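/- **Setting.** Let $(x,y)$ be a random pair with $x\in\mathbb R^d$ and $y\in\mathbb R$, let $\Sigma_x=\mathrm{cov}(x)$ and let $\Sigma_{E(x\mid y)}=\mathrm{cov}\{E(x\mid y)\}$. Let $\beta_1,\dots,\beta_K\in\mathbb R^d$ span the subspace $\mathcal V$, and assume that $y$ and $x$ are conditionally independent given $(\beta_1^{\mathsf T}x,\dots,\beta_K^{\mathsf T}x)$ and that the linearity condition holds: for every $a\in\mathbb R^d$ there are constants $b_0,\dots,b_K$ with $E(a^{\mathsf T}x\mid\beta_1^{\mathsf T}x,\dots,\beta_K^{\mathsf T}x)=b_0+\sum_k b_k\beta_k^{\mathsf T}x$. Let $\lambda_K>0$ be the $K$th largest generalized eigenvalue of the pair $\{\Sigma_{E(x\mid y)},\Sigma_x\}$, and let $s$ be the number of nonzero diagonal entries of the orthogonal projection matrix $P_{\mathcal V}$ onto $\mathcal V$. Assume $1\le K<\min(s,\log d)$. **Estimator.** Let $(x_1,y_1),\dots,(x_n,y_n)$ be independent copies of $(x,y)$, let $\hat\Sigma_x=n^{-1}\sum_i(x_i-\bar x)(x_i-\bar x)^{\mathsf T}$, let $x_{(i)^*}$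 be the covariate vector of the observation with the $i$th smallest response (ties broken by the index), and let $$\hat T=\frac1n\sum_{i=1}^{\lfloor n/2\rfloor}\{x_{(2i)^*}-x_{(2i-1)^*}\}\{x_{(2i)^*}-x_{(2i-1)^*}\}^{\mathsf T},\qquad \hat\Sigma_{E(x\mid y)}=\hat\Sigma_x-\hat T .$$ For $\rho>0$ let $\hat\Pi$ be any solution of $$\min_{\Pi\succeq0}\; -\mathrm{tr}\{\hat\Sigma_{E(x\mid y)}\Pi\}+\rho\sum_{i,j}|\Pi_{ij}|\quad\text{subject to}\quad \|\hat\Sigma_x^{1/2}\Pi\hat\Sigma_x^{1/2}\|_*\le K,\;\; \|\hat\Sigma_x^{1/2}\Pi\hat\Sigma_x^{1/2}\|_{\mathrm{sp}}\le1,$$ where $\|\cdot\|_*$ and $\|\cdot\|_{\mathrm{sp}}$ are the nuclear and the spectral norm. Let $\hat{\mathcal V}$ be the span of $K$ orthonormal eigenvectors of $\hat\Pi$ for its $K$ largest eigenvalues (any choice if there are ties), and let $D(\mathcal V,\hat{\mathcal V})=\|P_{\mathcal V}-P_{\hat{\mathcal V}}\|_{\mathrm F}$. **Theorem.** For every $c>0$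 there is an integer $\kappa\ge1$, for every $L>0$ there are constants $C,C_1,C_2,C_3,C_4>0$ depending only on $c$ and $L$, and for every real sequence $\tau_N\to0$ there is an $n_0$, such that the following holds for all $n\ge n_0$ and all $d,K,s$ and all distributions as above. Assume that 1. $y\in[-B,B]$ almost surely for some $B>0$, and a version $m$ of the inverse regression curve $m(y)=E(x\mid y)$ has total variation of order $1/4$ at rate $\tau$: $N^{-1/4}\sum_{i=2}^N\|m(t_i)-m(t_{i-1})\|_\infty\le\tau_N$ for all $N\geq 1$ and all $-B\le t_1\le\dots\le t_N\le B$; 2. $x$ is sub-Gaussian: $\|v^{\mathsf T}(x-Ex)\|_{\psi_2}\le L(v^{\mathsf T}\Sigma_xv)^{1/2}$ for all $v\in\mathbb R^d$, where $\|Z\|_{\psi_2}=\sup_{p\ge1}p^{-1/2}(E|Z|^p)^{1/p}$; 3. the sparse eigenvalues of $\Sigma_x$ at level $\kappa s^2$ are bounded: $c^{-1}\le v^{\mathsf T}\Sigma_xv/v^{\mathsf T}v\le c$ for all $v\ne0$ with at most $\kappa s^2$ nonzero entries; 4. $n>Cs^2\log d/\lambda_K^2$ and $\lambda_KK^2<s\log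 d$; 5. $C_1(\log d/n)^{1/2}\le\rho\le A(\log d/n)^{1/2}$ for some real $A$. Then, with probability at least $1-\exp(-C_3s)-\exp(-C_4\log d)$, every such $\hat\Pi$ and $\hat{\mathcal V}$ satisfy $$D(\mathcal V,\hat{\mathcal V})\le C_2\,A\,\frac{s}{\lambda_K}\Bigl(\frac{\log d}{n}\Bigr)^{1/2}.$$ -/

import Mathlib

open MeasureTheory ProbabilityTheory Filter Topology
open scoped Matrix MatrixOrder

namespace SparseSIR

noncomputable section

/-! ### Population quantities

A population is a law `P` of the pair `(x, y)`, with `x` in `ℝ^d` and `y` in `ℝ`. -/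

/-- The mean vector of `x`. -/
def meanVec {d : ℕ} (P : Measure ((Fin d → ℝ) × ℝ)) : Fin d → ℝ :=
  fun j => ∫ z, z.1 j ∂P

/-- The covariance matrix `Σ_x` of `x`. -/
def covX {d : ℕ} (P : Measure ((Fin d → ℝ) × ℝ)) : Matrix (Fin d) (Fin d) ℝ :=
  Matrix.of fun j k => covariance (fun z => z.1 j) (fun z => z.1 k) P

/-- The conditional expectation `E(x_j ∣ y)`, as a function of the pair `(x, y)`. -/
def condMeanX {d : ℕ} (P : Measure ((Fin d → ℝ) × ℝ)) (j : Fin d) :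
    (Fin d → ℝ) × ℝ → ℝ :=
  condExp (MeasurableSpace.comap (Prod.snd : (Fin d → ℝ) × ℝ → ℝ) inferInstance) P
    (fun z => z.1 j)

/-- The covariance matrix `Σ_{E(x ∣ y)}` of the conditional expectation `E(x ∣ y)`. -/
def covCondMean {d : ℕ} (P : Measure ((Fin d → ℝ) × ℝ)) : Matrix (Fin d) (Fin d) ℝ :=
  Matrix.of fun j k => covariance (condMeanX P j) (condMeanX P k) P

/-- `m` is a version of the inverse regression curve: `m(y) = E(x ∣ y)`. -/
def IsInverseRegressionCurve {d : ℕ} (P : Measure ((Fin d → ℝ) × ℝ))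
    (m : ℝ → Fin d → ℝ) : Prop :=
  Measurable m ∧ ∀ j, (fun z => m z.2 j) =ᵐ[P] condMeanX P j

/-- `m` has total variation of order `1/4` on `[-B, B]`, at rate `τ`: for every `N`, the sum
`∑_{i=2}^N ‖m(t_i) - m(t_{i-1})‖_∞` over any `N` points `-B ≤ t_1 ≤ ⋯ ≤ t_N ≤ B` is at most
`τ_N N^{1/4}`. (The norm of `Fin d → ℝ` is the maximum norm, and a partition with `N` points
is written as the first `N` terms of a monotone sequence.) -/
def HasVariationRate {d : ℕ} (B : ℝ) (τ : ℕ → ℝ) (m : ℝ → Fin d → ℝ) : Prop :=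
  ∀ N : ℕ, ∀ t : ℕ → ℝ, Monotone t → (∀ i, t i ∈ Set.Icc (-B) B) →
    ∑ i ∈ Finset.range (N - 1), ‖m (t (i + 1)) - m (t i)‖ ≤ τ N * (N : ℝ) ^ (1 / 4 : ℝ)

/-- The sub-Gaussian norm `sup_{p ≥ 1} p^{-1/2} (E|Z|^p)^{1/p}` of `Z` is at most `L`. -/
def SubGaussianNormLE {Ω : Type*} [MeasurableSpace Ω] (Z : Ω → ℝ) (L : ℝ) (P : Measure Ω) :
    Prop :=
  ∀ p : ℝ, 1 ≤ p → eLpNorm Z (ENNReal.ofReal p) P ≤ ENNReal.ofReal (L * Real.sqrt p)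

/-- `x` is a sub-Gaussian vector with parameter `L`: each `vᵀ(x - E x)` has sub-Gaussian norm at
most `L (vᵀ Σ_x v)^{1/2}`, that is `L` times its standard deviation. -/
def IsSubGaussianX {d : ℕ} (P : Measure ((Fin d → ℝ) × ℝ)) (L : ℝ) : Prop :=
  ∀ v : Fin d → ℝ, SubGaussianNormLE (fun z => v ⬝ᵥ (z.1 - meanVec P))
    (L * Real.sqrt (v ⬝ᵥ (covX P *ᵥ v))) P

/-- The number `‖v‖₀` of nonzero entries of `v`. -/
def nnzCount {d : ℕ} (v : Fin d → ℝ) : ℕ := Set.ncard {j | v j ≠ 0}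

/-- The `k`-sparse eigenvalues of `S` satisfy `c⁻¹ ≤ λ_min(S, k) ≤ λ_max(S, k) ≤ c`: every
quotient `vᵀSv / vᵀv` with `v ≠ 0`, `‖v‖₀ ≤ k` lies in `[c⁻¹, c]`. -/
def SparseEigenvaluesIn {d : ℕ} (S : Matrix (Fin d) (Fin d) ℝ) (k : ℕ) (c : ℝ) : Prop :=
  ∀ v : Fin d → ℝ, v ≠ 0 → nnzCount v ≤ k →
    c⁻¹ ≤ (v ⬝ᵥ (S *ᵥ v)) / (v ⬝ᵥ v) ∧ (v ⬝ᵥ (S *ᵥ v)) / (v ⬝ᵥ v) ≤ c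

/-- The reduced covariates `(β_1ᵀx, …, β_Kᵀx)`; the `β_k` are the columns of `β`. -/
def reducedX {d K : ℕ} (β : Matrix (Fin d) (Fin K) ℝ) (z : (Fin d → ℝ) × ℝ) : Fin K → ℝ :=
  βᵀ *ᵥ z.1

/-- The σ-algebra generated by `(β_1ᵀx, …, β_Kᵀx)`. -/
abbrev reducedSigma {d K : ℕ} (β : Matrix (Fin d) (Fin K) ℝ) :
    MeasurableSpace ((Fin d → ℝ) × ℝ) :=
  MeasurableSpace.comap (reducedX β) inferInstance

theorem measurable_reducedX {d K : ℕ} (β : Matrix (Fin d) (Fin K) ℝ) :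
    Measurable (reducedX β) := by
  have h : Continuous (reducedX β) := by
    unfold reducedX
    exact Continuous.matrix_mulVec continuous_const continuous_fst
  exact h.measurable

theorem reducedSigma_le {d K : ℕ} (β : Matrix (Fin d) (Fin K) ℝ) :
    reducedSigma β ≤ (inferInstance : MeasurableSpace ((Fin d → ℝ) × ℝ)) :=
  (measurable_reducedX β).comap_le

/-- `y` and `x` are conditionally independent given `(β_1ᵀx, …, β_Kᵀx)`: the columns of `β` span
a dimension reduction subspace. -/
def IsDimensionReduction {d K : ℕ} (P : Measure ((Fin d → ℝ) × ℝ)) [IsFiniteMeasure P]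
    (β : Matrix (Fin d) (Fin K) ℝ) : Prop :=
  CondIndepFun (reducedSigma β) (reducedSigma_le β)
    (Prod.snd : (Fin d → ℝ) × ℝ → ℝ) (Prod.fst : (Fin d → ℝ) × ℝ → Fin d → ℝ) P

/-- The linearity condition: for every `a`, the conditional expectation of `aᵀx` given
`(β_1ᵀx, …, β_Kᵀx)` is `b_0 + b_1 β_1ᵀx + ⋯ + b_K β_Kᵀx` for some constants. -/
def LinearityCondition {d K : ℕ} (P : Measure ((Fin d → ℝ) × ℝ))
    (β : Matrix (Fin d) (Fin K) ℝ) : Prop :=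
  ∀ a : Fin d → ℝ, ∃ (b₀ : ℝ) (b : Fin K → ℝ),
    condExp (reducedSigma β) P (fun z => a ⬝ᵥ z.1) =ᵐ[P] fun z => b₀ + b ⬝ᵥ reducedX β z

/-- `lam` is the `K`-th largest generalized eigenvalue of the pair `(A, S)`: there are
generalized eigenvectors `V_1, …, V_K` (the columns of `V`), orthonormal for `S`, with
eigenvalues `μ_1, …, μ_K` whose smallest is `lam`, and on the `S`-orthogonal complement of
`V_1, …, V_K` the generalized Rayleigh quotient does not exceed `lam`. -/
def IsKthGenEigenvalue {d : ℕ} (A S : Matrix (Fin d) (Fin d) ℝ) (K : ℕ) (lam : ℝ) : Prop :=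
  ∃ (V : Matrix (Fin d) (Fin K) ℝ) (μ : Fin K → ℝ),
    Vᵀ * S * V = 1 ∧ A * V = S * V * Matrix.diagonal μ ∧ IsLeast (Set.range μ) lam ∧
    ∀ v : Fin d → ℝ, Vᵀ *ᵥ (S *ᵥ v) = 0 → v ⬝ᵥ (A *ᵥ v) ≤ lam * (v ⬝ᵥ (S *ᵥ v))

/-! ### Subspaces -/

/-- The subspace of `ℝ^d` (with the Euclidean structure) spanned by the columns of `V`. -/
def colSpan {d K : ℕ} (V : Matrix (Fin d) (Fin K) ℝ) :
    Submodule ℝ (EuclideanSpace ℝ (Fin d)) :=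
  Submodule.span ℝ (Set.range fun k => WithLp.toLp 2 fun j => V j k)

/-- The matrix of the orthogonal projection onto the subspace `W`. -/
def projMatrix {d : ℕ} (W : Submodule ℝ (EuclideanSpace ℝ (Fin d))) :
    Matrix (Fin d) (Fin d) ℝ :=
  Matrix.of fun i j => (W.starProjection (EuclideanSpace.single j 1)) i

/-- The sparsity level of `W`: the number of nonzero diagonal entries of its projection. -/
def sparsityLevel {d : ℕ} (W : Submodule ℝ (EuclideanSpace ℝ (Fin d))) : ℕ :=
  Set.ncard {j | projMatrix W j j ≠ 0}

/-- The Frobenius norm of a matrix. -/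
def frobNorm {d : ℕ} (A : Matrix (Fin d) (Fin d) ℝ) : ℝ :=
  Real.sqrt (∑ i, ∑ j, A i j ^ 2)

/-- The distance `D(W, W')` between two subspaces: the Frobenius norm of the difference of their
projection matrices. -/
def subspaceDist {d : ℕ} (W W' : Submodule ℝ (EuclideanSpace ℝ (Fin d))) : ℝ :=
  frobNorm (projMatrix W - projMatrix W')

/-- `W` is spanned by `K` orthonormal eigenvectors of the symmetric matrix `A` for its `K`
largest eigenvalues (any choice is allowed when eigenvalues coincide). -/
def IsLeadingEigenspace {d : ℕ} (A : Matrix (Fin d) (Fin d) ℝ) (K : ℕ)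
    (W : Submodule ℝ (EuclideanSpace ℝ (Fin d))) : Prop :=
  ∃ (U : Matrix (Fin d) (Fin K) ℝ) (μ : Fin K → ℝ),
    Uᵀ * U = 1 ∧ A * U = U * Matrix.diagonal μ ∧
    (∀ k, ∀ v : Fin d → ℝ, Uᵀ *ᵥ v = 0 → v ⬝ᵥ (A *ᵥ v) ≤ μ k * (v ⬝ᵥ v)) ∧
    W = colSpan U

/-! ### The estimator

The data are `D : Fin n → (Fin d → ℝ) × ℝ`, where `D i = (x_i, y_i)`. -/

/-- The sample mean of the covariates. -/
def sampleMean {n d : ℕ} (D : Fin n → (Fin d → ℝ) × ℝ) : Fin d → ℝ :=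
  (n : ℝ)⁻¹ • ∑ i, (D i).1

/-- The sample covariance matrix `Σ̂_x` of the covariates. -/
def sampleCov {n d : ℕ} (D : Fin n → (Fin d → ℝ) × ℝ) : Matrix (Fin d) (Fin d) ℝ :=
  (n : ℝ)⁻¹ • ∑ i, Matrix.vecMulVec ((D i).1 - sampleMean D) ((D i).1 - sampleMean D)

/-- The concomitant `x_{(i)*}`: the covariate vector of the observation with the `i`-th smallest
response. Equal responses are ordered by their index in the sample. -/
def concomitant {n d : ℕ} (D : Fin n → (Fin d → ℝ) × ℝ) (i : Fin n) : Fin d → ℝ :=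
  (D (Tuple.sort (fun l => (D l).2) i)).1

/-- The difference `x_{(2i)*} - x_{(2i-1)*}`, with `i` counted from `0` here. -/
def concomitantDiff {n d : ℕ} (D : Fin n → (Fin d → ℝ) × ℝ) (i : Fin (n / 2)) : Fin d → ℝ :=
  concomitant D ⟨2 * i + 1, by have := i.isLt; omega⟩ -
    concomitant D ⟨2 * i, by have := i.isLt; omega⟩

/-- The estimator `T̂` of `E{cov(x ∣ y)}`. -/
def condCovEstimator {n d : ℕ} (D : Fin n → (Fin d → ℝ) × ℝ) : Matrix (Fin d) (Fin d) ℝ :=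
  (n : ℝ)⁻¹ • ∑ i : Fin (n / 2), Matrix.vecMulVec (concomitantDiff D i) (concomitantDiff D i)

/-- The estimator `Σ̂_{E(x ∣ y)} = Σ̂_x - T̂`. -/
def covCondMeanEstimator {n d : ℕ} (D : Fin n → (Fin d → ℝ) × ℝ) :
    Matrix (Fin d) (Fin d) ℝ :=
  sampleCov D - condCovEstimator D

/-- The matrix `S^{1/2} Q S^{1/2}`. -/
def sandwich {d : ℕ} (S Q : Matrix (Fin d) (Fin d) ℝ) : Matrix (Fin d) (Fin d) ℝ :=
  CFC.sqrt S * Q * CFC.sqrt S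

/-- The constraints: `Q` is symmetric positive semidefinite, `S^{1/2} Q S^{1/2}` has nuclear norm
at most `K` (it is positive semidefinite, so this norm is its trace) and spectral norm at
most `1`. -/
def IsFeasible {d : ℕ} (S : Matrix (Fin d) (Fin d) ℝ) (K : ℕ) (Q : Matrix (Fin d) (Fin d) ℝ) :
    Prop :=
  Q.PosSemidef ∧ (sandwich S Q).trace ≤ K ∧ ‖Matrix.toEuclideanCLM (𝕜 := ℝ) (sandwich S Q)‖ ≤ 1

/-- The objective `-tr(A Q) + ρ ‖Q‖₁`. -/
def penalizedObjective {d : ℕ} (A : Matrix (Fin d) (Fin d) ℝ) (ρ : ℝ)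
    (Q : Matrix (Fin d) (Fin d) ℝ) : ℝ :=
  -(A * Q).trace + ρ * ∑ i, ∑ j, |Q i j|

/-- `Q` solves the convex problem that defines `Π̂`. -/
def IsSIRSolution {n d : ℕ} (D : Fin n → (Fin d → ℝ) × ℝ) (K : ℕ) (ρ : ℝ)
    (Q : Matrix (Fin d) (Fin d) ℝ) : Prop :=
  IsFeasible (sampleCov D) K Q ∧
  ∀ Q' : Matrix (Fin d) (Fin d) ℝ, IsFeasible (sampleCov D) K Q' →
    penalizedObjective (covCondMeanEstimator D) ρ Q ≤
      penalizedObjective (covCondMeanEstimator D) ρ Q'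

end

end SparseSIR

/-!
# Sliced inverse regression by a penalized semidefinite program

The bound follows from a deterministic estimate on an event of high probability.

*Population.* Conditional independence and the linearity condition give
`E(x ∣ y) - E x ∈ Σ_x 𝒱` (`exists_linear_reduction`), so that `Σ_{E(x ∣ y)} = Σ_x U M Uᵀ Σ_x` with
`M = diag μ`, `Uᵀ Σ_x U = 1`, the columns of `U` spanning `𝒱`, and `λ_K ≤ μ_k ≤ 1`
(`exists_population_factorization`). The rows of `U` outside the `s` coordinates of the support of
`P_𝒱` vanish.

*Deterministic estimate* (`subspaceDist_le_of_deviation`). Write `S = Σ̂_x`. The comparison point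
`Π̃ = U (Uᵀ S U)⁻¹ Uᵀ` is feasible and spans `𝒱`, and `S^{1/2} Π̃ S^{1/2}` is a projection of rank
`K`. The linear objective `tr (S U M Uᵀ S Π)` has curvature at `Π̃` on the feasible set
(`fantope_curvature`): it drops by at least a multiple of `λ_K ‖S^{1/2} (Π̃ - Π) S^{1/2}‖_F²`. When
`ρ` dominates the entries of `Σ̂_{E(x ∣ y)} - S U M Uᵀ S`, optimality of `Π̂` puts `Π̂ - Π̃` in the
usual cone `‖Δ_{Iᶜ}‖₁ ≤ 3 ‖Δ_I‖₁`, with `I` a block of `s × s` entries. Peeling `Δ` into blocks of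
entries of decreasing size bounds `‖Δ‖_F` by `‖S^{1/2} Δ S^{1/2}‖_F` through the sparse eigenvalues
of `S` at the level `κ s²` (`le_frobNorm_sandwich_of_cone`), and a last application of the curvature
inequality turns `‖Π̂ - Π̃‖_F` into a distance of subspaces (`frobNorm_sub_le_of_leading`).

*Probability.* Products of sub-Gaussian variables are sub-exponential. This gives a Bernstein
inequality for all the averages involved (`measure_abs_sum_mul_sub_ge_le`), and, on a net of sparse
vectors, the sparse eigenvalues of `Σ̂_x` (`measure_not_sparse_sampleCov_le`). For `T̂`, write
`x = m(y) + ε`. The products of the residuals of the observations themselves average to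
`E(ε εᵀ) = Σ_x - Σ_{E(x ∣ y)}`. The products of the residuals of neighbouring observations are,
given the responses, independent and centred, and satisfy a Bernstein inequality as well
(`lintegral_exp_sum_neighbours_le`); for this the pair is represented as `x = f (y, u)` with an
independent uniform `u`. The increments of `m` between neighbours sum to at most `τ_n n^{1/4}`, and
`max |ε| = O((log n + log d)^{1/2})`, so that they contribute `O((log d / n)^{1/2})`
(`abs_condCovEstimator_sub_le`). Together this bounds the entries of `Σ̂_{E(x ∣ y)} - S U M Uᵀ S`
(`measure_not_forall_entry_le`).
-/

namespace SparseSIR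

/-! ### Traces, the Frobenius norm and a curvature inequality -/

section LinearAlgebra

variable {d K : ℕ}

theorem posSemidef_of_transpose_eq {m : ℕ} {A : Matrix (Fin m) (Fin m) ℝ} (h : Aᵀ = A)
    (h0 : ∀ x, 0 ≤ x ⬝ᵥ (A *ᵥ x)) : A.PosSemidef :=
  .of_dotProduct_mulVec_nonneg
    (by rw [Matrix.IsHermitian, Matrix.conjTranspose_eq_transpose_of_trivial, h])
    (fun x => by simpa using h0 x)

theorem transpose_eq_of_posSemidef {m : ℕ} {A : Matrix (Fin m) (Fin m) ℝ} (h : A.PosSemidef) :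
    Aᵀ = A := by
  rw [← Matrix.conjTranspose_eq_transpose_of_trivial]; exact h.1

theorem dotProduct_nonneg_of_posSemidef {m : ℕ} {A : Matrix (Fin m) (Fin m) ℝ}
    (h : A.PosSemidef) (x : Fin m → ℝ) : 0 ≤ x ⬝ᵥ (A *ᵥ x) := by
  simpa using h.dotProduct_mulVec_nonneg x

theorem posSemidef_conj {m k : ℕ} {A : Matrix (Fin m) (Fin m) ℝ} (h : A.PosSemidef)
    (B : Matrix (Fin k) (Fin m) ℝ) : (B * A * Bᵀ).PosSemidef := by
  have := h.mul_mul_conjTranspose_same B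
  rwa [Matrix.conjTranspose_eq_transpose_of_trivial] at this

theorem sqrt_mul_sqrt_of_posSemidef {m : ℕ} {S : Matrix (Fin m) (Fin m) ℝ}
    (h : S.PosSemidef) : CFC.sqrt S * CFC.sqrt S = S :=
  CFC.sqrt_mul_sqrt_self S (Matrix.nonneg_iff_posSemidef.2 h)

theorem sqrt_posSemidef {m : ℕ} (S : Matrix (Fin m) (Fin m) ℝ) : (CFC.sqrt S).PosSemidef :=
  Matrix.nonneg_iff_posSemidef.1 (CFC.sqrt_nonneg S)

theorem sqrt_transpose {m : ℕ} (S : Matrix (Fin m) (Fin m) ℝ) :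
    (CFC.sqrt S)ᵀ = CFC.sqrt S :=
  transpose_eq_of_posSemidef (sqrt_posSemidef S)

theorem trace_mul_nonneg_of_posSemidef {m : ℕ} {A B : Matrix (Fin m) (Fin m) ℝ}
    (hA : A.PosSemidef) (hB : B.PosSemidef) : 0 ≤ (A * B).trace := by
  have h := (posSemidef_conj hA (CFC.sqrt B)).trace_nonneg
  rw [sqrt_transpose, Matrix.mul_assoc, Matrix.trace_mul_comm, Matrix.mul_assoc,
    sqrt_mul_sqrt_of_posSemidef hB] at h
  exact h

theorem frobNorm_nonneg (A : Matrix (Fin d) (Fin d) ℝ) : 0 ≤ frobNorm A := Real.sqrt_nonneg _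

theorem frobNorm_sq (A : Matrix (Fin d) (Fin d) ℝ) : frobNorm A ^ 2 = ∑ i, ∑ j, A i j ^ 2 :=
  Real.sq_sqrt (by positivity)

theorem frobNorm_sq_eq_trace (A : Matrix (Fin d) (Fin d) ℝ) :
    frobNorm A ^ 2 = (A * Aᵀ).trace := by
  rw [frobNorm_sq]
  simp [Matrix.trace, Matrix.mul_apply, sq]

theorem frobNorm_transpose (A : Matrix (Fin d) (Fin d) ℝ) : frobNorm Aᵀ = frobNorm A := by
  unfold frobNorm
  rw [Finset.sum_comm]
  rfl

theorem trace_mul_le_frobNorm (A B : Matrix (Fin d) (Fin d) ℝ) :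
    (A * B).trace ≤ frobNorm A * frobNorm B := by
  rw [← frobNorm_transpose B]
  have h := Real.sum_mul_le_sqrt_mul_sqrt (Finset.univ : Finset (Fin d × Fin d))
    (fun p => A p.1 p.2) (fun p => B p.2 p.1)
  simp only [Fintype.sum_prod_type] at h
  exact h

/-- The linear functional `X ↦ tr(M X)` grows quadratically away from a projection `F₀` at which
it is maximal over the Fantope-like set `{0 ≤ F ≤ 1, tr F ≤ tr F₀}`: if `M` dominates `lam F₀`
and lives on the range of `F₀`, then leaving `F₀` costs at least `lam / 2` times the squared
Frobenius distance. -/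
theorem fantope_curvature {M F₀ F : Matrix (Fin d) (Fin d) ℝ} {lam k : ℝ} (hlam : 0 ≤ lam)
    (hsym : F₀ᵀ = F₀) (hidem : F₀ * F₀ = F₀) (htr : F₀.trace = k) (hM : M * F₀ = M)
    (hdom : (M - lam • F₀).PosSemidef) (hF : F.PosSemidef) (hF1 : (1 - F).PosSemidef)
    (hFk : F.trace ≤ k) :
    lam / 2 * frobNorm (F₀ - F) ^ 2 ≤ (M * (F₀ - F)).trace := by
  have h1 := trace_mul_nonneg_of_posSemidef hdom hF1
  have h2 := trace_mul_nonneg_of_posSemidef hF hF1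
  rw [frobNorm_sq_eq_trace, Matrix.transpose_sub, hsym, transpose_eq_of_posSemidef hF]
  have e3 : (F * F₀).trace = (F₀ * F).trace := Matrix.trace_mul_comm _ _
  simp only [Matrix.sub_mul, Matrix.mul_sub, Matrix.mul_one, Matrix.trace_sub, Matrix.smul_mul,
    Matrix.trace_smul, smul_eq_mul, hidem, hM, htr, e3] at h1 h2 ⊢
  nlinarith

/-- Ky Fan's principle: among the projections of rank `K`, the projection onto the span of `K`
leading eigenvectors maximizes `P ↦ tr(Q P)`. -/
theorem trace_mul_le_of_leading {Q P : Matrix (Fin d) (Fin d) ℝ} {U : Matrix (Fin d) (Fin K) ℝ}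
    {μ : Fin K → ℝ} (hK : 0 < K) (hQ : Qᵀ = Q) (hU : Uᵀ * U = 1)
    (hQU : Q * U = U * Matrix.diagonal μ)
    (hlead : ∀ k, ∀ v : Fin d → ℝ, Uᵀ *ᵥ v = 0 → v ⬝ᵥ (Q *ᵥ v) ≤ μ k * (v ⬝ᵥ v))
    (hP : Pᵀ = P) (hPP : P * P = P) (htr : P.trace = K) :
    (Q * P).trace ≤ (Q * (U * Uᵀ)).trace := by
  have : Nonempty (Fin K) := ⟨⟨0, hK⟩⟩
  obtain ⟨k₀, hk₀⟩ := Finite.exists_min μ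
  set E := U * Uᵀ with hE
  have hEE : E * E = E := by
    rw [hE, Matrix.mul_assoc, ← Matrix.mul_assoc Uᵀ, hU, Matrix.one_mul]
  have hEt : Eᵀ = E := by simp [hE]
  have hQE : Q * E = U * Matrix.diagonal μ * Uᵀ := by rw [hE, ← Matrix.mul_assoc, hQU]
  have hEQ : E * Q = Q * E := by
    have := congrArg Matrix.transpose hQE
    rw [Matrix.transpose_mul, hEt, hQ] at this
    rw [this, hQE]
    simp [Matrix.mul_assoc]
  have htrE : E.trace = K := by
    rw [hE, Matrix.trace_mul_comm, hU, Matrix.trace_one]; simp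
  have hUE : Uᵀ * E = Uᵀ := by rw [hE, ← Matrix.mul_assoc, hU, Matrix.one_mul]
  have hT1 : (μ k₀ • (1 - E) - Q * (1 - E)).PosSemidef := by
    have hcomm : Q * (1 - E) = (1 - E) * Q * (1 - E) := by
      simp only [Matrix.sub_mul, Matrix.mul_sub, Matrix.one_mul, Matrix.mul_one, hEQ,
        Matrix.mul_assoc, hEE]
      simp
    have h1E : (1 - E) = (1 - E)ᵀ * (1 - E) := by
      simp [Matrix.sub_mul, Matrix.mul_sub, hEE, hEt]
    apply posSemidef_of_transpose_eq
    · simp [Matrix.mul_sub, hEt, hQ, hEQ]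
    · intro x
      have hv := hlead k₀ ((1 - E) *ᵥ x) (by
        rw [Matrix.mulVec_mulVec, Matrix.mul_sub, hUE, Matrix.mul_one, sub_self,
          Matrix.zero_mulVec])
      have e1 : x ⬝ᵥ ((1 - E) *ᵥ x) = ((1 - E) *ᵥ x) ⬝ᵥ ((1 - E) *ᵥ x) := by
        conv_lhs => rw [h1E]
        rw [← Matrix.mulVec_mulVec, Matrix.dotProduct_mulVec, Matrix.vecMul_transpose]
      have e2 : x ⬝ᵥ ((Q * (1 - E)) *ᵥ x)
          = ((1 - E) *ᵥ x) ⬝ᵥ (Q *ᵥ ((1 - E) *ᵥ x)) := by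
        rw [hcomm]
        have : (1 - E) = (1 - E)ᵀ := by simp [hEt]
        conv_lhs => rw [Matrix.mul_assoc, ← Matrix.mulVec_mulVec, this, Matrix.dotProduct_mulVec,
          Matrix.vecMul_transpose, ← this, ← Matrix.mulVec_mulVec]
      rw [Matrix.sub_mulVec, Matrix.smul_mulVec, dotProduct_sub, dotProduct_smul, e2, e1,
        smul_eq_mul]
      linarith
  have hT2 : (Q * E - μ k₀ • E).PosSemidef := by
    have : Q * E - μ k₀ • E = U * Matrix.diagonal (fun k => μ k - μ k₀) * Uᵀ := by
      rw [hQE, hE]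
      have : Matrix.diagonal (fun k => μ k - μ k₀)
          = Matrix.diagonal μ - μ k₀ • (1 : Matrix (Fin K) (Fin K) ℝ) := by
        ext i j; by_cases h : i = j <;> simp [h, Matrix.diagonal]
      rw [this]
      simp [Matrix.mul_sub, Matrix.sub_mul]
    rw [this]
    refine posSemidef_conj ?_ U
    exact Matrix.PosSemidef.diagonal (fun k => by simpa using hk₀ k)
  have hPpsd : P.PosSemidef := by
    have := posSemidef_conj (Matrix.PosSemidef.one (n := Fin d) (R := ℝ)) P
    rwa [Matrix.mul_one, hP, hPP] at this
  have h1P : (1 - P).PosSemidef := by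
    have := posSemidef_conj (Matrix.PosSemidef.one (n := Fin d) (R := ℝ)) (1 - P)
    simpa [Matrix.mul_sub, Matrix.sub_mul, hP, hPP] using this
  have i1 := trace_mul_nonneg_of_posSemidef hT1 hPpsd
  have i2 := trace_mul_nonneg_of_posSemidef hT2 h1P
  simp only [Matrix.sub_mul, Matrix.mul_sub, Matrix.mul_one, Matrix.one_mul, Matrix.trace_sub,
    Matrix.smul_mul, Matrix.trace_smul, smul_eq_mul, htr, htrE, smul_sub] at i1 i2 ⊢
  linarith

/-- A Davis–Kahan bound: if `M` dominates `σ P` and lives on the range of the projection `P`, the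
leading eigenspace of a matrix `Q` close to `M` is close to the range of `P`. -/
theorem frobNorm_sub_le_of_leading {Q M P : Matrix (Fin d) (Fin d) ℝ}
    {U : Matrix (Fin d) (Fin K) ℝ} {μ : Fin K → ℝ} {σ : ℝ} (hσ : 0 < σ) (hK : 0 < K)
    (hQ : Qᵀ = Q) (hU : Uᵀ * U = 1) (hQU : Q * U = U * Matrix.diagonal μ)
    (hlead : ∀ k, ∀ v : Fin d → ℝ, Uᵀ *ᵥ v = 0 → v ⬝ᵥ (Q *ᵥ v) ≤ μ k * (v ⬝ᵥ v))
    (hP : Pᵀ = P) (hPP : P * P = P) (htr : P.trace = K) (hMP : M * P = M)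
    (hdom : (M - σ • P).PosSemidef) :
    frobNorm (P - U * Uᵀ) ≤ 2 / σ * frobNorm (M - Q) := by
  have hEE : (U * Uᵀ) * (U * Uᵀ) = U * Uᵀ := by
    rw [Matrix.mul_assoc, ← Matrix.mul_assoc Uᵀ, hU, Matrix.one_mul]
  have hE : (U * Uᵀ).PosSemidef := by
    simpa using posSemidef_conj (Matrix.PosSemidef.one (n := Fin K) (R := ℝ)) U
  have h1E : (1 - U * Uᵀ).PosSemidef := by
    have := posSemidef_conj (Matrix.PosSemidef.one (n := Fin d) (R := ℝ)) (1 - U * Uᵀ)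
    simpa [Matrix.mul_sub, Matrix.sub_mul, hEE] using this
  have htrE : (U * Uᵀ).trace ≤ K := by
    rw [Matrix.trace_mul_comm, hU, Matrix.trace_one]; simp
  have h1 := fantope_curvature hσ.le hP hPP htr hMP hdom hE h1E htrE
  have h2 := trace_mul_le_of_leading hK hQ hU hQU hlead hP hPP htr
  have h3 := trace_mul_le_frobNorm (M - Q) (P - U * Uᵀ)
  have h4 : (M * (P - U * Uᵀ)).trace
      ≤ ((M - Q) * (P - U * Uᵀ)).trace := by
    simp only [Matrix.sub_mul, Matrix.mul_sub, Matrix.trace_sub]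
    linarith
  have h0 := frobNorm_nonneg (P - U * Uᵀ)
  have h5 := frobNorm_nonneg (M - Q)
  rcases h0.eq_or_lt with h | h
  · rw [← h]; positivity
  · have : frobNorm (P - U * Uᵀ) * σ ≤ 2 * frobNorm (M - Q) := by
      nlinarith
    rw [div_mul_eq_mul_div, le_div_iff₀ hσ]
    exact this

/-! ### Projections onto column spans -/

theorem toLp_mulVec_mem_colSpan (V : Matrix (Fin d) (Fin K) ℝ) (y : Fin K → ℝ) :
    WithLp.toLp 2 (V *ᵥ y) ∈ colSpan V := by
  have : WithLp.toLp 2 (V *ᵥ y) = ∑ k, y k • (WithLp.toLp 2 fun j => V j k) := by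
    ext j
    simp [Matrix.mulVec, dotProduct, mul_comm]
  rw [this]
  exact Submodule.sum_mem _ fun k _ =>
    Submodule.smul_mem _ _ (Submodule.subset_span ⟨k, rfl⟩)

theorem projMatrix_colSpan {V : Matrix (Fin d) (Fin K) ℝ} (hV : IsUnit (Vᵀ * V).det) :
    projMatrix (colSpan V) = V * (Vᵀ * V)⁻¹ * Vᵀ := by
  ext i j
  have key : (colSpan V).starProjection (EuclideanSpace.single j 1)
      = WithLp.toLp 2 (V *ᵥ (((Vᵀ * V)⁻¹ * Vᵀ) *ᵥ (Pi.single j 1))) := by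
    apply Submodule.eq_starProjection_of_mem_of_inner_eq_zero (toLp_mulVec_mem_colSpan _ _)
    intro w hw
    induction hw using Submodule.span_induction with
    | mem w hw =>
      obtain ⟨k, rfl⟩ := hw
      have : Vᵀ *ᵥ (Pi.single j 1 - V *ᵥ (((Vᵀ * V)⁻¹ * Vᵀ) *ᵥ (Pi.single j 1))) = 0 := by
        rw [Matrix.mulVec_sub, Matrix.mulVec_mulVec, Matrix.mulVec_mulVec, ← Matrix.mul_assoc,
          Matrix.mul_nonsing_inv _ hV, Matrix.one_mul, sub_self]
      have := congrFun this k
      simpa [EuclideanSpace.inner_eq_star_dotProduct, Matrix.mulVec, dotProduct, PiLp.inner_apply,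
        Pi.single_apply, mul_comm] using this
    | zero => simp
    | add x y _ _ hx hy => rw [inner_add_right, hx, hy, add_zero]
    | smul a x _ hx => rw [inner_smul_right, hx, mul_zero]
  simp only [projMatrix, Matrix.of_apply, key]
  rw [Matrix.mulVec_mulVec, ← Matrix.mul_assoc]
  simp

theorem colSpan_mul_of_isUnit_det (V : Matrix (Fin d) (Fin K) ℝ) {X : Matrix (Fin K) (Fin K) ℝ}
    (hX : IsUnit X.det) : colSpan (V * X) = colSpan V := by
  have key : ∀ (V : Matrix (Fin d) (Fin K) ℝ) (X : Matrix (Fin K) (Fin K) ℝ),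
      colSpan (V * X) ≤ colSpan V := by
    intro V X
    refine Submodule.span_le.2 ?_
    rintro _ ⟨k, rfl⟩
    exact toLp_mulVec_mem_colSpan V (fun l => X l k)
  refine le_antisymm (key V X) ?_
  have := key (V * X) X⁻¹
  rwa [Matrix.mul_assoc, Matrix.mul_nonsing_inv _ hX, Matrix.mul_one] at this

end LinearAlgebra

end SparseSIR

namespace SparseSIR

/-! ### Restricted eigenvalues on a cone -/

section Peeling

variable {ι : Type*}

theorem exists_top_subset [DecidableEq ι] (f : ι → ℝ) (T : Finset ι) {m : ℕ} (hm : m ≤ T.card) :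
    ∃ B ⊆ T, B.card = m ∧ ∀ i ∈ B, ∀ j ∈ T \ B, f j ≤ f i := by
  induction m with
  | zero => exact ⟨∅, by simp, by simp, by simp⟩
  | succ m ih =>
    obtain ⟨B, hBT, hBm, hB⟩ := ih (by omega)
    have hne : (T \ B).Nonempty := by
      rw [← Finset.card_pos, Finset.card_sdiff_of_subset hBT]; omega
    obtain ⟨i₀, hi₀, hmax⟩ := Finset.exists_max_image (T \ B) f hne
    have hi := Finset.mem_sdiff.1 hi₀
    refine ⟨insert i₀ B, Finset.insert_subset hi.1 hBT, ?_, ?_⟩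
    · rw [Finset.card_insert_of_notMem hi.2, hBm]
    · intro i hiB j hj
      have hj' : j ∈ T \ B := by
        simp only [Finset.mem_sdiff, Finset.mem_insert, not_or] at hj ⊢
        exact ⟨hj.1, hj.2.2⟩
      rcases Finset.mem_insert.1 hiB with rfl | h
      · exact hmax j hj'
      · exact hB i h j hj'

theorem sqrt_sum_sq_le_of_abs_le (B : Finset ι) (a : ι → ℝ) {q : ℝ} (hq : 0 ≤ q)
    (h : ∀ i ∈ B, |a i| ≤ q) {m : ℕ} (hm : B.card ≤ m) :
    √(∑ i ∈ B, a i ^ 2) ≤ √m * q := by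
  rw [Real.sqrt_le_left (by positivity), mul_pow, Real.sq_sqrt (by positivity)]
  calc ∑ i ∈ B, a i ^ 2 ≤ ∑ i ∈ B, q ^ 2 :=
        Finset.sum_le_sum fun i hi => sq_le_sq' (by linarith [neg_abs_le (a i), h i hi])
          ((le_abs_self _).trans (h i hi))
    _ = B.card * q ^ 2 := by simp
    _ ≤ m * q ^ 2 := by gcongr

theorem indicator_add_indicator_sdiff [DecidableEq ι] (a : ι → ℝ) {B T : Finset ι} (h : B ⊆ T) :
    (T : Set ι).indicator a
      = (B : Set ι).indicator a + ((T \ B : Finset ι) : Set ι).indicator a := by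
  ext i
  by_cases hB : i ∈ B
  · simp [hB, h hB]
  · by_cases hT : i ∈ T <;> simp [hB, hT]

/-- A sublinear functional that is bounded by `φ` times the Euclidean norm on `m`-sparse vectors
is bounded by a combination of the maximum norm and the `ℓ¹` norm: split off the `m` largest
entries repeatedly. -/
theorem sublinear_indicator_le [DecidableEq ι] {p : (ι → ℝ) → ℝ}
    (hadd : ∀ x y, p (x + y) ≤ p x + p y) {φ : ℝ}
    (hφ : 0 ≤ φ) {m : ℕ} (hm : 0 < m) (a : ι → ℝ)
    (hp : ∀ B : Finset ι, B.card ≤ m →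
      p ((B : Set ι).indicator a) ≤ φ * √(∑ i ∈ B, a i ^ 2)) :
    ∀ (n : ℕ) (T : Finset ι) (q : ℝ), T.card ≤ n → 0 ≤ q → (∀ i ∈ T, |a i| ≤ q) →
      p ((T : Set ι).indicator a) ≤ φ * (√m * q + (∑ i ∈ T, |a i|) / √m) := by
  have hm' : (0 : ℝ) < √m := Real.sqrt_pos.2 (by exact_mod_cast hm)
  have hmm : √(m : ℝ) * √m = m := Real.mul_self_sqrt (by positivity)
  intro n
  induction n with
  | zero =>
    intro T q hT hq h
    have : T = ∅ := by simpa using hT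
    subst this
    refine (hp ∅ (by simp)).trans ?_
    have : (0 : ℝ) ≤ φ * (√m * q) := by positivity
    simpa using this
  | succ n ih =>
    intro T q hT hq h
    by_cases hTm : T.card ≤ m
    · refine (hp T hTm).trans ?_
      have h1 := sqrt_sum_sq_le_of_abs_le T a hq h hTm
      have h2 : 0 ≤ (∑ i ∈ T, |a i|) / √m :=
        div_nonneg (Finset.sum_nonneg fun i _ => abs_nonneg _) hm'.le
      exact mul_le_mul_of_nonneg_left (by linarith) hφ
    · obtain ⟨B, hBT, hBm, hB⟩ := exists_top_subset (fun i => |a i|) T (not_le.1 hTm).le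
      set q' := (∑ i ∈ B, |a i|) / m with hq'
      have hq'0 : 0 ≤ q' := div_nonneg (Finset.sum_nonneg fun i _ => abs_nonneg _) (by positivity)
      have hle : ∀ j ∈ T \ B, |a j| ≤ q' := by
        intro j hj
        rw [hq', le_div_iff₀ (by exact_mod_cast hm)]
        calc |a j| * m = ∑ i ∈ B, |a j| := by simp [hBm, mul_comm]
          _ ≤ ∑ i ∈ B, |a i| := Finset.sum_le_sum fun i hi => hB i hi j hj
      have h1 := ih (T \ B) q' (by rw [Finset.card_sdiff_of_subset hBT]; omega) hq'0 hle
      have h2 := (hp B hBm.le).trans (mul_le_mul_of_nonneg_left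
        (sqrt_sum_sq_le_of_abs_le B a hq (fun i hi => h i (hBT hi)) hBm.le) hφ)
      rw [indicator_add_indicator_sdiff a hBT]
      refine (hadd _ _).trans ((add_le_add h2 h1).trans (le_of_eq ?_))
      have h3 : √m * q' = (∑ i ∈ B, |a i|) / √m := by
        rw [hq', eq_div_iff hm'.ne']
        field_simp
        rw [Real.sq_sqrt (by positivity), mul_comm]
      rw [h3, ← Finset.sum_sdiff hBT]
      ring

/-- After the `m` largest entries on `T` are split off, a sublinear functional of the rest is
controlled by the `ℓ¹` norm on `T`. The same split works for all functionals. -/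
theorem exists_split_sublinear_le [DecidableEq ι] (a : ι → ℝ) {m : ℕ} (hm : 0 < m) (T : Finset ι) :
    ∃ B ⊆ T, B.card ≤ m ∧ ∀ (p : (ι → ℝ) → ℝ) (φ : ℝ), 0 ≤ φ →
      (∀ x y, p (x + y) ≤ p x + p y) →
      (∀ B : Finset ι, B.card ≤ m →
        p ((B : Set ι).indicator a) ≤ φ * √(∑ i ∈ B, a i ^ 2)) →
      p (((T \ B : Finset ι) : Set ι).indicator a) ≤ φ * ((∑ i ∈ T, |a i|) / √m) := by
  have hm' : (0 : ℝ) < √m := Real.sqrt_pos.2 (by exact_mod_cast hm)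
  have hmm : √(m : ℝ) * √m = m := Real.mul_self_sqrt (by positivity)
  by_cases hTm : T.card ≤ m
  · refine ⟨T, subset_rfl, hTm, fun p φ hφ _ hp => ?_⟩
    have h := hp ∅ (by simp)
    simp only [Finset.coe_empty, Set.indicator_empty, Finset.sum_empty, Real.sqrt_zero,
      mul_zero, sdiff_self, Finset.bot_eq_empty] at h ⊢
    exact h.trans (mul_nonneg hφ (div_nonneg (Finset.sum_nonneg fun i _ => abs_nonneg _) hm'.le))
  · obtain ⟨B, hBT, hBm, hB⟩ := exists_top_subset (fun i => |a i|) T (not_le.1 hTm).le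
    refine ⟨B, hBT, hBm.le, fun p φ hφ hadd hp => ?_⟩
    set q' := (∑ i ∈ B, |a i|) / m with hq'
    have hq'0 : 0 ≤ q' := div_nonneg (Finset.sum_nonneg fun i _ => abs_nonneg _) (by positivity)
    have hle : ∀ j ∈ T \ B, |a j| ≤ q' := by
      intro j hj
      rw [hq', le_div_iff₀ (by exact_mod_cast hm)]
      calc |a j| * m = ∑ i ∈ B, |a j| := by simp [hBm, mul_comm]
        _ ≤ ∑ i ∈ B, |a i| := Finset.sum_le_sum fun i hi => hB i hi j hj
    have h1 := sublinear_indicator_le hadd hφ hm a hp _ (T \ B) q' le_rfl hq'0 hle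
    have h3 : √m * q' = (∑ i ∈ B, |a i|) / √m := by
      rw [hq', eq_div_iff hm'.ne']
      field_simp
      rw [Real.sq_sqrt (by positivity), mul_comm]
    rw [h3] at h1
    refine h1.trans (le_of_eq ?_)
    rw [← Finset.sum_sdiff hBT]
    ring

theorem sqrt_sum_sq_add_le [Fintype ι] (x y : ι → ℝ) :
    √(∑ i, (x + y) i ^ 2) ≤ √(∑ i, x i ^ 2) + √(∑ i, y i ^ 2) := by
  have h := norm_add_le (WithLp.toLp 2 x : EuclideanSpace ℝ ι) (WithLp.toLp 2 y)
  simpa [EuclideanSpace.norm_eq, ← WithLp.toLp_add] using h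

theorem sum_indicator_sq [Fintype ι] (a : ι → ℝ) (B : Finset ι) :
    ∑ i, (B : Set ι).indicator a i ^ 2 = ∑ i ∈ B, a i ^ 2 := by
  rw [← Finset.sum_subset (Finset.subset_univ B)]
  · exact Finset.sum_congr rfl fun i hi => by simp [hi]
  · intro i _ hi; simp [hi]

/-- A seminorm that is comparable to the Euclidean norm on sparse vectors is bounded below on the
cone of vectors whose `ℓ¹` mass off the set `S` is at most three times the mass on `S`. -/
theorem le_seminorm_of_cone [DecidableEq ι] [Fintype ι] {N : (ι → ℝ) → ℝ}
    (hadd : ∀ x y, N (x + y) ≤ N x + N y) (hneg : ∀ x, N (-x) = N x)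
    {φ₁ φ₂ : ℝ} (h1 : 0 ≤ φ₁) (h12 : φ₁ ≤ φ₂) {r k₀ : ℕ} (hr : 0 < r) (hk₀ : 0 < k₀)
    (a : ι → ℝ)
    (hlow : ∀ B : Finset ι, B.card ≤ (k₀ + 1) * r →
      φ₁ * √(∑ i ∈ B, a i ^ 2) ≤ N ((B : Set ι).indicator a))
    (hupp : ∀ B : Finset ι, B.card ≤ (k₀ + 1) * r →
      N ((B : Set ι).indicator a) ≤ φ₂ * √(∑ i ∈ B, a i ^ 2))
    (hratio : 6 * φ₂ ≤ φ₁ * √k₀) (hk6 : 6 ≤ √(k₀ : ℝ))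
    {S : Finset ι} (hS : S.card ≤ r) (hcone : ∑ i ∈ Sᶜ, |a i| ≤ 3 * ∑ i ∈ S, |a i|) :
    φ₁ / 4 * √(∑ i, a i ^ 2) ≤ N a := by
  have hm : 0 < k₀ * r := by positivity
  obtain ⟨B, hBT, hBm, hB⟩ := exists_split_sublinear_le a hm Sᶜ
  have hdis : Disjoint S B := by
    rw [Finset.disjoint_right]
    intro i hi
    exact Finset.mem_compl.1 (hBT hi)
  set S₁ := S ∪ B with hS₁
  have hS₁c : S₁ᶜ = Sᶜ \ B := by
    ext i; simp [hS₁]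
  have hcard : S₁.card ≤ (k₀ + 1) * r := by
    refine (Finset.card_union_le _ _).trans ?_
    linarith
  set ℓ := √(∑ i ∈ S₁, a i ^ 2) with hℓ
  have hℓ0 : 0 ≤ ℓ := Real.sqrt_nonneg _
  have hk0' : (0 : ℝ) < √k₀ := by linarith
  have hr' : (0 : ℝ) < √r := Real.sqrt_pos.2 (by exact_mod_cast hr)
  have hSl : ∑ i ∈ S, |a i| ≤ √r * ℓ := by
    have hcs := Real.sum_mul_le_sqrt_mul_sqrt S (fun _ => (1 : ℝ)) (fun i => |a i|)
    simp only [one_mul, one_pow, sq_abs, Finset.sum_const, nsmul_eq_mul, mul_one] at hcs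
    refine hcs.trans ?_
    gcongr
    exact Real.sqrt_le_sqrt (Finset.sum_le_sum_of_subset_of_nonneg Finset.subset_union_left
      fun _ _ _ => sq_nonneg _)
  have htail : (∑ i ∈ Sᶜ, |a i|) / √((k₀ * r : ℕ) : ℝ) ≤ 3 * ℓ / √k₀ := by
    push_cast
    rw [Real.sqrt_mul (by positivity), div_le_div_iff₀ (by positivity) hk0']
    have : ∑ i ∈ Sᶜ, |a i| ≤ 3 * (√r * ℓ) := hcone.trans (by linarith)
    calc (∑ i ∈ Sᶜ, |a i|) * √k₀ ≤ 3 * (√r * ℓ) * √k₀ := by gcongr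
      _ = 3 * ℓ * (√k₀ * √r) := by ring
  have hmle : k₀ * r ≤ (k₀ + 1) * r := by nlinarith
  have hN := hB N φ₂ (h1.trans h12) hadd (fun B' hB' => hupp B' (hB'.trans hmle))
  have hL := hB (fun x => √(∑ i, x i ^ 2)) 1 zero_le_one sqrt_sum_sq_add_le
    (fun B' _ => by rw [sum_indicator_sq, one_mul])
  have hsplit : a = (S₁ : Set ι).indicator a + ((Sᶜ \ B : Finset ι) : Set ι).indicator a := by
    have := indicator_add_indicator_sdiff a (Finset.subset_univ S₁)
    rwa [← Finset.compl_eq_univ_sdiff, hS₁c, Finset.coe_univ, Set.indicator_univ] at this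
  set x := (S₁ : Set ι).indicator a with hx
  set y := ((Sᶜ \ B : Finset ι) : Set ι).indicator a with hy
  have hNx : φ₁ * ℓ ≤ N x := hlow S₁ hcard
  have hNy : N y ≤ φ₂ * (3 * ℓ / √k₀) :=
    hN.trans (mul_le_mul_of_nonneg_left htail (h1.trans h12))
  have hLx : √(∑ i, x i ^ 2) = ℓ := by rw [hx, sum_indicator_sq]
  have hLa : √(∑ i, a i ^ 2) ≤ ℓ + 3 * ℓ / √k₀ := by
    have := sqrt_sum_sq_add_le x y
    rw [← hsplit, hLx] at this
    simp only [one_mul] at hL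
    linarith
  have hNa : N x ≤ N a + N y := by
    have := hadd a (-y)
    rw [hneg, show a + -y = x by rw [hsplit]; abel] at this
    exact this
  have e1 : φ₂ * (3 * ℓ / √k₀) ≤ φ₁ / 2 * ℓ := by
    rw [mul_div_assoc', div_le_iff₀ hk0']
    nlinarith
  have e2 : 3 * ℓ / √k₀ ≤ ℓ := by
    rw [div_le_iff₀ hk0']
    nlinarith
  nlinarith

end Peeling

section RestrictedEigenvalue

variable {d : ℕ}

theorem frobNorm_eq_sqrt_sum_prod (A : Matrix (Fin d) (Fin d) ℝ) :
    frobNorm A = √(∑ p : Fin d × Fin d, A p.1 p.2 ^ 2) := by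
  rw [frobNorm, Fintype.sum_prod_type]

theorem frobNorm_add_le (A B : Matrix (Fin d) (Fin d) ℝ) :
    frobNorm (A + B) ≤ frobNorm A + frobNorm B := by
  simp only [frobNorm_eq_sqrt_sum_prod]
  exact sqrt_sum_sq_add_le (fun p : Fin d × Fin d => A p.1 p.2) (fun p => B p.1 p.2)

theorem frobNorm_neg (A : Matrix (Fin d) (Fin d) ℝ) : frobNorm (-A) = frobNorm A := by
  simp [frobNorm]

/-- The quadratic form of `S` lies between `φ₁` and `φ₂` times the squared Euclidean norm on
vectors with at most `k` nonzero entries. -/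
def SparseFormBounds (S : Matrix (Fin d) (Fin d) ℝ) (k : ℕ) (φ₁ φ₂ : ℝ) : Prop :=
  ∀ I : Finset (Fin d), I.card ≤ k → ∀ v : Fin d → ℝ, (∀ i ∉ I, v i = 0) →
    φ₁ * (v ⬝ᵥ v) ≤ v ⬝ᵥ (S *ᵥ v) ∧ v ⬝ᵥ (S *ᵥ v) ≤ φ₂ * (v ⬝ᵥ v)

theorem frobNorm_sqrt_mul_sq {S : Matrix (Fin d) (Fin d) ℝ} (hS : S.PosSemidef)
    (M : Matrix (Fin d) (Fin d) ℝ) :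
    frobNorm (CFC.sqrt S * M) ^ 2 = ∑ j, (fun i => M i j) ⬝ᵥ (S *ᵥ fun i => M i j) := by
  rw [frobNorm_sq_eq_trace, Matrix.trace_mul_comm, Matrix.transpose_mul, sqrt_transpose,
    Matrix.mul_assoc, ← Matrix.mul_assoc (CFC.sqrt S), sqrt_mul_sqrt_of_posSemidef hS]
  rfl

theorem frobNorm_sqrt_mul_bounds {S : Matrix (Fin d) (Fin d) ℝ} (hS : S.PosSemidef) {k : ℕ}
    {φ₁ φ₂ : ℝ} (h : SparseFormBounds S k φ₁ φ₂) (M : Matrix (Fin d) (Fin d) ℝ)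
    (I : Finset (Fin d)) (hI : I.card ≤ k) (hM : ∀ i ∉ I, ∀ j, M i j = 0) :
    φ₁ * frobNorm M ^ 2 ≤ frobNorm (CFC.sqrt S * M) ^ 2 ∧
      frobNorm (CFC.sqrt S * M) ^ 2 ≤ φ₂ * frobNorm M ^ 2 := by
  have e : frobNorm M ^ 2 = ∑ j, (fun i => M i j) ⬝ᵥ (fun i => M i j) := by
    rw [frobNorm_sq, Finset.sum_comm]
    simp [dotProduct, sq]
  rw [frobNorm_sqrt_mul_sq hS, e, Finset.mul_sum, Finset.mul_sum]
  exact ⟨Finset.sum_le_sum fun j _ => (h I hI _ fun i hi => hM i hi j).1,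
    Finset.sum_le_sum fun j _ => (h I hI _ fun i hi => hM i hi j).2⟩

theorem sandwich_frobNorm_bounds {S : Matrix (Fin d) (Fin d) ℝ} (hS : S.PosSemidef) {k : ℕ}
    {φ₁ φ₂ : ℝ} (h1 : 0 ≤ φ₁) (h2 : 0 ≤ φ₂) (h : SparseFormBounds S k φ₁ φ₂)
    (M : Matrix (Fin d) (Fin d) ℝ) (B : Finset (Fin d × Fin d)) (hB : B.card ≤ k)
    (hM : ∀ i j, (i, j) ∉ B → M i j = 0) :
    φ₁ * frobNorm M ≤ frobNorm (sandwich S M) ∧ frobNorm (sandwich S M) ≤ φ₂ * frobNorm M := by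
  classical
  have a1 := frobNorm_sqrt_mul_bounds hS h (M * CFC.sqrt S) (B.image Prod.fst)
    (Finset.card_image_le.trans hB) (by
      intro i hi j
      rw [Matrix.mul_apply]
      refine Finset.sum_eq_zero fun l _ => ?_
      rw [hM i l (fun hl => hi (Finset.mem_image.2 ⟨_, hl, rfl⟩)), zero_mul])
  have a2 := frobNorm_sqrt_mul_bounds hS h Mᵀ (B.image Prod.snd)
    (Finset.card_image_le.trans hB) (by
      intro i hi j
      exact hM j i (fun hl => hi (Finset.mem_image.2 ⟨_, hl, rfl⟩)))
  have e : frobNorm (CFC.sqrt S * Mᵀ) = frobNorm (M * CFC.sqrt S) := by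
    rw [← frobNorm_transpose, Matrix.transpose_mul, sqrt_transpose, Matrix.transpose_transpose]
  rw [e, frobNorm_transpose] at a2
  rw [← Matrix.mul_assoc] at a1
  change _ ≤ frobNorm (sandwich S M) ^ 2 ∧ frobNorm (sandwich S M) ^ 2 ≤ _ at a1
  constructor
  · refine le_of_sq_le_sq ?_ (frobNorm_nonneg _)
    nlinarith
  · refine le_of_sq_le_sq ?_ (mul_nonneg h2 (frobNorm_nonneg _))
    nlinarith

/-- The restricted eigenvalue property of `Δ ↦ S^{1/2} Δ S^{1/2}` on matrices whose mass is
concentrated on the block `J × J`. -/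
theorem le_frobNorm_sandwich_of_cone {S : Matrix (Fin d) (Fin d) ℝ} (hS : S.PosSemidef)
    {s k₀ : ℕ} (hs : 0 < s) (hk₀ : 0 < k₀) {φ₁ φ₂ : ℝ} (h1 : 0 ≤ φ₁) (h12 : φ₁ ≤ φ₂)
    (h : SparseFormBounds S ((k₀ + 1) * s ^ 2) φ₁ φ₂)
    (hratio : 6 * φ₂ ≤ φ₁ * √k₀) (hk6 : 6 ≤ √(k₀ : ℝ)) {J : Finset (Fin d)} (hJ : J.card ≤ s)
    (M : Matrix (Fin d) (Fin d) ℝ)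
    (hcone : ∑ p ∈ (J ×ˢ J)ᶜ, |M p.1 p.2| ≤ 3 * ∑ p ∈ J ×ˢ J, |M p.1 p.2|) :
    φ₁ / 4 * frobNorm M ≤ frobNorm (sandwich S M) := by
  set toM : (Fin d × Fin d → ℝ) → Matrix (Fin d) (Fin d) ℝ :=
    fun a => Matrix.of fun i j => a (i, j)
  have key := le_seminorm_of_cone (N := fun a => frobNorm (sandwich S (toM a)))
    (fun x y => by
      have : sandwich S (toM (x + y)) = sandwich S (toM x) + sandwich S (toM y) := by
        simp only [sandwich, ← Matrix.mul_add, ← Matrix.add_mul]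
        rfl
      simp only [this]
      exact frobNorm_add_le _ _)
    (fun x => by
      have : sandwich S (toM (-x)) = -sandwich S (toM x) := by
        have hx : toM (-x) = -toM x := rfl
        simp [sandwich, hx]
      simp only [this, frobNorm_neg])
    h1 h12 (r := s ^ 2) (by positivity) hk₀ (fun p => M p.1 p.2)
    (fun B hB => by
      have := (sandwich_frobNorm_bounds hS h1 (h1.trans h12) h
        (toM ((B : Set _).indicator fun p => M p.1 p.2)) B hB
        (fun i j hij => by simp [toM, hij])).1
      rw [frobNorm_eq_sqrt_sum_prod] at this
      simpa only [toM, Matrix.of_apply, Prod.mk.eta, sum_indicator_sq] using this)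
    (fun B hB => by
      have := (sandwich_frobNorm_bounds hS h1 (h1.trans h12) h
        (toM ((B : Set _).indicator fun p => M p.1 p.2)) B hB
        (fun i j hij => by simp [toM, hij])).2
      rw [frobNorm_eq_sqrt_sum_prod (toM _)] at this
      simpa only [toM, Matrix.of_apply, Prod.mk.eta, sum_indicator_sq] using this)
    hratio hk6 (S := J ×ˢ J) (by rw [Finset.card_product]; nlinarith) hcone
  rw [frobNorm_eq_sqrt_sum_prod]
  exact key

end RestrictedEigenvalue

end SparseSIR

namespace SparseSIR

/-! ### The deterministic error bound -/

section Deterministic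

variable {d K : ℕ}

theorem dotProduct_conj_mulVec {m k : ℕ} (A : Matrix (Fin m) (Fin m) ℝ)
    (B : Matrix (Fin k) (Fin m) ℝ) (x : Fin k → ℝ) :
    x ⬝ᵥ ((B * A * Bᵀ) *ᵥ x) = (Bᵀ *ᵥ x) ⬝ᵥ (A *ᵥ (Bᵀ *ᵥ x)) := by
  rw [Matrix.mul_assoc, ← Matrix.mulVec_mulVec, Matrix.dotProduct_mulVec, ← Matrix.mulVec_transpose,
    ← Matrix.mulVec_mulVec]

theorem norm_toEuclideanCLM_le_one_of_idem {F : Matrix (Fin d) (Fin d) ℝ} (hsym : Fᵀ = F)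
    (hidem : F * F = F) : ‖Matrix.toEuclideanCLM (𝕜 := ℝ) F‖ ≤ 1 := by
  refine ContinuousLinearMap.opNorm_le_bound _ zero_le_one fun x => ?_
  rw [one_mul]
  set y := Matrix.toEuclideanCLM (𝕜 := ℝ) F x with hy
  have h1 : ‖y‖ * ‖y‖ = inner ℝ x y := by
    rw [← real_inner_self_eq_norm_mul_norm]
    have e : y = WithLp.toLp 2 (F *ᵥ x.ofLp) := by
      rw [hy]; exact Matrix.toEuclideanCLM_toLp F x.ofLp
    have ex : x = WithLp.toLp 2 x.ofLp := rfl
    rw [e]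
    conv_rhs => rw [ex]
    rw [EuclideanSpace.inner_toLp_toLp, EuclideanSpace.inner_toLp_toLp]
    simp only [star_trivial]
    rw [Matrix.dotProduct_mulVec, ← Matrix.mulVec_transpose, hsym, Matrix.mulVec_mulVec, hidem]
  have h2 := real_inner_le_norm x y
  rw [← h1] at h2
  rcases (norm_nonneg y).eq_or_lt with h | h
  · rw [← h]; positivity
  · exact le_of_mul_le_mul_right h2 h

theorem one_sub_posSemidef_of_norm_le {F : Matrix (Fin d) (Fin d) ℝ} (hsym : Fᵀ = F)
    (hF : ‖Matrix.toEuclideanCLM (𝕜 := ℝ) F‖ ≤ 1) : (1 - F).PosSemidef := by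
  apply posSemidef_of_transpose_eq (by simp [hsym])
  intro x
  have h1 := real_inner_le_norm (WithLp.toLp 2 x : EuclideanSpace ℝ (Fin d))
    (Matrix.toEuclideanCLM (𝕜 := ℝ) F (WithLp.toLp 2 x))
  have h2 := (Matrix.toEuclideanCLM (𝕜 := ℝ) F).le_of_opNorm_le hF (WithLp.toLp 2 x)
  have h3 : ‖(WithLp.toLp 2 x : EuclideanSpace ℝ (Fin d))‖
      * ‖(WithLp.toLp 2 x : EuclideanSpace ℝ (Fin d))‖ = x ⬝ᵥ x := by
    rw [← real_inner_self_eq_norm_mul_norm, EuclideanSpace.inner_toLp_toLp, star_trivial]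
  rw [Matrix.toEuclideanCLM_toLp, EuclideanSpace.inner_toLp_toLp, star_trivial] at h1
  rw [Matrix.toEuclideanCLM_toLp] at h2
  rw [Matrix.sub_mulVec, Matrix.one_mulVec, dotProduct_sub, dotProduct_comm x (F *ᵥ x), ← h3]
  nlinarith [norm_nonneg (WithLp.toLp 2 x : EuclideanSpace ℝ (Fin d))]

theorem posDef_of_form_pos {m : ℕ} {A : Matrix (Fin m) (Fin m) ℝ} (h : Aᵀ = A)
    (h0 : ∀ x, x ≠ 0 → 0 < x ⬝ᵥ (A *ᵥ x)) : A.PosDef :=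
  .of_dotProduct_mulVec_pos
    (by rw [Matrix.IsHermitian, Matrix.conjTranspose_eq_transpose_of_trivial, h])
    (fun x hx => by simpa using h0 x hx)

theorem dotProduct_self_pos {m : ℕ} {x : Fin m → ℝ} (h : x ≠ 0) : 0 < x ⬝ᵥ x := by
  have h0 : 0 ≤ x ⬝ᵥ x := Finset.sum_nonneg fun _ _ => mul_self_nonneg _
  exact h0.lt_of_ne fun h1 => h (dotProduct_self_eq_zero.1 h1.symm)

theorem isUnit_det_of_posDef {m : ℕ} {A : Matrix (Fin m) (Fin m) ℝ} (h : A.PosDef) :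
    IsUnit A.det := h.det_pos.ne'.isUnit

theorem dotProduct_inv_mulVec_le {m : ℕ} {G : Matrix (Fin m) (Fin m) ℝ} (hdet : IsUnit G.det)
    (hG : ∀ y, 1 / 2 * (y ⬝ᵥ y) ≤ y ⬝ᵥ (G *ᵥ y)) (x : Fin m → ℝ) :
    x ⬝ᵥ (G⁻¹ *ᵥ x) ≤ 2 * (x ⬝ᵥ x) := by
  set y := G⁻¹ *ᵥ x with hy
  have hx : G *ᵥ y = x := by
    rw [hy, Matrix.mulVec_mulVec, Matrix.mul_nonsing_inv _ hdet, Matrix.one_mulVec]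
  have h1 := hG y
  rw [hx, dotProduct_comm y x] at h1
  -- expand `0 ≤ |2 x - y|²`
  have h2 : 0 ≤ ((2 : ℝ) • x - y) ⬝ᵥ ((2 : ℝ) • x - y) :=
    Finset.sum_nonneg fun _ _ => mul_self_nonneg _
  simp only [dotProduct_sub, sub_dotProduct, smul_dotProduct, dotProduct_smul, smul_eq_mul,
    dotProduct_comm y x] at h2
  linarith

theorem trace_mul_le_of_abs_le {A B : Matrix (Fin d) (Fin d) ℝ} {ε : ℝ}
    (hA : ∀ i j, |A i j| ≤ ε) : (A * B).trace ≤ ε * ∑ i, ∑ j, |B i j| := by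
  rw [Finset.sum_comm, Finset.mul_sum]
  refine Finset.sum_le_sum fun i _ => ?_
  rw [Matrix.diag_apply, Matrix.mul_apply, Finset.mul_sum]
  refine Finset.sum_le_sum fun j _ => (le_abs_self _).trans ?_
  rw [abs_mul]
  exact mul_le_mul_of_nonneg_right (hA i j) (abs_nonneg _)

/-- The deterministic part of the analysis. Suppose that the sample covariance matrix `S` is well
conditioned on sparse vectors, that the columns of the sparse matrix `U` are nearly orthonormal
for `S`, and that the matrix `A` in the objective is, entry by entry, within `ρ / 2` of
`S U diag(μ) Uᵀ S`. Then the leading eigenspace of any solution is within a multiple of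
`ρ s / lam` of the span of the columns of `U`. The comparison point is the feasible matrix
`U (Uᵀ S U)⁻¹ Uᵀ`, which `S^{1/2}` turns into a projection of rank `K`. -/
theorem subspaceDist_le_of_deviation {S A Q : Matrix (Fin d) (Fin d) ℝ} (hS : S.PosSemidef)
    {U : Matrix (Fin d) (Fin K) ℝ} {μ : Fin K → ℝ} {lam ρ : ℝ} (hK : 0 < K) (hlam : 0 < lam)
    (hρ : 0 < ρ) (hμ : ∀ k, lam ≤ μ k)
    {s k₀ : ℕ} (hs : 0 < s) (hk₀ : 0 < k₀) {φ₁ φ₂ : ℝ} (h1 : 0 < φ₁) (h12 : φ₁ ≤ φ₂)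
    (hform : SparseFormBounds S ((k₀ + 1) * s ^ 2) φ₁ φ₂)
    (hratio : 6 * φ₂ ≤ φ₁ * √k₀) (hk6 : 6 ≤ √(k₀ : ℝ)) {J : Finset (Fin d)} (hJ : J.card ≤ s)
    (hUJ : ∀ i ∉ J, ∀ k, U i k = 0)
    (hU : ∀ y, 1 / 2 * (y ⬝ᵥ y) ≤ y ⬝ᵥ ((Uᵀ * S * U) *ᵥ y))
    (hdev : ∀ i j, |(A - S * U * Matrix.diagonal μ * Uᵀ * S) i j| ≤ ρ / 2)
    (hQ : IsFeasible S K Q)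
    (hmin : ∀ Q', IsFeasible S K Q' → penalizedObjective A ρ Q ≤ penalizedObjective A ρ Q')
    {W : Submodule ℝ (EuclideanSpace ℝ (Fin d))} (hW : IsLeadingEigenspace Q K W) :
    subspaceDist (colSpan U) W ≤ 192 * φ₂ / φ₁ ^ 2 * (ρ * s / lam) := by
  have hφ₂ : 0 < φ₂ := h1.trans_le h12
  have hSt := transpose_eq_of_posSemidef hS
  set R := CFC.sqrt S with hR
  have hRR : R * R = S := sqrt_mul_sqrt_of_posSemidef hS
  have hRt : Rᵀ = R := sqrt_transpose S
  set G := Uᵀ * S * U with hG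
  have hGt : Gᵀ = G := by simp [hG, hSt, Matrix.mul_assoc]
  have hGpd : G.PosDef := posDef_of_form_pos hGt fun x hx => by
    have := hU x; have := dotProduct_self_pos hx; linarith
  have hGdet := isUnit_det_of_posDef hGpd
  have hGi : G⁻¹ * G = 1 := Matrix.nonsing_inv_mul _ hGdet
  have hGi' : G * G⁻¹ = 1 := Matrix.mul_nonsing_inv _ hGdet
  have hGit : (G⁻¹)ᵀ = G⁻¹ := by rw [Matrix.transpose_nonsing_inv, hGt]
  -- the quadratic form of `S` on the range of `U`
  have hUform : ∀ y, y ⬝ᵥ (G *ᵥ y) ≤ φ₂ * ((U *ᵥ y) ⬝ᵥ (U *ᵥ y)) := by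
    intro y
    have hk : J.card ≤ (k₀ + 1) * s ^ 2 := by nlinarith
    have := (hform J hk (U *ᵥ y) (fun i hi => by
      simp [Matrix.mulVec, dotProduct, hUJ i hi])).2
    have e : y ⬝ᵥ (G *ᵥ y) = (U *ᵥ y) ⬝ᵥ (S *ᵥ (U *ᵥ y)) := by
      have := dotProduct_conj_mulVec S Uᵀ y
      rwa [Matrix.transpose_transpose] at this
    rwa [e]
  have hUU : (Uᵀ * U).PosDef := posDef_of_form_pos (by simp) fun x hx => by
    have e : x ⬝ᵥ ((Uᵀ * U) *ᵥ x) = (U *ᵥ x) ⬝ᵥ (U *ᵥ x) := by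
      rw [← Matrix.mulVec_mulVec, Matrix.dotProduct_mulVec, Matrix.vecMul_transpose]
    have a1 := hU x
    have a2 := dotProduct_self_pos hx
    have a3 := hUform x
    rw [e]
    by_contra hcon
    nlinarith
  have hUUdet := isUnit_det_of_posDef hUU
  -- the comparison point
  set T := U * G⁻¹ * Uᵀ with hT
  have hTt : Tᵀ = T := by simp [hT, hGit, Matrix.mul_assoc]
  have hTpsd : T.PosSemidef := posSemidef_conj hGpd.inv.posSemidef U
  set F₀ := sandwich S T with hF₀
  have hF₀' : F₀ = R * U * G⁻¹ * (R * U)ᵀ := by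
    simp [hF₀, sandwich, hT, Matrix.mul_assoc, ← hR, hRt]
  have hRU : (R * U)ᵀ * (R * U) = G := by
    rw [Matrix.transpose_mul, hRt, Matrix.mul_assoc, ← Matrix.mul_assoc R, hRR, hG,
      Matrix.mul_assoc]
  have hF₀t : F₀ᵀ = F₀ := by
    rw [hF₀']; simp only [Matrix.transpose_mul, Matrix.transpose_transpose, hGit, Matrix.mul_assoc]
  have hF₀RU : (R * U)ᵀ * F₀ = (R * U)ᵀ := by
    rw [hF₀', ← Matrix.mul_assoc, ← Matrix.mul_assoc, hRU, hGi', Matrix.one_mul]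
  have hF₀idem : F₀ * F₀ = F₀ := by
    conv_lhs => rw [hF₀', Matrix.mul_assoc, ← hF₀', hF₀RU]
    exact hF₀'.symm
  have hF₀tr : F₀.trace = K := by
    rw [hF₀', Matrix.trace_mul_comm, ← Matrix.mul_assoc, hRU, hGi', Matrix.trace_one]
    simp
  have hTfeas : IsFeasible S K T :=
    ⟨hTpsd, hF₀tr.le, norm_toEuclideanCLM_le_one_of_idem hF₀t hF₀idem⟩
  -- the curvature of the objective at the comparison point
  set F := sandwich S Q with hF
  have hFpsd : F.PosSemidef := by
    have := posSemidef_conj hQ.1 R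
    rwa [hRt] at this
  set M := R * U * Matrix.diagonal μ * (R * U)ᵀ with hM
  have hcurv := fantope_curvature (M := M) (F₀ := F₀) (F := F) (lam := lam / 2) (k := K)
    (by positivity) hF₀t hF₀idem hF₀tr (by rw [hM, Matrix.mul_assoc, hF₀RU])
    (by
      have : M - (lam / 2) • F₀
          = R * U * (Matrix.diagonal μ - (lam / 2) • G⁻¹) * (R * U)ᵀ := by
        rw [hM, hF₀']
        simp only [Matrix.mul_sub, Matrix.sub_mul, Matrix.mul_smul, Matrix.smul_mul]
      rw [this]
      refine posSemidef_conj (posSemidef_of_transpose_eq (by simp [hGit]) fun x => ?_) _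
      have a1 := dotProduct_inv_mulVec_le hGdet hU x
      have a2 : lam * (x ⬝ᵥ x) ≤ x ⬝ᵥ (Matrix.diagonal μ *ᵥ x) := by
        simp only [dotProduct, Matrix.mulVec_diagonal, Finset.mul_sum]
        refine Finset.sum_le_sum fun k _ => ?_
        nlinarith [hμ k, mul_self_nonneg (x k)]
      rw [Matrix.sub_mulVec, Matrix.smul_mulVec, dotProduct_sub, dotProduct_smul, smul_eq_mul]
      nlinarith)
    hFpsd (one_sub_posSemidef_of_norm_le (transpose_eq_of_posSemidef hFpsd) hQ.2.2) hQ.2.1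
  set A₀ := S * U * Matrix.diagonal μ * Uᵀ * S with hA₀
  have hMA : (M * (F₀ - F)).trace = (A₀ * (T - Q)).trace := by
    have : F₀ - F = R * (T - Q) * R := by
      simp [hF₀, hF, sandwich, Matrix.mul_sub, Matrix.sub_mul, hR]
    rw [this, ← Matrix.mul_assoc, Matrix.trace_mul_comm]
    congr 1
    rw [hM, hA₀, Matrix.transpose_mul, hRt, ← hRR]
    simp only [Matrix.mul_assoc]
  have hsand : F₀ - F = sandwich S (T - Q) := by
    simp [hF₀, hF, sandwich, Matrix.mul_sub, Matrix.sub_mul]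
  -- the basic inequality
  set Δ := T - Q with hΔ
  set I := J ×ˢ J with hI
  set a := ∑ p ∈ I, |Δ p.1 p.2| with ha
  set b := ∑ p ∈ Iᶜ, |Δ p.1 p.2| with hb
  have hsplit : ∀ f : Fin d × Fin d → ℝ,
      ∑ i, ∑ j, f (i, j) = ∑ p ∈ I, f p + ∑ p ∈ Iᶜ, f p := by
    intro f
    rw [Finset.sum_add_sum_compl, Fintype.sum_prod_type]
  have hTI : ∀ p ∉ I, T p.1 p.2 = 0 := by
    intro p hp
    rw [hI, Finset.mem_product, not_and_or] at hp
    rcases hp with hp | hp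
    · rw [hT, Matrix.mul_assoc, Matrix.mul_apply]
      exact Finset.sum_eq_zero fun k _ => by rw [hUJ _ hp, zero_mul]
    · rw [hT, Matrix.mul_apply]
      exact Finset.sum_eq_zero fun k _ => by rw [Matrix.transpose_apply, hUJ _ hp, mul_zero]
  have hl1 : (∑ i, ∑ j, |T i j|) - (∑ i, ∑ j, |Q i j|) ≤ a - b := by
    rw [hsplit (fun p => |T p.1 p.2|), hsplit (fun p => |Q p.1 p.2|)]
    have i1 : ∑ p ∈ I, |T p.1 p.2| ≤ ∑ p ∈ I, |Q p.1 p.2| + a := by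
      rw [ha, ← Finset.sum_add_distrib]
      refine Finset.sum_le_sum fun p _ => ?_
      have := abs_add_le (Q p.1 p.2) (Δ p.1 p.2)
      rwa [hΔ, Matrix.sub_apply, add_sub_cancel] at this
    have i2 : ∑ p ∈ Iᶜ, |T p.1 p.2| = 0 :=
      Finset.sum_eq_zero fun p hp => by rw [hTI p (Finset.mem_compl.1 hp), abs_zero]
    have i3 : b = ∑ p ∈ Iᶜ, |Q p.1 p.2| :=
      Finset.sum_congr rfl fun p hp => by
        rw [hΔ, Matrix.sub_apply, hTI p (Finset.mem_compl.1 hp), zero_sub, abs_neg]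
    rw [i2, ← i3]
    linarith
  have hbasic : (A₀ * Δ).trace ≤ ρ / 2 * (a + b) + ρ * (a - b) := by
    have o1 := hmin T hTfeas
    simp only [penalizedObjective] at o1
    have o2 := trace_mul_le_of_abs_le (A := A₀ - A) (B := Δ) (ε := ρ / 2) (fun i j => by
      rw [Matrix.sub_apply, abs_sub_comm]; exact hdev i j)
    rw [hsplit (fun p => |Δ p.1 p.2|)] at o2
    have o3 : (A * T).trace - (A * Q).trace = (A * Δ).trace := by
      rw [hΔ, Matrix.mul_sub, Matrix.trace_sub]
    rw [Matrix.sub_mul, Matrix.trace_sub] at o2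
    nlinarith
  rw [hMA, hsand] at hcurv
  have hb0 : 0 ≤ b := Finset.sum_nonneg fun _ _ => abs_nonneg _
  have hcone : b ≤ 3 * a := by
    have : 0 ≤ lam / 2 / 2 * frobNorm (sandwich S Δ) ^ 2 := by positivity
    by_contra hcon
    nlinarith
  have hre := le_frobNorm_sandwich_of_cone hS hs hk₀ h1.le h12 hform hratio hk6 hJ Δ hcone
  have has : a ≤ s * frobNorm Δ := by
    have hcs := Real.sum_mul_le_sqrt_mul_sqrt I (fun _ => (1 : ℝ)) (fun p => |Δ p.1 p.2|)
    simp only [one_mul, one_pow, sq_abs, Finset.sum_const, nsmul_eq_mul, mul_one] at hcs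
    refine hcs.trans ?_
    rw [frobNorm_eq_sqrt_sum_prod]
    have c1 : √(I.card : ℝ) ≤ s := by
      rw [Real.sqrt_le_left (by positivity), hI, Finset.card_product]
      push_cast
      have : (J.card : ℝ) ≤ s := by exact_mod_cast hJ
      nlinarith
    have c2 : √(∑ p ∈ I, Δ p.1 p.2 ^ 2) ≤ √(∑ p : Fin d × Fin d, Δ p.1 p.2 ^ 2) :=
      Real.sqrt_le_sqrt (Finset.sum_le_sum_of_subset_of_nonneg (Finset.subset_univ _)
        fun _ _ _ => sq_nonneg _)
    exact mul_le_mul c1 c2 (Real.sqrt_nonneg _) (by positivity)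
  have hΔ0 := frobNorm_nonneg Δ
  have hΔle : frobNorm Δ ≤ 96 / φ₁ ^ 2 * (ρ * s / lam) := by
    have hsq : (φ₁ / 4 * frobNorm Δ) ^ 2 ≤ frobNorm (sandwich S Δ) ^ 2 :=
      pow_le_pow_left₀ (by positivity) hre 2
    have key : lam * φ₁ ^ 2 * frobNorm Δ * frobNorm Δ ≤ 96 * ρ * s * frobNorm Δ := by
      have e1 : lam / 4 * (φ₁ / 4 * frobNorm Δ) ^ 2
          ≤ lam / 4 * frobNorm (sandwich S Δ) ^ 2 := by gcongr
      have e2 : ρ * a ≤ ρ * (s * frobNorm Δ) := by gcongr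
      nlinarith
    rcases hΔ0.eq_or_lt with h | h
    · rw [← h]; positivity
    · have := le_of_mul_le_mul_right key h
      rw [div_mul_div_comm, le_div_iff₀ (by positivity)]
      linarith
  -- from the matrix to its leading eigenspace
  obtain ⟨V, ν, hV, hQV, hlead, rfl⟩ := hW
  set P := U * (Uᵀ * U)⁻¹ * Uᵀ with hP
  have hUUt : ((Uᵀ * U)⁻¹)ᵀ = (Uᵀ * U)⁻¹ := by rw [Matrix.transpose_nonsing_inv]; simp
  have hPt : Pᵀ = P := by simp only [hP, Matrix.transpose_mul, Matrix.transpose_transpose, hUUt,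
    Matrix.mul_assoc]
  have hUP : Uᵀ * P = Uᵀ := by
    rw [hP, ← Matrix.mul_assoc, ← Matrix.mul_assoc, Matrix.mul_nonsing_inv _ hUUdet,
      Matrix.one_mul]
  have hPP : P * P = P := by
    conv_lhs => rw [hP, Matrix.mul_assoc, ← hP, hUP]
  have hPtr : P.trace = K := by
    rw [hP, Matrix.trace_mul_comm, ← Matrix.mul_assoc, Matrix.mul_nonsing_inv _ hUUdet,
      Matrix.trace_one]
    simp
  have hdk := frobNorm_sub_le_of_leading (Q := Q) (M := T) (P := P) (U := V) (μ := ν)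
    (σ := 1 / φ₂) (by positivity) hK (transpose_eq_of_posSemidef hQ.1) hV hQV hlead hPt hPP hPtr
    (by rw [hT, Matrix.mul_assoc, hUP])
    (by
      refine posSemidef_of_transpose_eq (by simp [hTt, hPt]) fun x => ?_
      -- with `z = G⁻¹ Uᵀ x` and `U y = P x`, expand `0 ≤ (z - y / φ₂)ᵀ G (z - y / φ₂)`
      set g := Uᵀ *ᵥ x with hg
      set z := G⁻¹ *ᵥ g with hz
      set y := (Uᵀ * U)⁻¹ *ᵥ g with hy
      have e1 : x ⬝ᵥ (T *ᵥ x) = g ⬝ᵥ z := by rw [hT, dotProduct_conj_mulVec]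
      have e2 : x ⬝ᵥ (P *ᵥ x) = g ⬝ᵥ y := by rw [hP, dotProduct_conj_mulVec]
      have e3 : (U *ᵥ y) ⬝ᵥ (U *ᵥ y) = g ⬝ᵥ y := by
        rw [Matrix.dotProduct_mulVec, ← Matrix.mulVec_transpose, Matrix.mulVec_mulVec, hy,
          Matrix.mulVec_mulVec, Matrix.mul_nonsing_inv _ hUUdet, Matrix.one_mulVec]
      have e4 : G *ᵥ z = g := by
        rw [hz, Matrix.mulVec_mulVec, hGi', Matrix.one_mulVec]
      have e5 : z ⬝ᵥ (G *ᵥ y) = g ⬝ᵥ y := by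
        rw [Matrix.dotProduct_mulVec, ← Matrix.mulVec_transpose, hGt, e4]
      have q := dotProduct_nonneg_of_posSemidef hGpd.posSemidef (z - (1 / φ₂) • y)
      have hy2 := hUform y
      rw [e3] at hy2
      simp only [Matrix.mulVec_sub, Matrix.mulVec_smul, dotProduct_sub, sub_dotProduct,
        smul_dotProduct, dotProduct_smul, smul_eq_mul, e4, e5, dotProduct_comm z g,
        dotProduct_comm y g] at q
      rw [Matrix.sub_mulVec, Matrix.smul_mulVec, dotProduct_sub, dotProduct_smul, smul_eq_mul,
        e1, e2]
      have hy3 : 1 / φ₂ * (1 / φ₂ * (y ⬝ᵥ (G *ᵥ y))) ≤ 1 / φ₂ * (g ⬝ᵥ y) := by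
        refine mul_le_mul_of_nonneg_left ?_ (by positivity)
        rw [one_div, inv_mul_le_iff₀ hφ₂]
        exact hy2
      linarith)
  have hVdet : IsUnit (Vᵀ * V).det := by rw [hV]; simp
  rw [subspaceDist, projMatrix_colSpan hUUdet, projMatrix_colSpan hVdet, hV]
  simp only [inv_one, Matrix.mul_one]
  refine hdk.trans ?_
  calc 2 / (1 / φ₂) * frobNorm (T - Q) ≤ 2 / (1 / φ₂) * (96 / φ₁ ^ 2 * (ρ * s / lam)) := by
        gcongr
    _ = 192 * φ₂ / φ₁ ^ 2 * (ρ * s / lam) := by field_simp; norm_num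

end Deterministic

end SparseSIR

namespace SparseSIR

/-! ### The population matrices -/

section Population

variable {d K : ℕ}

/-- If `y` and `x` are conditionally independent given a function of `x`, a function of `x` whose
conditional expectation given the reduction vanishes has vanishing conditional expectation
given `y`. -/
theorem condExp_eq_zero_of_condIndepFun {Ω X Y : Type*} {m mΩ : MeasurableSpace Ω}
    [StandardBorelSpace Ω] [mX : MeasurableSpace X] [mY : MeasurableSpace Y] {P : Measure Ω}
    [IsFiniteMeasure P] {hm : m ≤ mΩ} {fx : Ω → X} {fy : Ω → Y}
    (hfx : Measurable fx) (hfy : Measurable fy) (hmx : m ≤ mX.comap fx)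
    (h : CondIndepFun m hm fy fx P) {Z : Ω → ℝ} (hZ : StronglyMeasurable[mX.comap fx] Z)
    (hZi : Integrable Z P) (hZ0 : P[Z | m] =ᵐ[P] 0) :
    P[Z | mY.comap fy] =ᵐ[P] 0 := by
  rw [condIndepFun_iff_condExp_inter_preimage_eq_mul hfy hfx] at h
  have hlex : mX.comap fx ≤ mΩ := hfx.comap_le
  have hley : mY.comap fy ≤ mΩ := hfy.comap_le
  symm
  refine ae_eq_condExp_of_forall_setIntegral_eq hley hZi
      (fun _ _ _ => (integrable_zero _ _ _).integrableOn)
    ?_ (aestronglyMeasurable_zero)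
  rintro _ ⟨C, hC, rfl⟩ -
  have hS : MeasurableSet (fy ⁻¹' C) := hfy hC
  set g : Ω → ℝ := (fy ⁻¹' C).indicator fun _ => 1 with hg
  have hgi : Integrable g P := (integrable_const (1 : ℝ)).indicator hS
  set G := P[g | m] with hG
  have hGm : StronglyMeasurable[m] G := stronglyMeasurable_condExp
  have hGb : ∀ᵐ ω ∂P, ‖G ω‖ ≤ 1 := by
    have : ∀ᵐ ω ∂P, |g ω| ≤ 1 := .of_forall fun ω => by
      by_cases hω : ω ∈ fy ⁻¹' C <;> simp [hg, hω]
    exact ae_bdd_abs_condExp_of_ae_bdd_abs this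
  have hGx : G =ᵐ[P] P[g | mX.comap fx] := by
    refine ae_eq_condExp_of_forall_setIntegral_eq hlex hgi
      (fun _ _ _ => integrable_condExp.integrableOn) ?_ (hGm.mono hmx).aestronglyMeasurable
    rintro _ ⟨t, ht, rfl⟩ -
    have hT : MeasurableSet (fx ⁻¹' t) := hfx ht
    set k : Ω → ℝ := (fx ⁻¹' t).indicator fun _ => 1 with hk
    have hki : Integrable k P := (integrable_const (1 : ℝ)).indicator hT
    have e1 : ∫ ω in fx ⁻¹' t, G ω ∂P = ∫ ω, (G * k) ω ∂P := by
      rw [← integral_indicator hT]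
      congr 1 with ω
      by_cases hω : ω ∈ fx ⁻¹' t <;> simp [hk, hω]
    have e2 : ∫ ω in fx ⁻¹' t, g ω ∂P
        = ∫ ω, (fy ⁻¹' C ∩ fx ⁻¹' t).indicator (fun _ => (1 : ℝ)) ω ∂P := by
      rw [← integral_indicator hT]
      congr 1 with ω
      by_cases hω : ω ∈ fx ⁻¹' t <;> by_cases hω' : ω ∈ fy ⁻¹' C <;> simp [hg, hω, hω']
    rw [e1, e2, ← integral_condExp hm, ← integral_condExp hm (f := Set.indicator _ _)]
    refine integral_congr_ae ?_
    filter_upwards [condExp_stronglyMeasurable_mul_of_bound hm hGm hki 1 hGb, h C t hC ht]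
      with ω h1 h2
    rw [h1, h2]
    rfl
  have hZg : Integrable (Z * g) P := by
    have : Z * g = (fy ⁻¹' C).indicator Z := by
      ext ω
      by_cases hω : ω ∈ fy ⁻¹' C <;> simp [hg, hω]
    rw [this]
    exact hZi.indicator hS
  have e3 : ∫ ω in fy ⁻¹' C, Z ω ∂P = ∫ ω, (Z * g) ω ∂P := by
    rw [← integral_indicator hS]
    congr 1 with ω
    by_cases hω : ω ∈ fy ⁻¹' C <;> simp [hg, hω]
  have e4 : ∫ ω, (Z * g) ω ∂P = ∫ ω, (G * Z) ω ∂P := by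
    rw [← integral_condExp hlex]
    refine integral_congr_ae ?_
    filter_upwards [condExp_mul_of_stronglyMeasurable_left hZ hZg hgi, hGx] with ω h1 h2
    rw [h1, Pi.mul_apply, ← h2, mul_comm]
    rfl
  have e5 : ∫ ω, (G * Z) ω ∂P = 0 := by
    rw [← integral_condExp hm]
    refine integral_eq_zero_of_ae ?_
    filter_upwards [condExp_stronglyMeasurable_mul_of_bound hm hGm hZi 1 hGb, hZ0] with ω h1 h2
    rw [h1, Pi.mul_apply, h2]
    simp
  rw [e3, e4, e5]
  simp

theorem dotProduct_covariance_mulVec {Ω : Type*} [MeasurableSpace Ω] {P : Measure Ω}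
    [IsProbabilityMeasure P] {X : Fin d → Ω → ℝ} (hX : ∀ j, MemLp (X j) 2 P) (v w : Fin d → ℝ) :
    v ⬝ᵥ ((Matrix.of fun j k => covariance (X j) (X k) P) *ᵥ w)
      = covariance (fun ω => ∑ j, v j * X j ω) (fun ω => ∑ k, w k * X k ω) P := by
  have e : ∀ u : Fin d → ℝ, (fun ω => ∑ j, u j * X j ω) = ∑ j, u j • X j := by
    intro u; ext ω; simp
  have hs : ∀ (u : Fin d → ℝ) j, MemLp (u j • X j) 2 P := fun u j => (hX j).const_smul _
  have hsum : MemLp (∑ k, w k • X k) 2 P := memLp_finsetSum' _ fun k _ => hs w k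
  rw [e v, e w, covariance_sum_left (hs v) hsum]
  simp only [dotProduct, Matrix.mulVec, Matrix.of_apply]
  refine Finset.sum_congr rfl fun j _ => ?_
  rw [covariance_sum_right (hs w) (hs v j), Finset.mul_sum]
  refine Finset.sum_congr rfl fun k _ => ?_
  rw [covariance_smul_left, covariance_smul_right]
  ring

theorem meanVec_single_dotProduct (P : Measure ((Fin d → ℝ) × ℝ)) (j : Fin d)
    (z : (Fin d → ℝ) × ℝ) :
    (Pi.single j 1 : Fin d → ℝ) ⬝ᵥ (z.1 - meanVec P) = z.1 j - meanVec P j := by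
  simp

theorem IsSubGaussianX.memLp {P : Measure ((Fin d → ℝ) × ℝ)} [IsProbabilityMeasure P] {L : ℝ}
    (h : IsSubGaussianX P L) (j : Fin d) : MemLp (fun z => z.1 j) 2 P := by
  have hmeas : Measurable fun z : (Fin d → ℝ) × ℝ => z.1 j := by fun_prop
  have h1 := h (Pi.single j 1) 2 one_le_two
  simp only [meanVec_single_dotProduct] at h1
  have h2 : MemLp (fun z : (Fin d → ℝ) × ℝ => z.1 j - meanVec P j) 2 P := by
    refine ⟨(hmeas.sub_const _).aestronglyMeasurable, ?_⟩
    refine lt_of_le_of_lt (by simpa using h1) ENNReal.ofReal_lt_top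
  have := h2.add (memLp_const (meanVec P j))
  refine this.congr_norm hmeas.aestronglyMeasurable (.of_forall fun z => ?_)
  simp

/-- The regression residual `x_j - E(x_j ∣ y)`. -/
noncomputable def residual (P : Measure ((Fin d → ℝ) × ℝ)) (j : Fin d)
    (z : (Fin d → ℝ) × ℝ) : ℝ := z.1 j - condMeanX P j z

theorem memLp_condMeanX {P : Measure ((Fin d → ℝ) × ℝ)} [IsProbabilityMeasure P]
    (h : ∀ j : Fin d, MemLp (fun z : (Fin d → ℝ) × ℝ => z.1 j) 2 P) (j : Fin d) :
    MemLp (condMeanX P j) 2 P :=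
  (h j).condExp one_le_two

theorem comap_snd_le : MeasurableSpace.comap (Prod.snd : (Fin d → ℝ) × ℝ → ℝ) inferInstance
    ≤ (inferInstance : MeasurableSpace ((Fin d → ℝ) × ℝ)) := measurable_snd.comap_le

theorem integral_mul_condMeanX {P : Measure ((Fin d → ℝ) × ℝ)} [IsProbabilityMeasure P]
    (h : ∀ j : Fin d, MemLp (fun z : (Fin d → ℝ) × ℝ => z.1 j) 2 P) (j k : Fin d) :
    ∫ z, condMeanX P k z * z.1 j ∂P = ∫ z, condMeanX P k z * condMeanX P j z ∂P := by
  have hint : Integrable (condMeanX P k * fun z : (Fin d → ℝ) × ℝ => z.1 j) P :=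
    (memLp_condMeanX h k).integrable_mul (h j)
  have hk : StronglyMeasurable[MeasurableSpace.comap (Prod.snd : (Fin d → ℝ) × ℝ → ℝ)
      inferInstance] (condMeanX P k) := stronglyMeasurable_condExp
  have := condExp_mul_of_stronglyMeasurable_left hk hint ((h j).integrable one_le_two)
  calc ∫ z, condMeanX P k z * z.1 j ∂P
      = ∫ z, (condMeanX P k * fun z : (Fin d → ℝ) × ℝ => z.1 j) z ∂P := rfl
    _ = _ := by
        rw [← integral_condExp comap_snd_le]
        refine integral_congr_ae ?_
        filter_upwards [this] with z hz
        rw [hz]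
        rfl

/-- The covariance matrix of `x` splits into the parts explained and not explained by `y`. -/
theorem integral_residual_mul {P : Measure ((Fin d → ℝ) × ℝ)} [IsProbabilityMeasure P]
    (h : ∀ j : Fin d, MemLp (fun z : (Fin d → ℝ) × ℝ => z.1 j) 2 P) (j k : Fin d) :
    ∫ z, residual P j z * residual P k z ∂P = covX P j k - covCondMean P j k := by
  have hm := memLp_condMeanX h
  have hmean : ∀ j, ∫ z, condMeanX P j z ∂P = ∫ z, z.1 j ∂P := fun j =>
    integral_condExp comap_snd_le
  have i1 := (h j).integrable_mul (h k)
  have i2 := (hm j).integrable_mul (h k)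
  have i3 := (hm k).integrable_mul (h j)
  have i4 := (hm j).integrable_mul (hm k)
  have a1 : ∀ {f g : (Fin d → ℝ) × ℝ → ℝ}, ∫ z, (f * g) z ∂P = ∫ z, f z * g z ∂P := rfl
  simp only [covX, covCondMean, Matrix.of_apply]
  rw [covariance_eq_sub (h j) (h k), covariance_eq_sub (hm j) (hm k), hmean, hmean]
  have e : ∀ z : (Fin d → ℝ) × ℝ, residual P j z * residual P k z
      = (((fun z : (Fin d → ℝ) × ℝ => z.1 j) * fun z : (Fin d → ℝ) × ℝ => z.1 k) z
        - (condMeanX P j * fun z : (Fin d → ℝ) × ℝ => z.1 k) z)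
        - ((condMeanX P k * fun z : (Fin d → ℝ) × ℝ => z.1 j) z
            - (condMeanX P j * condMeanX P k) z) := by
    intro z; simp only [residual, Pi.mul_apply]; ring
  simp only [e]
  have t1 := integral_sub (i1.sub i2) (i3.sub i4)
  simp only [Pi.sub_apply] at t1
  rw [t1, integral_sub i1 i2, integral_sub i3 i4]
  rw [a1, a1, a1, a1, integral_mul_condMeanX h, integral_mul_condMeanX h]
  have : ∫ z, condMeanX P k z * condMeanX P j z ∂P = ∫ z, condMeanX P j z * condMeanX P k z ∂P := by
    congr 1 with z; ring
  rw [this]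
  ring

theorem covCondMean_form_le {P : Measure ((Fin d → ℝ) × ℝ)} [IsProbabilityMeasure P]
    (h : ∀ j : Fin d, MemLp (fun z : (Fin d → ℝ) × ℝ => z.1 j) 2 P) (v : Fin d → ℝ) :
    v ⬝ᵥ (covCondMean P *ᵥ v) ≤ v ⬝ᵥ (covX P *ᵥ v) := by
  have hr : ∀ j, MemLp (residual P j) 2 P := fun j => (h j).sub (memLp_condMeanX h j)
  have key : v ⬝ᵥ ((covX P - covCondMean P) *ᵥ v)
      = ∫ z, (∑ j, v j * residual P j z) * (∑ k, v k * residual P k z) ∂P := by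
    simp only [Finset.sum_mul_sum]
    rw [integral_finsetSum]
    · simp only [dotProduct, Matrix.mulVec, Finset.mul_sum]
      refine Finset.sum_congr rfl fun j _ => ?_
      rw [integral_finsetSum]
      · refine Finset.sum_congr rfl fun k _ => ?_
        rw [Matrix.sub_apply, ← integral_residual_mul h, ← integral_mul_const,
          ← integral_const_mul]
        congr 1 with z; ring
      · intro k _
        have := ((hr j).integrable_mul (hr k)).const_mul (v j * v k)
        refine this.congr (.of_forall fun z => ?_)
        simp only [Pi.mul_apply]; ring
    · intro j _
      refine integrable_finsetSum _ fun k _ => ?_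
      have := ((hr j).integrable_mul (hr k)).const_mul (v j * v k)
      refine this.congr (.of_forall fun z => ?_)
      simp only [Pi.mul_apply]; ring
  have : 0 ≤ v ⬝ᵥ ((covX P - covCondMean P) *ᵥ v) := by
    rw [key]; exact integral_nonneg fun z => mul_self_nonneg _
  rw [Matrix.sub_mulVec, dotProduct_sub] at this
  linarith

theorem covX_transpose (P : Measure ((Fin d → ℝ) × ℝ)) : (covX P)ᵀ = covX P := by
  ext i j; simp [covX, covariance_comm]

theorem covCondMean_transpose (P : Measure ((Fin d → ℝ) × ℝ)) :
    (covCondMean P)ᵀ = covCondMean P := by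
  ext i j; simp [covCondMean, covariance_comm]

theorem covX_posSemidef {P : Measure ((Fin d → ℝ) × ℝ)} [IsProbabilityMeasure P]
    (h : ∀ j : Fin d, MemLp (fun z : (Fin d → ℝ) × ℝ => z.1 j) 2 P) : (covX P).PosSemidef := by
  refine posSemidef_of_transpose_eq (covX_transpose P) fun v => ?_
  rw [covX, dotProduct_covariance_mulVec h, covariance_self (by fun_prop)]
  exact variance_nonneg _ _

/-- The linearity condition and conditional independence confine both `Σ_{E(x ∣ y)}` and the
covariances with the reduced covariates to the reduced covariates: replacing `x` by its linear
prediction `β B x` changes neither. -/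
theorem exists_linear_reduction {P : Measure ((Fin d → ℝ) × ℝ)} [IsProbabilityMeasure P]
    (h : ∀ j : Fin d, MemLp (fun z : (Fin d → ℝ) × ℝ => z.1 j) 2 P)
    {β : Matrix (Fin d) (Fin K) ℝ} (hdr : IsDimensionReduction P β)
    (hlin : LinearityCondition P β) :
    ∃ B : Matrix (Fin K) (Fin d) ℝ, covCondMean P * β * B = covCondMean P ∧
      βᵀ * covX P * β * B = βᵀ * covX P := by
  choose b₀ b hb using fun j : Fin d => hlin (Pi.single j 1)
  set B : Matrix (Fin K) (Fin d) ℝ := Matrix.of fun k j => b j k with hB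
  -- the prediction error of the coordinate `x_j`
  set a : Fin d → Fin d → ℝ := fun j => Pi.single j 1 - β *ᵥ b j with ha
  have hcol : ∀ {m : ℕ} (M : Matrix (Fin m) (Fin d) ℝ), (∀ j, M *ᵥ a j = 0) →
      M * β * B = M := by
    intro m M hM
    ext i j
    have := congrFun (hM j) i
    rw [ha, Matrix.mulVec_sub, Matrix.mulVec_mulVec, Pi.sub_apply, Pi.zero_apply, sub_eq_zero]
      at this
    rw [Matrix.mulVec_single_one] at this
    exact this.symm
  have hmle := reducedSigma_le β
  set Z : Fin d → (Fin d → ℝ) × ℝ → ℝ := fun j z => a j ⬝ᵥ z.1 with hZ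
  have hmem : ∀ v : Fin d → ℝ, MemLp (fun z : (Fin d → ℝ) × ℝ => v ⬝ᵥ z.1) 2 P := fun v =>
    memLp_finsetSum _ fun j _ => (h j).const_mul (v j)
  have hred : ∀ k : Fin K, StronglyMeasurable[reducedSigma β]
      fun z : (Fin d → ℝ) × ℝ => reducedX β z k :=
    fun k => ((measurable_pi_apply k).comp (comap_measurable (reducedX β))).stronglyMeasurable
  have hcomb : ∀ j z, Z j z = (Pi.single j 1 : Fin d → ℝ) ⬝ᵥ z.1 - b j ⬝ᵥ reducedX β z := by
    intro j z
    simp only [hZ, ha, sub_dotProduct, reducedX]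
    congr 1
    rw [Matrix.dotProduct_mulVec, ← Matrix.mulVec_transpose, Matrix.transpose_transpose]
  have hredm : ∀ j, StronglyMeasurable[reducedSigma β] fun z => b j ⬝ᵥ reducedX β z := by
    intro j
    simp only [dotProduct]
    exact Finset.stronglyMeasurable_fun_sum _ fun k _ => (hred k).const_mul (b j k)
  have hredi : ∀ j, Integrable (fun z => b j ⬝ᵥ reducedX β z) P := by
    intro j
    have := (hmem (β *ᵥ b j)).integrable one_le_two
    refine this.congr (.of_forall fun z => ?_)
    simp only [reducedX]
    rw [Matrix.dotProduct_mulVec, ← Matrix.mulVec_transpose, Matrix.transpose_transpose]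
  have hZm : ∀ j, P[Z j | reducedSigma β] =ᵐ[P] fun _ => b₀ j := by
    intro j
    have e : Z j = (fun z => (Pi.single j 1 : Fin d → ℝ) ⬝ᵥ z.1)
        - fun z => b j ⬝ᵥ reducedX β z := funext fun z => hcomb j z
    rw [e]
    filter_upwards [condExp_sub ((hmem (Pi.single j 1)).integrable one_le_two) (hredi j)
      (reducedSigma β),
      hb j] with z h1 h2
    rw [h1, Pi.sub_apply, h2, condExp_of_stronglyMeasurable hmle (hredm j) (hredi j)]
    ring
  have hZi : ∀ j, Integrable (Z j) P := fun j => (hmem (a j)).integrable one_le_two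
  have hZmean : ∀ j, ∫ z, Z j z ∂P = b₀ j := by
    intro j
    rw [← integral_condExp hmle, integral_congr_ae (hZm j)]
    simp
  refine ⟨B, hcol _ fun j => ?_, hcol _ fun j => ?_⟩
  · -- `E(Z_j ∣ y)` is constant
    have hy : P[Z j | MeasurableSpace.comap (Prod.snd : (Fin d → ℝ) × ℝ → ℝ) inferInstance]
        =ᵐ[P] fun _ => b₀ j := by
      have hx : StronglyMeasurable[MeasurableSpace.comap
          (Prod.fst : (Fin d → ℝ) × ℝ → Fin d → ℝ) inferInstance] (Z j) := by
        have : Continuous fun x : Fin d → ℝ => a j ⬝ᵥ x := by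
          simp only [dotProduct]; fun_prop
        exact (this.measurable.comp (comap_measurable _)).stronglyMeasurable
      have hmx : reducedSigma β ≤ MeasurableSpace.comap
          (Prod.fst : (Fin d → ℝ) × ℝ → Fin d → ℝ) inferInstance := by
        have : Measurable fun x : Fin d → ℝ => βᵀ *ᵥ x :=
          (Continuous.matrix_mulVec continuous_const continuous_id).measurable
        exact (this.comp (comap_measurable
          (Prod.fst : (Fin d → ℝ) × ℝ → Fin d → ℝ))).comap_le
      have h0 := condExp_eq_zero_of_condIndepFun measurable_fst measurable_snd hmx hdr
        (Z := fun z => Z j z - b₀ j) (hx.sub stronglyMeasurable_const)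
        ((hZi j).sub (integrable_const _)) (by
          have := condExp_sub (hZi j) (integrable_const (b₀ j)) (reducedSigma β)
          filter_upwards [this, hZm j] with z h1 h2
          rw [show (fun z => Z j z - b₀ j) = Z j - fun _ => b₀ j from rfl, h1, Pi.sub_apply, h2,
            condExp_const hmle]
          simp)
      have := condExp_sub (hZi j) (integrable_const (b₀ j))
        (MeasurableSpace.comap (Prod.snd : (Fin d → ℝ) × ℝ → ℝ) inferInstance)
      filter_upwards [this, h0] with z h1 h2
      rw [show (fun z => Z j z - b₀ j) = Z j - fun _ => b₀ j from rfl, h1, Pi.sub_apply,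
        condExp_const comap_snd_le, Pi.zero_apply] at h2
      linarith
    have hsum : (fun z => ∑ i, a j i * condMeanX P i z) =ᵐ[P] fun _ => b₀ j := by
      have e : Z j = ∑ i, a j i • fun z : (Fin d → ℝ) × ℝ => z.1 i := by
        ext z; simp [hZ, dotProduct]
      have h1 := condExp_finsetSum (s := Finset.univ)
        (f := fun i => a j i • fun z : (Fin d → ℝ) × ℝ => z.1 i)
        (fun i _ => ((h i).integrable one_le_two).smul (a j i))
        (MeasurableSpace.comap (Prod.snd : (Fin d → ℝ) × ℝ → ℝ) inferInstance) (μ := P)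
      have h2 : ∀ᵐ z ∂P, ∀ i, P[a j i • fun z : (Fin d → ℝ) × ℝ => z.1 i |
          MeasurableSpace.comap (Prod.snd : (Fin d → ℝ) × ℝ → ℝ) inferInstance] z
          = a j i * condMeanX P i z :=
        ae_all_iff.2 fun i => by
          filter_upwards [condExp_smul (μ := P) (a j i) (fun z : (Fin d → ℝ) × ℝ => z.1 i)
            (MeasurableSpace.comap (Prod.snd : (Fin d → ℝ) × ℝ → ℝ) inferInstance)] with z hz
          rw [hz]; rfl
      rw [← e] at h1
      filter_upwards [h1, h2, hy] with z g1 g2 g3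
      rw [← g3, g1, Finset.sum_apply]
      exact Finset.sum_congr rfl fun i _ => (g2 i).symm
    rw [← dotProduct_self_eq_zero]
    rw [show covCondMean P = Matrix.of fun j k => covariance (condMeanX P j) (condMeanX P k) P
      from rfl, dotProduct_covariance_mulVec (memLp_condMeanX h)]
    have hdev : (fun z => (fun z => ∑ i, a j i * condMeanX P i z) z
        - ∫ z, (fun z => ∑ i, a j i * condMeanX P i z) z ∂P) =ᵐ[P] 0 := by
      filter_upwards [hsum] with z hz
      rw [integral_congr_ae hsum, hz]
      simp
    rw [covariance]
    refine integral_eq_zero_of_ae ?_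
    filter_upwards [hdev] with z hz
    rw [hz, Pi.zero_apply, mul_zero]
  · ext k
    rw [← Matrix.mulVec_mulVec]
    have e : (βᵀ *ᵥ (covX P *ᵥ a j)) k = (fun i => β i k) ⬝ᵥ (covX P *ᵥ a j) := rfl
    rw [e, covX, dotProduct_covariance_mulVec h]
    change covariance (fun z : (Fin d → ℝ) × ℝ => reducedX β z k) (Z j) P = 0
    have hk : MemLp (fun z : (Fin d → ℝ) × ℝ => reducedX β z k) 2 P := hmem fun i => β i k
    rw [covariance_eq_sub hk (hmem (a j)), hZmean, ← integral_condExp hmle]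
    have hint := hk.integrable_mul (hmem (a j))
    have : P[(fun z : (Fin d → ℝ) × ℝ => reducedX β z k) * Z j | reducedSigma β]
        =ᵐ[P] fun z => reducedX β z k * b₀ j := by
      filter_upwards [condExp_mul_of_stronglyMeasurable_left (hred k) hint (hZi j), hZm j]
        with z h1 h2
      rw [h1, Pi.mul_apply, h2]
    rw [integral_congr_ae this, integral_mul_const, sub_self]

end Population

end SparseSIR

namespace SparseSIR

section Factorization

variable {d K : ℕ}

theorem mul_eq_zero_of_form_eq_zero {m : ℕ} {S : Matrix (Fin d) (Fin d) ℝ} (hS : S.PosSemidef)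
    {E : Matrix (Fin d) (Fin m) ℝ} (h : Eᵀ * S * E = 0) : S * E = 0 := by
  have h1 : (CFC.sqrt S * E)ᵀ * (CFC.sqrt S * E) = 0 := by
    rw [Matrix.transpose_mul, sqrt_transpose, Matrix.mul_assoc, ← Matrix.mul_assoc (CFC.sqrt S),
      sqrt_mul_sqrt_of_posSemidef hS, ← Matrix.mul_assoc, h]
  rw [← Matrix.conjTranspose_eq_transpose_of_trivial,
    Matrix.conjTranspose_mul_self_eq_zero] at h1
  rw [← sqrt_mul_sqrt_of_posSemidef hS, Matrix.mul_assoc, h1, Matrix.mul_zero]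

/-- Generalized eigenvectors for `K` positive generalized eigenvalues can be chosen in the span of
the `K` columns of `β`, which they then span, and they factorize `A`. No invertibility of `S` is
needed. -/
theorem exists_eigenvectors_in_colSpan {A S : Matrix (Fin d) (Fin d) ℝ} (hS : S.PosSemidef)
    (hA : Aᵀ = A) {β V : Matrix (Fin d) (Fin K) ℝ} {B : Matrix (Fin K) (Fin d) ℝ}
    {μ : Fin K → ℝ} (hAB : A * β * B = A) (hSB : βᵀ * S * β * B = βᵀ * S)
    (hV : Vᵀ * S * V = 1) (hAV : A * V = S * V * Matrix.diagonal μ) (hμ : ∀ k, μ k ≠ 0) :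
    ∃ U : Matrix (Fin d) (Fin K) ℝ, Uᵀ * S * U = 1 ∧
      A = S * U * Matrix.diagonal μ * Uᵀ * S ∧ A * U = S * U * Matrix.diagonal μ ∧
      colSpan U = colSpan β := by
  have hSt := transpose_eq_of_posSemidef hS
  obtain ⟨X, hX⟩ : ∃ X, X = B * V := ⟨_, rfl⟩
  obtain ⟨U, hU⟩ : ∃ U, U = β * X := ⟨_, rfl⟩
  have hAU : A * U = A * V := by
    rw [hU, hX, ← Matrix.mul_assoc, ← Matrix.mul_assoc, hAB]
  have hβU : βᵀ * S * U = βᵀ * S * V := by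
    rw [hU, hX, ← Matrix.mul_assoc, ← Matrix.mul_assoc, hSB]
  have hUSV : Uᵀ * S * V = Uᵀ * S * U := by
    have : ∀ Z : Matrix (Fin d) (Fin K) ℝ, Uᵀ * S * Z = Xᵀ * (βᵀ * S * Z) := fun Z => by
      rw [hU, Matrix.transpose_mul]; simp only [Matrix.mul_assoc]
    rw [this, this, hβU]
  set E := V - U with hE
  have hAE : A * E = 0 := by rw [hE, Matrix.mul_sub, hAU, sub_self]
  have hEA : Eᵀ * A = 0 := by
    have := congrArg Matrix.transpose hAE
    rwa [Matrix.transpose_mul, hA, Matrix.transpose_zero] at this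
  have hESV : Eᵀ * S * V = 0 := by
    have h1 : (Eᵀ * S * V) * Matrix.diagonal μ = 0 := by
      rw [Matrix.mul_assoc, Matrix.mul_assoc, ← Matrix.mul_assoc S, ← hAV, ← Matrix.mul_assoc, hEA,
        Matrix.zero_mul]
    ext i j
    have := congrFun (congrFun h1 i) j
    rw [Matrix.mul_diagonal, Matrix.zero_apply] at this
    exact (mul_eq_zero.1 this).resolve_right (hμ j)
  have hESU : Eᵀ * S * U = 0 := by
    have : Uᵀ * S * E = 0 := by rw [hE, Matrix.mul_sub, hUSV, sub_self]
    have := congrArg Matrix.transpose this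
    simpa [Matrix.mul_assoc, hSt] using this
  have hSE : S * E = 0 := mul_eq_zero_of_form_eq_zero hS (by
    conv_lhs => rw [hE, Matrix.mul_sub, ← hE, hESV, hESU, sub_self])
  have hSU : S * U = S * V := by
    rw [hE, Matrix.mul_sub, sub_eq_zero] at hSE
    exact hSE.symm
  have hUSU : Uᵀ * S * U = 1 := by
    have h1 : Uᵀ * S = Vᵀ * S := by
      have := congrArg Matrix.transpose hSU
      rwa [Matrix.transpose_mul, Matrix.transpose_mul, hSt] at this
    rw [← hUSV, h1, hV]
  have hXinv : (Xᵀ * βᵀ * S * β) * X = 1 := by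
    rw [← hUSU, hU, Matrix.transpose_mul]; simp only [Matrix.mul_assoc]
  have hXinv' := mul_eq_one_comm.1 hXinv
  have hXdet : IsUnit X.det := by
    have := congrArg Matrix.det hXinv
    rw [Matrix.det_mul, Matrix.det_one, mul_comm] at this
    exact IsUnit.of_mul_eq_one _ this
  have hAU' : A * U = S * U * Matrix.diagonal μ := by rw [hAU, hAV, hSU]
  refine ⟨U, hUSU, ?_, hAU', by rw [hU, colSpan_mul_of_isUnit_det β hXdet]⟩
  have h1 : X * (Uᵀ * S) = B := by
    have : Uᵀ * S = Xᵀ * (βᵀ * S * β * B) := by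
      rw [hSB, hU, Matrix.transpose_mul]; simp only [Matrix.mul_assoc]
    rw [this]
    calc X * (Xᵀ * (βᵀ * S * β * B)) = X * (Xᵀ * βᵀ * S * β) * B := by
          simp only [Matrix.mul_assoc]
      _ = B := by rw [hXinv', Matrix.one_mul]
  rw [← hAU']
  conv_lhs => rw [← hAB, ← h1]
  rw [hU]
  simp only [Matrix.mul_assoc]

/-- The population matrix `Σ_{E(x ∣ y)}` factorizes through generalized eigenvectors that span the
dimension reduction subspace. -/
theorem exists_population_factorization {P : Measure ((Fin d → ℝ) × ℝ)} [IsProbabilityMeasure P]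
    (h : ∀ j : Fin d, MemLp (fun z : (Fin d → ℝ) × ℝ => z.1 j) 2 P) (hK : 0 < K)
    {β : Matrix (Fin d) (Fin K) ℝ} {lam : ℝ} (hdr : IsDimensionReduction P β)
    (hlin : LinearityCondition P β)
    (hgen : IsKthGenEigenvalue (covCondMean P) (covX P) K lam) (hlam : 0 < lam) :
    ∃ (U : Matrix (Fin d) (Fin K) ℝ) (μ : Fin K → ℝ), Uᵀ * covX P * U = 1 ∧
      covCondMean P = covX P * U * Matrix.diagonal μ * Uᵀ * covX P ∧
      (∀ k, lam ≤ μ k) ∧ (∀ k, μ k ≤ 1) ∧ lam ≤ 1 ∧ colSpan U = colSpan β := by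
  obtain ⟨V, μ, hV, hAV, hleast, -⟩ := hgen
  obtain ⟨B, hAB, hSB⟩ := exists_linear_reduction h hdr hlin
  have hμ : ∀ k, lam ≤ μ k := fun k => hleast.2 ⟨k, rfl⟩
  obtain ⟨U, hU, hA, hAU, hspan⟩ := exists_eigenvectors_in_colSpan (covX_posSemidef h)
    (covCondMean_transpose P) hAB hSB hV hAV (fun k => (hlam.trans_le (hμ k)).ne')
  have hμ1 : ∀ k, μ k ≤ 1 := by
    intro k
    have h1 := covCondMean_form_le h (U *ᵥ Pi.single k 1)
    have e : ∀ M : Matrix (Fin d) (Fin d) ℝ, (U *ᵥ Pi.single k 1) ⬝ᵥ (M *ᵥ (U *ᵥ Pi.single k 1))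
        = (Uᵀ * M * U) k k := by
      intro M
      have := dotProduct_conj_mulVec M Uᵀ (Pi.single k 1)
      rw [Matrix.transpose_transpose] at this
      rw [← this]
      simp
    rw [e, e, hU, Matrix.mul_assoc, hAU, ← Matrix.mul_assoc, ← Matrix.mul_assoc, hU,
      Matrix.one_mul] at h1
    simpa using h1
  exact ⟨U, μ, hU, hA, hμ, hμ1, (hμ ⟨0, hK⟩).trans (hμ1 _), hspan⟩

/-- The rows of `U` outside the support of the projection onto its column span vanish. -/
theorem eq_zero_of_projMatrix_diag_eq_zero {U : Matrix (Fin d) (Fin K) ℝ} {j : Fin d}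
    (hj : projMatrix (colSpan U) j j = 0) (k : Fin K) : U j k = 0 := by
  set W := colSpan U
  set e : EuclideanSpace ℝ (Fin d) := EuclideanSpace.single j 1 with he
  have h0 : W.starProjection e = 0 := by
    have h1 : inner ℝ (W.starProjection e) (W.starProjection e) = (0 : ℝ) := by
      rw [Submodule.inner_starProjection_left_eq_right,
        Submodule.starProjection_eq_self_iff.2 (Submodule.starProjection_apply_mem _ _)]
      have : inner ℝ e (W.starProjection e) = (W.starProjection e) j := by
        rw [he, EuclideanSpace.inner_single_left]; simp
      rw [this]
      exact hj
    exact inner_self_eq_zero.1 h1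
  have hu : (WithLp.toLp 2 fun i => U i k : EuclideanSpace ℝ (Fin d)) ∈ W :=
    Submodule.subset_span ⟨k, rfl⟩
  have h2 : inner ℝ e (WithLp.toLp 2 fun i => U i k : EuclideanSpace ℝ (Fin d)) = U j k := by
    rw [he, EuclideanSpace.inner_single_left]; simp
  rw [← h2, ← Submodule.starProjection_eq_self_iff.2 hu,
    ← Submodule.inner_starProjection_left_eq_right, h0, inner_zero_left]

/-- Bessel's inequality for columns that are orthonormal for `S`. -/
theorem sum_sq_transpose_mulVec_le {S : Matrix (Fin d) (Fin d) ℝ} (hS : S.PosSemidef)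
    {U : Matrix (Fin d) (Fin K) ℝ} (hU : Uᵀ * S * U = 1) (v : Fin d → ℝ) :
    ∑ k, ((Uᵀ *ᵥ (S *ᵥ v)) k) ^ 2 ≤ v ⬝ᵥ (S *ᵥ v) := by
  set y := Uᵀ *ᵥ (S *ᵥ v) with hy
  have hSt := transpose_eq_of_posSemidef hS
  have h0 := dotProduct_nonneg_of_posSemidef hS (v - U *ᵥ y)
  have e1 : (U *ᵥ y) ⬝ᵥ (S *ᵥ v) = y ⬝ᵥ y := by
    conv_rhs => rw [hy]
    rw [← hy, Matrix.dotProduct_mulVec y, Matrix.vecMul_transpose]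
  have e2 : v ⬝ᵥ (S *ᵥ (U *ᵥ y)) = y ⬝ᵥ y := by
    rw [Matrix.dotProduct_mulVec, ← Matrix.mulVec_transpose, hSt, dotProduct_comm, e1]
  have e3 : (U *ᵥ y) ⬝ᵥ (S *ᵥ (U *ᵥ y)) = y ⬝ᵥ y := by
    have := dotProduct_conj_mulVec S Uᵀ y
    rw [Matrix.transpose_transpose, hU, Matrix.one_mulVec] at this
    exact this.symm
  simp only [Matrix.mulVec_sub, dotProduct_sub, sub_dotProduct, e1, e2, e3] at h0
  have e4 : ∑ k, y k ^ 2 = y ⬝ᵥ y := by simp [dotProduct, sq]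
  rw [e4]
  linarith

end Factorization

end SparseSIR

namespace SparseSIR

/-! ### Exponential moments of products of sub-Gaussian variables -/

section ExponentialMoments

/-- The remainder `e^x - 1 - x` of the exponential function. -/
noncomputable def expRem (x : ℝ) : ℝ := Real.exp x - 1 - x

theorem expRem_nonneg (x : ℝ) : 0 ≤ expRem x := by
  have := Real.add_one_le_exp x
  unfold expRem; linarith

theorem measurable_expRem : Measurable expRem := by unfold expRem; fun_prop

theorem expRem_mono {x y : ℝ} (hx : 0 ≤ x) (hxy : x ≤ y) : expRem x ≤ expRem y := by
  have h1 : Real.exp y = Real.exp x * Real.exp (y - x) := by rw [← Real.exp_add]; congr 1; ring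
  have h2 := Real.add_one_le_exp (y - x)
  have h3 := Real.one_le_exp hx
  unfold expRem
  rw [h1]
  nlinarith

theorem expRem_midpoint_le (x y : ℝ) : expRem ((x + y) / 2) ≤ (expRem x + expRem y) / 2 := by
  have h1 : Real.exp ((x + y) / 2) = Real.exp (x / 2) * Real.exp (y / 2) := by
    rw [← Real.exp_add]; congr 1; ring
  have h2 : Real.exp x = Real.exp (x / 2) ^ 2 := by rw [← Real.exp_nat_mul]; congr 1; ring
  have h3 : Real.exp y = Real.exp (y / 2) ^ 2 := by rw [← Real.exp_nat_mul]; congr 1; ring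
  unfold expRem
  rw [h1, h2, h3]
  nlinarith [sq_nonneg (Real.exp (x / 2) - Real.exp (y / 2))]

theorem exp_le_one_add_expRem_abs (u : ℝ) : Real.exp u ≤ 1 + u + expRem |u| := by
  rcases le_total 0 u with h | h
  · rw [abs_of_nonneg h, expRem]; linarith
  · rw [abs_of_nonpos h, expRem]
    have h1 : -u ≤ Real.sinh (-u) := Real.self_le_sinh_iff.2 (by linarith)
    rw [Real.sinh_eq, neg_neg] at h1
    linarith

theorem exp_mul_le (t x y : ℝ) :
    Real.exp (t * (x * y)) ≤
      1 + t * (x * y) + (expRem (|t| * x ^ 2) + expRem (|t| * y ^ 2)) / 2 := by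
  refine (exp_le_one_add_expRem_abs _).trans ?_
  have h1 : |t * (x * y)| ≤ (|t| * x ^ 2 + |t| * y ^ 2) / 2 := by
    rw [abs_mul, abs_mul]
    have : |x| * |y| ≤ (x ^ 2 + y ^ 2) / 2 := by
      have := sq_nonneg (|x| - |y|)
      rw [sub_sq, sq_abs, sq_abs] at this
      linarith
    calc |t| * (|x| * |y|) ≤ |t| * ((x ^ 2 + y ^ 2) / 2) := by gcongr
      _ = _ := by ring
  have h2 := (expRem_mono (abs_nonneg _) h1).trans (expRem_midpoint_le _ _)
  linarith

theorem hasSum_expRem (x : ℝ) :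
    HasSum (fun q : ℕ => x ^ (q + 2) / (q + 2).factorial) (expRem x) := by
  have h := NormedSpace.expSeries_div_hasSum_exp x
  rw [← Real.exp_eq_exp_ℝ] at h
  have h2 := (hasSum_nat_add_iff' 2).2 h
  have e : Real.exp x - ∑ i ∈ Finset.range 2, x ^ i / (i.factorial : ℝ) = expRem x := by
    simp only [Finset.sum_range_succ, Finset.sum_range_zero, expRem]
    norm_num
    ring
  rw [e] at h2
  exact h2

variable {Ω : Type*} [MeasurableSpace Ω] {P : Measure Ω}

theorem SubGaussianNormLE.lintegral_pow_le {X : Ω → ℝ} {L : ℝ} (hL : 0 ≤ L)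
    (h : SubGaussianNormLE X L P) {q : ℕ} (hq : 0 < q) :
    ∫⁻ ω, ENNReal.ofReal (X ω ^ (2 * q)) ∂P ≤ ENNReal.ofReal ((L ^ 2 * (2 * q)) ^ q) := by
  have hq1 : (1 : ℝ) ≤ ((2 * q : ℕ) : ℝ) := by exact_mod_cast (by omega : 1 ≤ 2 * q)
  have h1 := h _ hq1
  rw [ENNReal.ofReal_natCast, eLpNorm_eq_lintegral_rpow_enorm_toReal (by simp; omega)
    (ENNReal.natCast_ne_top _),
    ENNReal.toReal_natCast] at h1
  have h2 := ENNReal.rpow_le_rpow h1 (z := ((2 * q : ℕ) : ℝ)) (by positivity)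
  rw [← ENNReal.rpow_mul, one_div, inv_mul_cancel₀ (by positivity), ENNReal.rpow_one,
    ENNReal.rpow_natCast, ← ENNReal.ofReal_pow (by positivity)] at h2
  calc ∫⁻ ω, ENNReal.ofReal (X ω ^ (2 * q)) ∂P
      = ∫⁻ ω, ‖X ω‖ₑ ^ ((2 * q : ℕ) : ℝ) ∂P := by
        refine lintegral_congr fun ω => ?_
        rw [ENNReal.rpow_natCast, Real.enorm_eq_ofReal_abs, ← ENNReal.ofReal_pow (abs_nonneg _),
          (even_two_mul q).pow_abs]
    _ ≤ _ := h2
    _ = _ := by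
        congr 1
        rw [pow_mul, mul_pow, Real.sq_sqrt (by positivity)]
        push_cast
        rfl

/-- The constant `2 e L²` in the exponential moment bounds. -/
noncomputable def sqExpConst (L : ℝ) : ℝ := 2 * Real.exp 1 * L ^ 2

theorem sqExpConst_pos {L : ℝ} (hL : 0 < L) : 0 < sqExpConst L := by
  unfold sqExpConst; positivity

theorem SubGaussianNormLE.lintegral_expRem_le {X : Ω → ℝ} (hX : Measurable X) {L : ℝ}
    (hL : 0 ≤ L) (h : SubGaussianNormLE X L P) {t : ℝ} (ht : 0 ≤ t)
    (htL : sqExpConst L * t ≤ 1 / 2) :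
    ∫⁻ ω, ENNReal.ofReal (expRem (t * X ω ^ 2)) ∂P
      ≤ ENNReal.ofReal (2 * (sqExpConst L * t) ^ 2) := by
  set r := sqExpConst L * t with hr
  have hr0 : 0 ≤ r := by rw [hr, sqExpConst]; positivity
  have hterm : ∀ q : ℕ, ∫⁻ ω, ENNReal.ofReal ((t * X ω ^ 2) ^ (q + 2) / (q + 2).factorial) ∂P
      ≤ ENNReal.ofReal (r ^ (q + 2)) := by
    intro q
    set k := q + 2 with hk
    have e : ∀ ω, ENNReal.ofReal ((t * X ω ^ 2) ^ k / k.factorial)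
        = ENNReal.ofReal (t ^ k / k.factorial) * ENNReal.ofReal (X ω ^ (2 * k)) := by
      intro ω
      rw [← ENNReal.ofReal_mul (by positivity)]
      congr 1
      rw [mul_pow, ← pow_mul]; ring
    simp only [e]
    rw [lintegral_const_mul _ (by fun_prop)]
    refine (mul_le_mul_right (h.lintegral_pow_le hL (q := k) (by omega)) _).trans ?_
    rw [← ENNReal.ofReal_mul (by positivity)]
    refine ENNReal.ofReal_le_ofReal ?_
    have h3 := Real.pow_div_factorial_le_exp (k : ℝ) (by positivity) k
    calc t ^ k / k.factorial * (L ^ 2 * (2 * k)) ^ k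
        = (2 * L ^ 2 * t) ^ k * ((k : ℝ) ^ k / k.factorial) := by
          simp only [mul_pow]; ring
      _ ≤ (2 * L ^ 2 * t) ^ k * Real.exp k := by gcongr
      _ = r ^ k := by
          rw [hr, sqExpConst, ← Real.exp_one_pow]
          simp only [mul_pow]; ring
  have hexp : ∀ ω, ENNReal.ofReal (expRem (t * X ω ^ 2))
      = ∑' q : ℕ, ENNReal.ofReal ((t * X ω ^ 2) ^ (q + 2) / (q + 2).factorial) := by
    intro ω
    have hs := hasSum_expRem (t * X ω ^ 2)
    rw [← ENNReal.ofReal_tsum_of_nonneg (fun q => by positivity) hs.summable, hs.tsum_eq]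
  simp only [hexp]
  rw [lintegral_tsum fun q => by fun_prop]
  have hgeo : HasSum (fun q : ℕ => r ^ (q + 2)) (r ^ 2 * (1 - r)⁻¹) := by
    have := (hasSum_geometric_of_lt_one hr0 (by linarith)).mul_left (r ^ 2)
    have e : (fun q : ℕ => r ^ (q + 2)) = fun q => r ^ 2 * r ^ q := by
      ext q; rw [pow_add, mul_comm]
    rw [e]; exact this
  refine (ENNReal.tsum_le_tsum hterm).trans ?_
  rw [← ENNReal.ofReal_tsum_of_nonneg (fun q => by positivity) hgeo.summable, hgeo.tsum_eq]
  refine ENNReal.ofReal_le_ofReal ?_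
  have : (1 - r)⁻¹ ≤ 2 := by
    rw [inv_le_comm₀ (by linarith) (by norm_num)]; linarith
  nlinarith [sq_nonneg r]

theorem SubGaussianNormLE.lintegral_exp_le [IsProbabilityMeasure P] {X : Ω → ℝ}
    (hX : Measurable X) {L : ℝ} (hL : 0 ≤ L) (h : SubGaussianNormLE X L P) {t : ℝ} (ht : 0 ≤ t)
    (htL : sqExpConst L * t ≤ 1 / 2) :
    ∫⁻ ω, ENNReal.ofReal (Real.exp (t * X ω ^ 2)) ∂P ≤ 2 := by
  have e : ∀ ω, ENNReal.ofReal (Real.exp (t * X ω ^ 2))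
      = 1 + ENNReal.ofReal t * ENNReal.ofReal (X ω ^ (2 * 1))
        + ENNReal.ofReal (expRem (t * X ω ^ 2)) := by
    intro ω
    have hx : 0 ≤ t * X ω ^ (2 * 1) := mul_nonneg ht ((even_two_mul 1).pow_nonneg _)
    rw [← ENNReal.ofReal_one, ← ENNReal.ofReal_mul ht, ← ENNReal.ofReal_add zero_le_one hx,
      ← ENNReal.ofReal_add (by linarith) (expRem_nonneg _)]
    congr 1
    rw [expRem]; ring
  have hm : Measurable fun ω => ENNReal.ofReal (expRem (t * X ω ^ 2)) :=
    (measurable_expRem.comp (by fun_prop)).ennreal_ofReal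
  simp only [e]
  rw [lintegral_add_right _ hm, lintegral_add_right _ (by fun_prop),
    lintegral_const_mul _ (by fun_prop), lintegral_one, measure_univ]
  have h1 := h.lintegral_pow_le hL one_pos
  have h2 := h.lintegral_expRem_le hX hL ht htL
  have ha0 : 0 ≤ sqExpConst L * t := by rw [sqExpConst]; positivity
  have h3 : ENNReal.ofReal t * ∫⁻ ω, ENNReal.ofReal (X ω ^ (2 * 1)) ∂P
      ≤ ENNReal.ofReal (1 / 2) := by
    refine (mul_le_mul_right h1 _).trans ?_
    rw [← ENNReal.ofReal_mul ht]
    refine ENNReal.ofReal_le_ofReal (le_trans ?_ htL)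
    have he : 1 ≤ Real.exp 1 := Real.one_le_exp zero_le_one
    have : 0 ≤ L ^ 2 * t := by positivity
    simp only [sqExpConst]
    push_cast
    nlinarith
  calc 1 + ENNReal.ofReal t * ∫⁻ ω, ENNReal.ofReal (X ω ^ (2 * 1)) ∂P
        + ∫⁻ ω, ENNReal.ofReal (expRem (t * X ω ^ 2)) ∂P
      ≤ ENNReal.ofReal 1 + ENNReal.ofReal (1 / 2) + ENNReal.ofReal (1 / 2) := by
        refine add_le_add (add_le_add (by simp) h3) (h2.trans (ENNReal.ofReal_le_ofReal ?_))
        nlinarith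
    _ = 2 := by
        rw [← ENNReal.ofReal_add (by norm_num) (by norm_num),
          ← ENNReal.ofReal_add (by norm_num) (by norm_num)]
        norm_num

theorem SubGaussianNormLE.neg {X : Ω → ℝ} {L : ℝ} (h : SubGaussianNormLE X L P) :
    SubGaussianNormLE (fun ω => -X ω) L P := by
  intro p hp
  have := h p hp
  rwa [← eLpNorm_neg] at this

theorem SubGaussianNormLE.mono {X : Ω → ℝ} {L L' : ℝ} (h : SubGaussianNormLE X L P)
    (hL : L ≤ L') : SubGaussianNormLE X L' P := fun p hp =>
  (h p hp).trans (ENNReal.ofReal_le_ofReal (by gcongr))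

theorem SubGaussianNormLE.memLp {X : Ω → ℝ} (hX : Measurable X) {L : ℝ}
    (h : SubGaussianNormLE X L P) : MemLp X 2 P := by
  refine ⟨hX.aestronglyMeasurable, ?_⟩
  have := h 2 one_le_two
  exact lt_of_le_of_lt (by simpa using this) ENNReal.ofReal_lt_top

theorem subGaussianNormLE_const [IsProbabilityMeasure P] {a : ℝ} :
    SubGaussianNormLE (fun _ : Ω => a) |a| P := by
  intro p hp
  have hp0 : ENNReal.ofReal p ≠ 0 := by simp; linarith
  rw [eLpNorm_const _ hp0 (IsProbabilityMeasure.ne_zero P), measure_univ, ENNReal.one_rpow, mul_one,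
    Real.enorm_eq_ofReal_abs]
  refine ENNReal.ofReal_le_ofReal ?_
  have : 1 ≤ √p := Real.one_le_sqrt.2 hp
  nlinarith [abs_nonneg a]

theorem SubGaussianNormLE.integrable_expRem {X : Ω → ℝ} (hX : Measurable X) {L : ℝ}
    (hL : 0 ≤ L) (h : SubGaussianNormLE X L P) {t : ℝ} (ht : 0 ≤ t)
    (htL : sqExpConst L * t ≤ 1 / 2) :
    Integrable (fun ω => expRem (t * X ω ^ 2)) P ∧
      ∫ ω, expRem (t * X ω ^ 2) ∂P ≤ 2 * (sqExpConst L * t) ^ 2 := by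
  have hb := h.lintegral_expRem_le hX hL ht htL
  have hm : Measurable fun ω => expRem (t * X ω ^ 2) := measurable_expRem.comp (by fun_prop)
  have hi : Integrable (fun ω => expRem (t * X ω ^ 2)) P := by
    refine ⟨hm.aestronglyMeasurable, ?_⟩
    rw [hasFiniteIntegral_iff_ofReal (.of_forall fun ω => expRem_nonneg _)]
    exact lt_of_le_of_lt hb ENNReal.ofReal_lt_top
  refine ⟨hi, ?_⟩
  rw [← ofReal_integral_eq_lintegral_ofReal hi (.of_forall fun ω => expRem_nonneg _)] at hb
  exact (ENNReal.ofReal_le_ofReal_iff (by positivity)).1 hb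

/-- A product of sub-Gaussian variables is sub-exponential. -/
theorem integrable_exp_mul_and_mgf_le [IsProbabilityMeasure P] {g h : Ω → ℝ}
    (hg : Measurable g) (hh : Measurable h) {L : ℝ} (hL : 0 ≤ L) (hgL : SubGaussianNormLE g L P)
    (hhL : SubGaussianNormLE h L P) {t : ℝ} (ht : 0 ≤ t) (htL : sqExpConst L * t ≤ 1 / 2) :
    Integrable (fun ω => Real.exp (t * (g ω * h ω - ∫ ω, g ω * h ω ∂P))) P ∧
      mgf (fun ω => g ω * h ω - ∫ ω, g ω * h ω ∂P) P t
        ≤ Real.exp (2 * (sqExpConst L * t) ^ 2) := by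
  set e := ∫ ω, g ω * h ω ∂P with he
  obtain ⟨ig, bg⟩ := hgL.integrable_expRem hg hL ht htL
  obtain ⟨ih, bh⟩ := hhL.integrable_expRem hh hL ht htL
  have igh : Integrable (fun ω => g ω * h ω) P := (hgL.memLp hg).integrable_mul (hhL.memLp hh)
  have ib : Integrable (fun ω => 1 + t * (g ω * h ω)
      + (expRem (t * g ω ^ 2) + expRem (t * h ω ^ 2)) / 2) P :=
    ((integrable_const _).add (igh.const_mul t)).add ((ig.add ih).div_const 2)
  have hle : ∀ ω, Real.exp (t * (g ω * h ω)) ≤ 1 + t * (g ω * h ω)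
      + (expRem (t * g ω ^ 2) + expRem (t * h ω ^ 2)) / 2 := by
    intro ω
    have := exp_mul_le t (g ω) (h ω)
    rwa [abs_of_nonneg ht] at this
  have ie : Integrable (fun ω => Real.exp (t * (g ω * h ω))) P :=
    ib.mono' (by fun_prop) (.of_forall fun ω => by
      rw [Real.norm_eq_abs, abs_of_pos (Real.exp_pos _)]; exact hle ω)
  have hsplit : ∀ ω, Real.exp (t * (g ω * h ω - e))
      = Real.exp (-(t * e)) * Real.exp (t * (g ω * h ω)) := by
    intro ω; rw [← Real.exp_add]; congr 1; ring
  refine ⟨by simp only [hsplit]; exact ie.const_mul _, ?_⟩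
  have hint : ∫ ω, Real.exp (t * (g ω * h ω)) ∂P ≤ 1 + t * e + 2 * (sqExpConst L * t) ^ 2 := by
    refine (integral_mono ie ib hle).trans ?_
    have i1 : ∫ ω, (1 + t * (g ω * h ω)
        + (expRem (t * g ω ^ 2) + expRem (t * h ω ^ 2)) / 2) ∂P
        = 1 + t * e + (∫ ω, expRem (t * g ω ^ 2) ∂P + ∫ ω, expRem (t * h ω ^ 2) ∂P) / 2 := by
      have j1 : Integrable (fun ω => 1 + t * (g ω * h ω)) P :=
        (integrable_const _).add (igh.const_mul t)
      have j2 : Integrable (fun ω => (expRem (t * g ω ^ 2) + expRem (t * h ω ^ 2)) / 2) P :=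
        (ig.add ih).div_const 2
      rw [integral_add j1 j2, integral_add (integrable_const _) (igh.const_mul t),
        integral_const_mul, integral_div, integral_add ig ih]
      simp [he]
    rw [i1]
    linarith
  simp only [mgf, hsplit]
  rw [integral_const_mul]
  calc Real.exp (-(t * e)) * ∫ ω, Real.exp (t * (g ω * h ω)) ∂P
      ≤ Real.exp (-(t * e)) * Real.exp (t * e + 2 * (sqExpConst L * t) ^ 2) := by
        refine mul_le_mul_of_nonneg_left (hint.trans ?_) (Real.exp_pos _).le
        have := Real.add_one_le_exp (t * e + 2 * (sqExpConst L * t) ^ 2)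
        linarith
    _ = _ := by rw [← Real.exp_add]; congr 1; ring

end ExponentialMoments

section Bernstein

variable {Ω Z : Type*} [MeasurableSpace Ω] [MeasurableSpace Z] {pr : Measure Ω}
  [IsProbabilityMeasure pr] {P : Measure Z} [IsProbabilityMeasure P] {n : ℕ} {D : Fin n → Ω → Z}

theorem measure_sum_mul_sub_ge_le (hD : ∀ i, Measurable (D i)) (hind : iIndepFun D pr)
    (hlaw : ∀ i, pr.map (D i) = P) {g h : Z → ℝ} (hg : Measurable g) (hh : Measurable h) {L : ℝ}
    (hL : 0 ≤ L) (hgL : SubGaussianNormLE g L P) (hhL : SubGaussianNormLE h L P) {t : ℝ}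
    (ht : 0 ≤ t) (htL : sqExpConst L * t ≤ 1 / 2) (δ : ℝ) :
    pr {ω | n * δ ≤ ∑ i, (g (D i ω) * h (D i ω) - ∫ z, g z * h z ∂P)}
      ≤ ENNReal.ofReal (Real.exp (-(n * (t * δ - 2 * (sqExpConst L * t) ^ 2)))) := by
  set Q : Z → ℝ := fun z => g z * h z - ∫ z, g z * h z ∂P with hQ
  have hQm : Measurable Q := by fun_prop
  obtain ⟨hi, hm⟩ := integrable_exp_mul_and_mgf_le hg hh hL hgL hhL ht htL
  have hind' : iIndepFun (fun i => Q ∘ D i) pr := hind.comp (fun _ => Q) fun _ => hQm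
  have hQD : ∀ i, Measurable (Q ∘ D i) := fun i => hQm.comp (hD i)
  have hint : ∀ i, Integrable (fun ω => Real.exp (t * (Q ∘ D i) ω)) pr := by
    intro i
    have : Integrable (fun z => Real.exp (t * Q z)) (pr.map (D i)) := by rw [hlaw i]; exact hi
    exact this.comp_measurable (hD i)
  have hmgf : ∀ i, mgf (Q ∘ D i) pr t ≤ Real.exp (2 * (sqExpConst L * t) ^ 2) := by
    intro i
    have : mgf (Q ∘ D i) pr t = mgf Q P t := by
      rw [mgf, mgf, ← hlaw i, integral_map (hD i).aemeasurable (by fun_prop)]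
      rfl
    rw [this]; exact hm
  have hsum : mgf (∑ i, Q ∘ D i) pr t ≤ Real.exp (n * (2 * (sqExpConst L * t) ^ 2)) := by
    rw [hind'.mgf_sum hQD]
    calc ∏ i : Fin n, mgf (Q ∘ D i) pr t
        ≤ ∏ i : Fin n, Real.exp (2 * (sqExpConst L * t) ^ 2) :=
          Finset.prod_le_prod (fun i _ => mgf_nonneg) fun i _ => hmgf i
      _ = _ := by rw [Finset.prod_const, ← Real.exp_nat_mul]; simp
  have hi' : Integrable (fun ω => Real.exp (t * (∑ i, Q ∘ D i) ω)) pr :=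
    hind'.integrable_exp_mul_sum hQD fun i _ => hint i
  have hfin := measure_ge_le_exp_mul_mgf (n * δ) ht hi'
  have hset : {ω | n * δ ≤ ∑ i, (g (D i ω) * h (D i ω) - ∫ z, g z * h z ∂P)}
      = {ω | n * δ ≤ (∑ i, Q ∘ D i) ω} := by
    ext ω; simp [hQ]
  rw [hset, ← ofReal_measureReal]
  refine ENNReal.ofReal_le_ofReal (hfin.trans ?_)
  calc Real.exp (-t * (n * δ)) * mgf (∑ i, Q ∘ D i) pr t
      ≤ Real.exp (-t * (n * δ)) * Real.exp (n * (2 * (sqExpConst L * t) ^ 2)) := by gcongr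
    _ = _ := by rw [← Real.exp_add]; congr 1; ring

/-- A Bernstein inequality for the sample averages of a product of sub-Gaussian variables. -/
theorem measure_abs_sum_mul_sub_ge_le (hD : ∀ i, Measurable (D i)) (hind : iIndepFun D pr)
    (hlaw : ∀ i, pr.map (D i) = P) {g h : Z → ℝ} (hg : Measurable g) (hh : Measurable h) {L : ℝ}
    (hL : 0 ≤ L) (hgL : SubGaussianNormLE g L P) (hhL : SubGaussianNormLE h L P) {t : ℝ}
    (ht : 0 ≤ t) (htL : sqExpConst L * t ≤ 1 / 2) (δ : ℝ) :
    pr {ω | n * δ ≤ |∑ i, (g (D i ω) * h (D i ω) - ∫ z, g z * h z ∂P)|}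
      ≤ ENNReal.ofReal (2 * Real.exp (-(n * (t * δ - 2 * (sqExpConst L * t) ^ 2)))) := by
  have h1 := measure_sum_mul_sub_ge_le hD hind hlaw hg hh hL hgL hhL ht htL δ
  have h2 := measure_sum_mul_sub_ge_le hD hind hlaw hg.neg hh hL hgL.neg hhL ht htL δ
  have hsub : {ω | n * δ ≤ |∑ i, (g (D i ω) * h (D i ω) - ∫ z, g z * h z ∂P)|}
      ⊆ {ω | n * δ ≤ ∑ i, (g (D i ω) * h (D i ω) - ∫ z, g z * h z ∂P)}
        ∪ {ω | n * δ ≤ ∑ i, ((-g) (D i ω) * h (D i ω) - ∫ z, (-g) z * h z ∂P)} := by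
    intro ω hω
    rcases le_abs.1 (show n * δ ≤ |∑ i, (g (D i ω) * h (D i ω) - ∫ z, g z * h z ∂P)| from hω)
      with h | h
    · exact Or.inl h
    · refine Or.inr (h.trans (le_of_eq ?_))
      rw [← Finset.sum_neg_distrib]
      refine Finset.sum_congr rfl fun i _ => ?_
      simp only [Pi.neg_apply, neg_mul, integral_neg]
      ring
  refine (measure_mono hsub).trans ((measure_union_le _ _).trans ((add_le_add h1 h2).trans ?_))
  rw [← ENNReal.ofReal_add (by positivity) (by positivity)]
  exact ENNReal.ofReal_le_ofReal (by linarith)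

end Bernstein

end SparseSIR

namespace SparseSIR

/-! ### Products of neighbouring residuals after sorting by the response -/

section Pairs

open scoped ENNReal

variable {I : Type*} [MeasurableSpace I] {ν : Measure I} [IsProbabilityMeasure ν]

theorem lintegral_exp_mul_pair_le {a b : I → ℝ} (ha : Measurable a) (hb : Measurable b)
    (hai : Integrable a ν) (ha0 : ∫ u, a u ∂ν = 0) {t : ℝ} (ht : 0 ≤ t) :
    ∫⁻ v, ∫⁻ u, ENNReal.ofReal (Real.exp (t * (a u * b v))) ∂ν ∂ν
      ≤ (1 + ∫⁻ u, ENNReal.ofReal (expRem (t * a u ^ 2)) ∂ν)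
        * (1 + ∫⁻ v, ENNReal.ofReal (expRem (t * b v ^ 2)) ∂ν) := by
  set A := ∫⁻ u, ENNReal.ofReal (expRem (t * a u ^ 2)) ∂ν with hA
  set B := ∫⁻ v, ENNReal.ofReal (expRem (t * b v ^ 2)) ∂ν with hB
  rcases eq_or_ne A ∞ with hAtop | hAtop
  · rw [hAtop, add_top, ENNReal.top_mul (by simp)]
    exact le_top
  have hwa : Measurable fun u => expRem (t * a u ^ 2) := measurable_expRem.comp (by fun_prop)
  have hwb : Measurable fun v => expRem (t * b v ^ 2) := measurable_expRem.comp (by fun_prop)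
  have hwi : Integrable (fun u => expRem (t * a u ^ 2)) ν := by
    refine ⟨hwa.aestronglyMeasurable, ?_⟩
    rw [hasFiniteIntegral_iff_ofReal (.of_forall fun ω => expRem_nonneg _)]
    exact hAtop.lt_top
  have hAr : A = ENNReal.ofReal (∫ u, expRem (t * a u ^ 2) ∂ν) :=
    (ofReal_integral_eq_lintegral_ofReal hwi (.of_forall fun ω => expRem_nonneg _)).symm
  have hinner : ∀ v, ∫⁻ u, ENNReal.ofReal (Real.exp (t * (a u * b v))) ∂ν
      ≤ 1 + A + ENNReal.ofReal (expRem (t * b v ^ 2)) := by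
    intro v
    have hle : ∀ u, Real.exp (t * (a u * b v)) ≤ 1 + (t * b v) * a u
        + (expRem (t * a u ^ 2) + expRem (t * b v ^ 2)) / 2 := by
      intro u
      have := exp_mul_le t (a u) (b v)
      rw [abs_of_nonneg ht] at this
      linarith
    have j1 : Integrable (fun u => 1 + (t * b v) * a u) ν :=
      (integrable_const _).add (hai.const_mul _)
    have j2 : Integrable (fun u => (expRem (t * a u ^ 2) + expRem (t * b v ^ 2)) / 2) ν :=
      (hwi.add (integrable_const _)).div_const 2
    calc ∫⁻ u, ENNReal.ofReal (Real.exp (t * (a u * b v))) ∂ν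
        ≤ ∫⁻ u, ENNReal.ofReal (1 + (t * b v) * a u
          + (expRem (t * a u ^ 2) + expRem (t * b v ^ 2)) / 2) ∂ν :=
          lintegral_mono fun u => ENNReal.ofReal_le_ofReal (hle u)
      _ = ENNReal.ofReal (∫ u, (1 + (t * b v) * a u
          + (expRem (t * a u ^ 2) + expRem (t * b v ^ 2)) / 2) ∂ν) :=
          (ofReal_integral_eq_lintegral_ofReal (j1.add j2)
            (.of_forall fun u => (Real.exp_pos _).le.trans (hle u))).symm
      _ ≤ ENNReal.ofReal (1 + ∫ u, expRem (t * a u ^ 2) ∂ν + expRem (t * b v ^ 2)) := by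
          refine ENNReal.ofReal_le_ofReal ?_
          rw [integral_add j1 j2, integral_add (integrable_const _) (hai.const_mul _),
            integral_const_mul, ha0, integral_div, integral_add hwi (integrable_const _)]
          have h1 : 0 ≤ ∫ u, expRem (t * a u ^ 2) ∂ν := integral_nonneg fun u => expRem_nonneg _
          have h2 := expRem_nonneg (t * b v ^ 2)
          simp only [integral_const, probReal_univ, smul_eq_mul, one_mul, mul_zero, add_zero]
          linarith
      _ = _ := by
          have h1 : 0 ≤ ∫ u, expRem (t * a u ^ 2) ∂ν := integral_nonneg fun u => expRem_nonneg _
          rw [ENNReal.ofReal_add (by positivity) (expRem_nonneg _),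
            ENNReal.ofReal_add zero_le_one h1, ENNReal.ofReal_one, hAr]
  refine (lintegral_mono hinner).trans ?_
  rw [lintegral_add_right _ hwb.ennreal_ofReal, lintegral_const, measure_univ, mul_one, ← hB]
  calc 1 + A + B ≤ 1 + A + B + A * B := le_self_add
    _ = (1 + A) * (1 + B) := by ring

theorem lintegral_prod_pi {m : ℕ} {f : Fin m → I → ℝ≥0∞} (hf : ∀ i, Measurable (f i)) :
    ∫⁻ u : Fin m → I, ∏ i, f i (u i) ∂(Measure.pi fun _ => ν) = ∏ i, ∫⁻ u, f i u ∂ν := by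
  have hind : iIndepFun (fun (i : Fin m) (u : Fin m → I) => f i (u i))
      (Measure.pi fun _ : Fin m => ν) := iIndepFun_pi fun i => (hf i).aemeasurable
  rw [lintegral_prod_eq_prod_lintegral_of_indepFun Finset.univ _ hind
    fun i => (hf i).comp (measurable_pi_apply i)]
  refine Finset.prod_congr rfl fun i _ => ?_
  exact (measurePreserving_eval (fun _ : Fin m => ν) i).lintegral_comp (hf i)

/-- Factors that depend on disjoint pairs of coordinates can be integrated separately. -/
theorem lintegral_prod_pairs {n m : ℕ} {e : Fin m ⊕ Fin m → Fin n} (he : Function.Injective e)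
    {φ : Fin m → I × I → ℝ≥0∞} (hφ : ∀ i, Measurable (φ i)) :
    ∫⁻ u : Fin n → I, ∏ i, φ i (u (e (Sum.inl i)), u (e (Sum.inr i))) ∂(Measure.pi fun _ => ν)
      = ∏ i, ∫⁻ v, ∫⁻ u, φ i (u, v) ∂ν ∂ν := by
  have hid : iIndepFun (fun (i : Fin n) (u : Fin n → I) => u i) (Measure.pi fun _ : Fin n => ν) :=
    iIndepFun_pi (X := fun _ => id) fun i => aemeasurable_id
  have hmap := (iIndepFun_iff_map_fun_eq_pi_map
    (fun k => (measurable_pi_apply (e k)).aemeasurable)).1 (hid.precomp he)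
  have heval : ∀ k, (Measure.pi fun _ : Fin n => ν).map (fun u : Fin n → I => u (e k)) = ν :=
    fun k => (measurePreserving_eval (fun _ : Fin n => ν) (e k)).map_eq
  simp only [heval] at hmap
  have hmeas : Measurable fun w : Fin m ⊕ Fin m → I =>
      ∏ i, φ i (w (Sum.inl i), w (Sum.inr i)) :=
    Finset.measurable_prod _ fun i _ => (hφ i).comp (by fun_prop)
  have hmp := measurePreserving_sumPiEquivProdPi (X := fun _ : Fin m ⊕ Fin m => I)
    (fun _ => ν)
  have hmeas2 : Measurable fun p : (Fin m → I) × (Fin m → I) => ∏ i, φ i (p.1 i, p.2 i) :=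
    Finset.measurable_prod _ fun i _ => (hφ i).comp (by fun_prop)
  calc ∫⁻ u : Fin n → I, ∏ i, φ i (u (e (Sum.inl i)), u (e (Sum.inr i))) ∂(Measure.pi fun _ => ν)
      = ∫⁻ w : Fin m ⊕ Fin m → I, ∏ i, φ i (w (Sum.inl i), w (Sum.inr i))
          ∂(Measure.pi fun _ => ν) := by
        rw [← hmap, lintegral_map hmeas (by fun_prop)]
    _ = ∫⁻ p : (Fin m → I) × (Fin m → I), ∏ i, φ i (p.1 i, p.2 i)
          ∂((Measure.pi fun _ => ν).prod (Measure.pi fun _ => ν)) := by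
        rw [← hmp.lintegral_comp hmeas2]
        rfl
    _ = ∫⁻ v : Fin m → I, ∫⁻ u : Fin m → I, ∏ i, φ i (u i, v i)
          ∂(Measure.pi fun _ => ν) ∂(Measure.pi fun _ => ν) :=
        lintegral_prod_symm _ hmeas2.aemeasurable
    _ = ∫⁻ v : Fin m → I, ∏ i, (∫⁻ u, φ i (u, v i) ∂ν) ∂(Measure.pi fun _ => ν) := by
        refine lintegral_congr fun v => ?_
        exact lintegral_prod_pi (f := fun i u => φ i (u, v i)) fun i => (hφ i).comp (by fun_prop)
    _ = _ := lintegral_prod_pi (f := fun i v => ∫⁻ u, φ i (u, v) ∂ν)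
        fun i => (hφ i).lintegral_prod_left'

end Pairs

section Sorting

open scoped ENNReal

/-- The position `2 i` in `{0, …, n - 1}`. -/
def evenPos {n : ℕ} (i : Fin (n / 2)) : Fin n := ⟨2 * i, by have := i.isLt; omega⟩

/-- The position `2 i + 1` in `{0, …, n - 1}`. -/
def oddPos {n : ℕ} (i : Fin (n / 2)) : Fin n := ⟨2 * i + 1, by have := i.isLt; omega⟩

theorem injective_sumElim_pos {n : ℕ} :
    Function.Injective (Sum.elim (oddPos (n := n)) (evenPos (n := n))) := by
  rintro (i | i) (j | j) h <;> simp only [Sum.elim_inl, Sum.elim_inr, oddPos, evenPos,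
    Fin.mk.injEq] at h
  · congr 1; ext; omega
  · omega
  · omega
  · congr 1; ext; omega

theorem measurableSet_sort_eq {n : ℕ} (σ : Equiv.Perm (Fin n)) :
    MeasurableSet {y : Fin n → ℝ | Tuple.sort y = σ} := by
  have : {y : Fin n → ℝ | Tuple.sort y = σ}
      = {y | (∀ i j, i ≤ j → y (σ i) ≤ y (σ j)) ∧
        ∀ i j, i < j → y (σ i) = y (σ j) → σ i < σ j} := by
    ext y
    rw [Set.mem_ofPred_eq, eq_comm, Tuple.eq_sort_iff]
    rfl
  rw [this]
  refine Measurable.setOf (Measurable.and ?_ ?_)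
  · refine Measurable.forall fun i => Measurable.forall fun j => Measurable.imp measurable_const ?_
    exact measurableSet_setOfPred.1
      (measurableSet_le (measurable_pi_apply (σ i)) (measurable_pi_apply (σ j)))
  · refine Measurable.forall fun i => Measurable.forall fun j => Measurable.imp measurable_const ?_
    refine Measurable.imp ?_ measurable_const
    exact measurableSet_setOfPred.1
      (measurableSet_eq_fun (measurable_pi_apply (σ i)) (measurable_pi_apply (σ j)))

/-- Every law on `X × ℝ` is the law of `(f(y, u), y)` with `u` uniform and independent of `y`. -/
theorem exists_eq_map_prod {X : Type*} [MeasurableSpace X] [StandardBorelSpace X] [Nonempty X]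
    (P : Measure (X × ℝ)) [IsProbabilityMeasure P] :
    ∃ f : ℝ → unitInterval → X, Measurable (Function.uncurry f) ∧
      ((P.map Prod.snd).prod volume).map (fun p => (f p.1 p.2, p.1)) = P := by
  obtain ⟨f, hf, hfκ⟩ := Kernel.exists_measurable_map_eq_unitInterval
    (condDistrib (Prod.fst : X × ℝ → X) Prod.snd P)
  refine ⟨f, hf, ?_⟩
  have hg : Measurable fun p : ℝ × unitInterval => (p.1, f p.1 p.2) := measurable_fst.prodMk hf
  have : IsProbabilityMeasure (P.map Prod.snd) :=
    Measure.isProbabilityMeasure_map measurable_snd.aemeasurable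
  have h1 : ((P.map Prod.snd).prod volume).map (fun p => (p.1, f p.1 p.2))
      = P.map fun z => (z.2, z.1) := by
    rw [← compProd_map_condDistrib (X := (Prod.snd : X × ℝ → ℝ)) measurable_fst.aemeasurable]
    ext s hs
    rw [Measure.map_apply hg hs, Measure.prod_apply (hg hs), Measure.compProd_apply hs]
    refine lintegral_congr fun y => ?_
    rw [← hfκ y, Measure.map_apply (hf.of_uncurry_left) (measurable_prodMk_left hs)]
    rfl
  have h2 : (((P.map Prod.snd).prod volume).map (fun p => (p.1, f p.1 p.2))).map Prod.swap
      = (P.map fun z => (z.2, z.1)).map Prod.swap := by rw [h1]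
  rw [Measure.map_map measurable_swap hg, Measure.map_map measurable_swap (by fun_prop)] at h2
  have h3 : (Prod.swap ∘ fun z : X × ℝ => (z.2, z.1)) = id := rfl
  rw [h3, Measure.map_id] at h2
  exact h2

/-- The exponential moment of a sum of products of neighbouring residuals, neighbours with respect
to the order of the responses. Given the responses the observations are independent and the
residuals are centered, so that the first order terms vanish; the remainders are bounded by a
product over the observations, which does not depend on the order. -/
theorem lintegral_exp_sum_neighbours_le {X Ω : Type*} [MeasurableSpace X] [StandardBorelSpace X]
    [Nonempty X] [MeasurableSpace Ω] {pr : Measure Ω} [IsProbabilityMeasure pr]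
    {P : Measure (X × ℝ)} [IsProbabilityMeasure P] {n : ℕ} {D : Fin n → Ω → X × ℝ}
    (hD : ∀ i, Measurable (D i)) (hind : iIndepFun D pr) (hlaw : ∀ i, pr.map (D i) = P)
    {a b : X × ℝ → ℝ} (ha : Measurable a) (hb : Measurable b) (hai : Integrable a P)
    (ha0 : ∀ C : Set ℝ, MeasurableSet C → ∫ z in Prod.snd ⁻¹' C, a z ∂P = 0)
    {t : ℝ} (ht : 0 ≤ t) :
    ∫⁻ ω, ENNReal.ofReal (Real.exp (t * ∑ i : Fin (n / 2),
        a (D (Tuple.sort (fun l => (D l ω).2) (oddPos i)) ω)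
          * b (D (Tuple.sort (fun l => (D l ω).2) (evenPos i)) ω))) ∂pr
      ≤ (1 + (∫⁻ z, ENNReal.ofReal (expRem (t * a z ^ 2)) ∂P
          + ∫⁻ z, ENNReal.ofReal (expRem (t * b z ^ 2)) ∂P)) ^ n := by
  obtain ⟨f, hf, hfP⟩ := exists_eq_map_prod P
  set μ := P.map Prod.snd with hμ
  have : IsProbabilityMeasure μ := Measure.isProbabilityMeasure_map measurable_snd.aemeasurable
  set G : ℝ × unitInterval → X × ℝ := fun p => (f p.1 p.2, p.1) with hG
  have hGm : Measurable G := hf.prodMk measurable_fst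
  -- the terms for a fixed order of the observations
  set F : Equiv.Perm (Fin n) → (Fin n → X × ℝ) → ℝ≥0∞ := fun σ x =>
    ∏ i : Fin (n / 2),
      ENNReal.ofReal (Real.exp (t * (a (x (σ (oddPos i))) * b (x (σ (evenPos i))))))
    with hF
  have hFm : ∀ σ, Measurable (F σ) := fun σ => by
    refine Finset.measurable_prod _ fun i _ => ?_
    exact (Real.measurable_exp.comp (((ha.comp (measurable_pi_apply _)).mul
      (hb.comp (measurable_pi_apply _))).const_mul t)).ennreal_ofReal
  set S : Equiv.Perm (Fin n) → Set (Fin n → ℝ) := fun σ => {y | Tuple.sort y = σ} with hS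
  have hSm : ∀ σ, MeasurableSet (S σ) := measurableSet_sort_eq
  have hpart : ∀ (g : Equiv.Perm (Fin n) → ℝ≥0∞) (y : Fin n → ℝ),
      ∑ σ, (S σ).indicator (fun _ => g σ) y = g (Tuple.sort y) := by
    intro g y
    rw [Finset.sum_eq_single (Tuple.sort y)]
    · simp [hS]
    · intro σ _ hσ
      exact Set.indicator_of_notMem (fun h => hσ h.symm) _
    · simp
  set wa : X × ℝ → ℝ≥0∞ := fun z => ENNReal.ofReal (expRem (t * a z ^ 2)) with hwa
  set wb : X × ℝ → ℝ≥0∞ := fun z => ENNReal.ofReal (expRem (t * b z ^ 2)) with hwb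
  have hwam : Measurable wa := (measurable_expRem.comp (by fun_prop)).ennreal_ofReal
  have hwbm : Measurable wb := (measurable_expRem.comp (by fun_prop)).ennreal_ofReal
  set A : ℝ → ℝ≥0∞ := fun y => ∫⁻ u, wa (G (y, u)) with hA
  set B : ℝ → ℝ≥0∞ := fun y => ∫⁻ u, wb (G (y, u)) with hB
  have hAm : Measurable A := (hwam.comp hGm).lintegral_prod_right'
  have hBm : Measurable B := (hwbm.comp hGm).lintegral_prod_right'
  have hAint : ∫⁻ y, A y ∂μ = ∫⁻ z, wa z ∂P := by
    conv_rhs => rw [← hfP]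
    rw [lintegral_map hwam hGm, lintegral_prod (fun p => wa (G p)) (hwam.comp hGm).aemeasurable]
  have hBint : ∫⁻ y, B y ∂μ = ∫⁻ z, wb z ∂P := by
    conv_rhs => rw [← hfP]
    rw [lintegral_map hwbm hGm, lintegral_prod (fun p => wb (G p)) (hwbm.comp hGm).aemeasurable]
  -- for almost every response, the residual is integrable and centered
  have haG : Integrable (fun p => a (G p)) (μ.prod volume) := by
    have h0 : Integrable a ((μ.prod volume).map G) := by rw [hfP]; exact hai
    exact h0.comp_measurable hGm
  have hae : ∀ᵐ y ∂μ, Integrable (fun u => a (G (y, u))) volume ∧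
      ∫ u, a (G (y, u)) = 0 := by
    have h1 := haG.prod_right_ae
    have h2 : (fun y => ∫ u, a (G (y, u))) =ᵐ[μ] 0 := by
      refine haG.integral_prod_left.ae_eq_zero_of_forall_setIntegral_eq_zero fun C hC _ => ?_
      have h3 := ha0 C hC
      rw [← hfP, setIntegral_map (measurable_snd hC) ha.aestronglyMeasurable hGm.aemeasurable] at h3
      have h4 : G ⁻¹' (Prod.snd ⁻¹' C) = C ×ˢ Set.univ := by ext p; simp [hG]
      rw [h4, setIntegral_prod _ haG.integrableOn] at h3
      simpa using h3
    filter_upwards [h1, h2] with y g1 g2 using ⟨g1, g2⟩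
  have hae' : ∀ᵐ y ∂(Measure.pi fun _ : Fin n => μ), ∀ l,
      Integrable (fun u => a (G (y l, u))) volume ∧ ∫ u, a (G (y l, u)) = 0 :=
    ae_all_iff.2 fun l =>
      (measurePreserving_eval (fun _ : Fin n => μ) l).quasiMeasurePreserving.ae hae
  -- the conditional bound, given the responses
  have hcond : ∀ σ : Equiv.Perm (Fin n), ∀ y : Fin n → ℝ,
      (∀ l, Integrable (fun u => a (G (y l, u))) volume ∧ ∫ u, a (G (y l, u)) = 0) →
      ∫⁻ u : Fin n → unitInterval, F σ (fun l => G (y l, u l)) ∂(Measure.pi fun _ => volume)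
        ≤ ∏ l, (1 + (A (y l) + B (y l))) := by
    intro σ y hy
    set e : Fin (n / 2) ⊕ Fin (n / 2) → Fin n := σ ∘ Sum.elim oddPos evenPos with he
    have hinj : Function.Injective e := σ.injective.comp injective_sumElim_pos
    have h1 := lintegral_prod_pairs (ν := (volume : Measure unitInterval)) hinj
      (φ := fun i p => ENNReal.ofReal (Real.exp (t * (a (G (y (σ (oddPos i)), p.1))
        * b (G (y (σ (evenPos i)), p.2))))))
      (fun i => (Real.measurable_exp.comp (((ha.comp (hGm.comp (by fun_prop))).mul
        (hb.comp (hGm.comp (by fun_prop)))).const_mul t)).ennreal_ofReal)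
    refine (le_of_eq h1).trans ?_
    have h2 : ∀ i : Fin (n / 2),
        ∫⁻ v : unitInterval, ∫⁻ u : unitInterval, ENNReal.ofReal
          (Real.exp (t * (a (G (y (σ (oddPos i)), u)) * b (G (y (σ (evenPos i)), v)))))
        ≤ (1 + (A (y (e (Sum.inl i))) + B (y (e (Sum.inl i)))))
          * (1 + (A (y (e (Sum.inr i))) + B (y (e (Sum.inr i))))) := by
      intro i
      refine (lintegral_exp_mul_pair_le (ha.comp (hGm.comp measurable_prodMk_left))
        (hb.comp (hGm.comp measurable_prodMk_left)) (hy _).1 (hy _).2 ht).trans ?_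
      refine mul_le_mul' (add_le_add_right ?_ _) (add_le_add_right ?_ _)
      · exact le_self_add
      · exact le_add_self
    refine (Finset.prod_le_prod' fun i _ => h2 i).trans ?_
    rw [Finset.prod_mul_distrib]
    have h3 : (∏ i, (1 + (A (y (e (Sum.inl i))) + B (y (e (Sum.inl i))))))
        * ∏ i, (1 + (A (y (e (Sum.inr i))) + B (y (e (Sum.inr i)))))
        = ∏ k, (1 + (A (y (e k)) + B (y (e k)))) := by
      rw [Fintype.prod_sum_type]
    rw [h3, ← Finset.prod_image (s := Finset.univ) (g := e)
      (f := fun l => 1 + (A (y l) + B (y l))) (fun _ _ _ _ h => hinj h)]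
    exact Finset.prod_le_prod_of_subset_of_one_le' (Finset.subset_univ _)
      fun l _ _ => le_self_add
  -- the joint law of the sample
  have hjoint : pr.map (fun ω i => D i ω) = Measure.pi fun _ : Fin n => P := by
    rw [(iIndepFun_iff_map_fun_eq_pi_map fun i => (hD i).aemeasurable).1 hind]
    simp only [hlaw]
  have hpi : (Measure.pi fun _ : Fin n => μ.prod (volume : Measure unitInterval)).map
      (fun p i => G (p i)) = Measure.pi fun _ : Fin n => P := by
    rw [Measure.pi_map_pi fun _ => hGm.aemeasurable]
    change (Measure.pi fun _ : Fin n => (μ.prod volume).map G) = _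
    rw [hfP]
  have hterm : ∀ σ : Equiv.Perm (Fin n),
      ∫⁻ ω, (S σ).indicator (fun _ => F σ fun i => D i ω) (fun l => (D l ω).2) ∂pr
        ≤ ∫⁻ y, (S σ).indicator (fun y => ∏ l, (1 + (A (y l) + B (y l)))) y
          ∂(Measure.pi fun _ : Fin n => μ) := by
    intro σ
    set H : (Fin n → X × ℝ) → ℝ≥0∞ := fun x =>
      (S σ).indicator (fun _ => F σ x) (fun l => (x l).2) with hH
    have hHm : Measurable H := by
      have : H = ((fun (x : Fin n → X × ℝ) l => (x l).2) ⁻¹' S σ).indicator (F σ) := by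
        ext x; simp [hH, Set.indicator]
      rw [this]
      exact (hFm σ).indicator ((by fun_prop : Measurable fun (x : Fin n → X × ℝ) l => (x l).2)
        (hSm σ))
    have hGn : Measurable fun (p : Fin n → ℝ × unitInterval) i => G (p i) :=
      measurable_pi_lambda _ fun i => hGm.comp (measurable_pi_apply i)
    have hmp := measurePreserving_arrowProdEquivProdArrow ℝ unitInterval (Fin n)
      (fun _ => μ) (fun _ => volume)
    set H' : (Fin n → ℝ) × (Fin n → unitInterval) → ℝ≥0∞ := fun q =>
      H fun l => G (q.1 l, q.2 l) with hH'
    have hH'm : Measurable H' := hHm.comp (measurable_pi_lambda _ fun l => hGm.comp (by fun_prop))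
    calc ∫⁻ ω, (S σ).indicator (fun _ => F σ fun i => D i ω) (fun l => (D l ω).2) ∂pr
        = ∫⁻ x, H x ∂(Measure.pi fun _ : Fin n => P) := by
          rw [← hjoint, lintegral_map hHm (measurable_pi_lambda _ hD)]
      _ = ∫⁻ p, H (fun i => G (p i))
            ∂(Measure.pi fun _ : Fin n => μ.prod (volume : Measure unitInterval)) := by
          rw [← hpi, lintegral_map hHm hGn]
      _ = ∫⁻ q, H' q ∂((Measure.pi fun _ : Fin n => μ).prod (Measure.pi fun _ => volume)) := by
          rw [← hmp.lintegral_comp hH'm]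
          rfl
      _ = ∫⁻ y, ∫⁻ u, H' (y, u) ∂(Measure.pi fun _ => volume)
            ∂(Measure.pi fun _ : Fin n => μ) := lintegral_prod _ hH'm.aemeasurable
      _ ≤ _ := by
          refine lintegral_mono_ae ?_
          filter_upwards [hae'] with y hy
          by_cases hyS : y ∈ S σ
          · have e1 : ∀ u, H' (y, u) = F σ fun l => G (y l, u l) := by
              intro u
              simp only [hH', hH]
              exact Set.indicator_of_mem hyS _
            simp only [e1, Set.indicator_of_mem hyS]
            exact hcond σ y hy
          · have e1 : ∀ u, H' (y, u) = 0 := by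
              intro u
              simp only [hH', hH]
              exact Set.indicator_of_notMem hyS _
            simp [e1]
  calc ∫⁻ ω, ENNReal.ofReal (Real.exp (t * ∑ i : Fin (n / 2),
        a (D (Tuple.sort (fun l => (D l ω).2) (oddPos i)) ω)
          * b (D (Tuple.sort (fun l => (D l ω).2) (evenPos i)) ω))) ∂pr
      = ∫⁻ ω, ∑ σ, (S σ).indicator (fun _ => F σ fun i => D i ω) (fun l => (D l ω).2) ∂pr := by
        refine lintegral_congr fun ω => ?_
        rw [hpart (fun σ => F σ fun i => D i ω)]
        simp only [hF]
        rw [← ENNReal.ofReal_prod_of_nonneg fun i _ => (Real.exp_pos _).le, ← Real.exp_sum,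
          Finset.mul_sum]
    _ = ∑ σ, ∫⁻ ω, (S σ).indicator (fun _ => F σ fun i => D i ω) (fun l => (D l ω).2) ∂pr := by
        refine lintegral_finsetSum _ fun σ _ => ?_
        have : (fun ω => (S σ).indicator (fun _ => F σ fun i => D i ω) fun l => (D l ω).2)
            = ((fun ω l => (D l ω).2) ⁻¹' S σ).indicator fun ω => F σ fun i => D i ω := by
          ext ω; simp [Set.indicator]
        rw [this]
        exact ((hFm σ).comp (measurable_pi_lambda _ hD)).indicator
          ((measurable_pi_lambda _ fun l => (hD l).snd) (hSm σ))
    _ ≤ ∑ σ, ∫⁻ y, (S σ).indicator (fun y => ∏ l, (1 + (A (y l) + B (y l)))) y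
          ∂(Measure.pi fun _ : Fin n => μ) := Finset.sum_le_sum fun σ _ => hterm σ
    _ = ∫⁻ y, ∏ l, (1 + (A (y l) + B (y l))) ∂(Measure.pi fun _ : Fin n => μ) := by
        have hpm : Measurable fun y : Fin n → ℝ => ∏ l, (1 + (A (y l) + B (y l))) :=
          Finset.measurable_prod _ fun l _ => measurable_const.add
            ((hAm.comp (measurable_pi_apply l)).add (hBm.comp (measurable_pi_apply l)))
        rw [← lintegral_finsetSum _ fun σ _ => hpm.indicator (hSm σ)]
        refine lintegral_congr fun y => ?_
        exact hpart (fun _ => ∏ l, (1 + (A (y l) + B (y l)))) y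
    _ = (1 + (∫⁻ z, wa z ∂P + ∫⁻ z, wb z ∂P)) ^ n := by
        rw [lintegral_prod_pi (f := fun _ y => 1 + (A y + B y))
          fun _ => measurable_const.add (hAm.add hBm)]
        rw [Finset.prod_const, Finset.card_univ, Fintype.card_fin,
          lintegral_add_left measurable_const, lintegral_const, measure_univ, one_mul,
          lintegral_add_left hAm, hAint, hBint]

end Sorting

end SparseSIR

namespace SparseSIR

/-! ### Uniform tail bounds for finite families -/

section Tails

open scoped ENNReal

theorem measure_not_forall_le {Ω ι : Type*} [MeasurableSpace Ω] {pr : Measure Ω} [Fintype ι]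
    {p : ι → Ω → Prop} {x : ℝ} (h : ∀ a, pr {ω | ¬ p a ω} ≤ ENNReal.ofReal x) :
    pr {ω | ¬ ∀ a, p a ω} ≤ ENNReal.ofReal (Fintype.card ι * x) := by
  have e : {ω | ¬ ∀ a, p a ω} = ⋃ a, {ω | ¬ p a ω} := by
    ext ω; simp
  rw [e]
  refine (measure_iUnion_fintype_le pr _).trans ((Finset.sum_le_sum fun a _ => h a).trans ?_)
  rw [Finset.sum_const, Finset.card_univ, nsmul_eq_mul, ENNReal.ofReal_mul (by positivity),
    ENNReal.ofReal_natCast]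

/-- The maximum of a finite sub-Gaussian family over the sample grows like `√u`, up to an event whose
probability is at most `2 exp (-u)` times the number of variables. No independence is needed. -/
theorem measure_not_forall_sq_le {Ω Z ι : Type*} [MeasurableSpace Ω] [MeasurableSpace Z]
    [Fintype ι] {pr : Measure Ω} {P : Measure Z} [IsProbabilityMeasure P] {n : ℕ}
    {D : Fin n → Ω → Z} (hD : ∀ i, Measurable (D i))
    (hlaw : ∀ i, pr.map (D i) = P) {F : ι → Z → ℝ}
    (hF : ∀ a, Measurable (F a)) {L : ℝ} (hL : 0 < L) (hFL : ∀ a, SubGaussianNormLE (F a) L P)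
    (u : ℝ) :
    pr {ω | ¬ ∀ p : Fin n × ι, F p.2 (D p.1 ω) ^ 2 ≤ 2 * sqExpConst L * u}
      ≤ ENNReal.ofReal (Fintype.card (Fin n × ι) * (2 * Real.exp (-u))) := by
  refine measure_not_forall_le fun p => ?_
  have hκ := sqExpConst_pos hL
  set t := 1 / (2 * sqExpConst L) with ht
  have h := (hFL p.2).lintegral_exp_le (hF p.2) hL.le (t := t) (by positivity)
    (le_of_eq (by rw [ht]; field_simp))
  have h2 : ∫⁻ ω, ENNReal.ofReal (Real.exp (t * F p.2 (D p.1 ω) ^ 2)) ∂pr ≤ 2 := by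
    rw [← hlaw p.1, lintegral_map (by have := hF p.2; fun_prop) (hD p.1)] at h
    exact h
  refine (measure_mono (t := {ω | ENNReal.ofReal (Real.exp u)
    ≤ ENNReal.ofReal (Real.exp (t * F p.2 (D p.1 ω) ^ 2))}) ?_).trans ?_
  · intro ω hω
    have := not_le.1 hω
    refine ENNReal.ofReal_le_ofReal (Real.exp_le_exp.2 ?_)
    rw [ht, one_div_mul_eq_div, le_div_iff₀ (by positivity)]
    linarith
  · refine (ENNReal.le_div_iff_mul_le (Or.inl (by simp [Real.exp_pos])) (Or.inl (by simp))).2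
      ((mul_comm _ _).trans_le ((mul_meas_ge_le_lintegral₀ ?_ _).trans h2)) |>.trans ?_
    · have := (hF p.2).comp (hD p.1)
      exact (Measurable.aemeasurable (by fun_prop))
    · rw [show (2 : ℝ≥0∞) = ENNReal.ofReal 2 by simp, ← ENNReal.ofReal_div_of_pos (Real.exp_pos _),
        Real.exp_neg, div_eq_mul_inv]

variable {Ω : Type*} [MeasurableSpace Ω] {pr : Measure Ω} [IsProbabilityMeasure pr] {n : ℕ}

theorem measurable_sort_apply {Y : Type*} [MeasurableSpace Y] {y : Fin n → Ω → ℝ}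
    (hy : ∀ i, Measurable (y i)) {f : Equiv.Perm (Fin n) → Ω → Y} (hf : ∀ σ, Measurable (f σ)) :
    Measurable fun ω => f (Tuple.sort fun l => y l ω) ω := by
  intro s hs
  have e : (fun ω => f (Tuple.sort fun l => y l ω) ω) ⁻¹' s
      = ⋃ σ, (fun ω l => y l ω) ⁻¹' {y | Tuple.sort y = σ} ∩ f σ ⁻¹' s := by
    ext ω; simp
  rw [e]
  exact MeasurableSet.iUnion fun σ =>
    (measurable_pi_lambda _ hy (measurableSet_sort_eq σ)).inter (hf σ hs)

/-- A Bernstein inequality for the sums of products over neighbouring observations, when the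
observations are sorted by the response. -/
theorem measure_abs_sum_neighbours_ge_le {X : Type*} [MeasurableSpace X] [StandardBorelSpace X]
    [Nonempty X] {P : Measure (X × ℝ)} [IsProbabilityMeasure P] {D : Fin n → Ω → X × ℝ}
    (hD : ∀ i, Measurable (D i)) (hind : iIndepFun D pr) (hlaw : ∀ i, pr.map (D i) = P)
    {a b : X × ℝ → ℝ} (ha : Measurable a) (hb : Measurable b) {L : ℝ} (hL : 0 ≤ L)
    (haL : SubGaussianNormLE a L P) (hbL : SubGaussianNormLE b L P)
    (ha0 : ∀ C, MeasurableSet C → ∫ z in Prod.snd ⁻¹' C, a z ∂P = 0) {t : ℝ} (ht : 0 ≤ t)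
    (htL : sqExpConst L * t ≤ 1 / 2) (δ : ℝ) :
    pr {ω | n * δ ≤ |∑ i : Fin (n / 2), a (D (Tuple.sort (fun l => (D l ω).2) (oddPos i)) ω)
        * b (D (Tuple.sort (fun l => (D l ω).2) (evenPos i)) ω)|}
      ≤ ENNReal.ofReal (2 * Real.exp (-(n * (t * δ - 4 * (sqExpConst L * t) ^ 2)))) := by
  have one_sided : ∀ a' : X × ℝ → ℝ, Measurable a' → SubGaussianNormLE a' L P →
      (∀ C, MeasurableSet C → ∫ z in Prod.snd ⁻¹' C, a' z ∂P = 0) →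
      pr {ω | n * δ ≤ ∑ i : Fin (n / 2), a' (D (Tuple.sort (fun l => (D l ω).2) (oddPos i)) ω)
        * b (D (Tuple.sort (fun l => (D l ω).2) (evenPos i)) ω)}
      ≤ ENNReal.ofReal (Real.exp (-(n * (t * δ - 4 * (sqExpConst L * t) ^ 2)))) := by
    intro a' ha' haL' ha0'
    have h := lintegral_exp_sum_neighbours_le hD hind hlaw ha' hb
      ((haL'.memLp ha').integrable one_le_two) ha0' ht
    have h1 := haL'.lintegral_expRem_le ha' hL ht htL
    have h2 := hbL.lintegral_expRem_le hb hL ht htL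
    set r := sqExpConst L * t
    have h3 : (1 + (∫⁻ z, ENNReal.ofReal (expRem (t * a' z ^ 2)) ∂P
        + ∫⁻ z, ENNReal.ofReal (expRem (t * b z ^ 2)) ∂P)) ^ n
        ≤ ENNReal.ofReal (Real.exp (n * (4 * r ^ 2))) := by
      rw [Real.exp_nat_mul, ENNReal.ofReal_pow (Real.exp_pos _).le]
      refine pow_le_pow_left' ((add_le_add_right (add_le_add h1 h2) _).trans ?_) n
      rw [← ENNReal.ofReal_add (by positivity) (by positivity), ← ENNReal.ofReal_one,
        ← ENNReal.ofReal_add (by positivity) (by positivity)]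
      refine ENNReal.ofReal_le_ofReal ?_
      have := Real.add_one_le_exp (4 * r ^ 2)
      linarith
    have key := h.trans h3
    have hmeas : Measurable fun ω => ENNReal.ofReal (Real.exp (t * ∑ i : Fin (n / 2),
        a' (D (Tuple.sort (fun l => (D l ω).2) (oddPos i)) ω)
          * b (D (Tuple.sort (fun l => (D l ω).2) (evenPos i)) ω))) :=
      measurable_sort_apply (fun i => (hD i).snd)
        (f := fun σ ω => ENNReal.ofReal (Real.exp (t * ∑ i : Fin (n / 2),
          a' (D (σ (oddPos i)) ω) * b (D (σ (evenPos i)) ω)))) fun σ => by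
          have h1 := fun i => ha'.comp (hD i)
          have h2 := fun i => hb.comp (hD i)
          simp only [Function.comp_def] at h1 h2
          fun_prop
    refine (measure_mono (t := {ω | ENNReal.ofReal (Real.exp (t * (n * δ))) ≤
      ENNReal.ofReal (Real.exp (t * ∑ i : Fin (n / 2),
        a' (D (Tuple.sort (fun l => (D l ω).2) (oddPos i)) ω)
          * b (D (Tuple.sort (fun l => (D l ω).2) (evenPos i)) ω)))}) ?_).trans ?_
    · intro ω hω
      refine ENNReal.ofReal_le_ofReal (Real.exp_le_exp.2 ?_)
      exact mul_le_mul_of_nonneg_left hω ht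
    · refine (ENNReal.le_div_iff_mul_le (Or.inl (by simp [Real.exp_pos])) (Or.inl (by simp))).2
        ((mul_comm _ _).trans_le ((mul_meas_ge_le_lintegral hmeas _).trans key)) |>.trans ?_
      rw [← ENNReal.ofReal_div_of_pos (Real.exp_pos _), ← Real.exp_sub]
      refine ENNReal.ofReal_le_ofReal (Real.exp_le_exp.2 ?_)
      linarith
  have h1 := one_sided a ha haL ha0
  have h2 := one_sided (fun z => -a z) ha.neg haL.neg fun C hC => by
    rw [integral_neg, ha0 C hC, neg_zero]
  refine (measure_mono (t := _ ∪ _) ?_).trans ((measure_union_le _ _).trans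
    ((add_le_add h1 h2).trans ?_))
  · intro ω hω
    rcases le_abs.1 (Set.mem_ofPred_eq ▸ hω : _ ≤ |_|) with h | h
    · exact Or.inl h
    · refine Or.inr (h.trans (le_of_eq ?_))
      rw [← Finset.sum_neg_distrib]
      exact Finset.sum_congr rfl fun i _ => (neg_mul _ _).symm
  · rw [← ENNReal.ofReal_add (by positivity) (by positivity)]
    exact ENNReal.ofReal_le_ofReal (by linarith)

variable {Z : Type*} [MeasurableSpace Z] {P : Measure Z} [IsProbabilityMeasure P]
  {D : Fin n → Ω → Z}

/-- The factor of the deviation `r` in the tail bounds with probability `exp (- q n r²)`. -/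
noncomputable def deviationConst (L q : ℝ) : ℝ := 2 * sqExpConst L * (q + 1)

theorem deviationConst_pos {L q : ℝ} (hL : 0 < L) (hq : 0 ≤ q) : 0 < deviationConst L q := by
  have := sqExpConst_pos hL
  unfold deviationConst; positivity

/-- All the averages of the products of two functions of a finite sub-Gaussian family are
uniformly close to their expectations. -/
theorem measure_not_forall_average_le {ι : Type*} [Fintype ι] (hD : ∀ i, Measurable (D i))
    (hind : iIndepFun D pr) (hlaw : ∀ i, pr.map (D i) = P) {F : ι → Z → ℝ}
    (hF : ∀ a, Measurable (F a)) {L : ℝ} (hL : 0 < L) (hFL : ∀ a, SubGaussianNormLE (F a) L P)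
    {q r : ℝ} (hr : 0 ≤ r) (hr1 : r ≤ 1) (hn : 0 < n) :
    pr {ω | ¬ ∀ p : ι × ι, |(n : ℝ)⁻¹ * ∑ i, F p.1 (D i ω) * F p.2 (D i ω)
        - ∫ z, F p.1 z * F p.2 z ∂P| ≤ deviationConst L q * r}
      ≤ ENNReal.ofReal (Fintype.card (ι × ι) * (2 * Real.exp (-(q * (n * r ^ 2))))) := by
  refine measure_not_forall_le fun p => ?_
  have hκ := sqExpConst_pos hL
  have hk : sqExpConst L * (r / (2 * sqExpConst L)) = r / 2 := by field_simp
  have h := measure_abs_sum_mul_sub_ge_le hD hind hlaw (hF p.1) (hF p.2) hL.le (hFL p.1) (hFL p.2)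
    (t := r / (2 * sqExpConst L)) (by positivity) (by rw [hk]; linarith) (deviationConst L q * r)
  refine (measure_mono fun ω hω => ?_).trans (h.trans (ENNReal.ofReal_le_ofReal ?_))
  · have h1 := (not_le.1 hω).le
    have e : (n : ℝ)⁻¹ * ∑ i, F p.1 (D i ω) * F p.2 (D i ω) - ∫ z, F p.1 z * F p.2 z ∂P
        = (n : ℝ)⁻¹ * ∑ i, (F p.1 (D i ω) * F p.2 (D i ω) - ∫ z, F p.1 z * F p.2 z ∂P) := by
      rw [Finset.sum_sub_distrib, Finset.sum_const, Finset.card_univ, Fintype.card_fin,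
        nsmul_eq_mul]
      field_simp
    rw [e, abs_mul, abs_of_pos (by positivity), ← div_eq_inv_mul, le_div_iff₀ (by positivity)] at h1
    change n * (deviationConst L q * r) ≤ _
    linarith
  · have e : r / (2 * sqExpConst L) * (deviationConst L q * r) = (q + 1) * r ^ 2 := by
      rw [deviationConst]; field_simp
    rw [hk, e]
    have : 0 ≤ (n : ℝ) * r ^ 2 := by positivity
    refine mul_le_mul_of_nonneg_left (Real.exp_le_exp.2 ?_) zero_le_two
    nlinarith

/-- The products over neighbouring observations are uniformly small for all pairs of functions of a
finite sub-Gaussian family whose conditional means given the response vanish. -/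
theorem measure_not_forall_neighbours_le {X ι : Type*} [MeasurableSpace X]
    [StandardBorelSpace X] [Nonempty X] [Fintype ι] {P : Measure (X × ℝ)} [IsProbabilityMeasure P]
    {D : Fin n → Ω → X × ℝ} (hD : ∀ i, Measurable (D i)) (hind : iIndepFun D pr)
    (hlaw : ∀ i, pr.map (D i) = P) {F : ι → X × ℝ → ℝ} (hF : ∀ a, Measurable (F a)) {L : ℝ}
    (hL : 0 < L) (hFL : ∀ a, SubGaussianNormLE (F a) L P)
    (hF0 : ∀ a C, MeasurableSet C → ∫ z in Prod.snd ⁻¹' C, F a z ∂P = 0)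
    {q r : ℝ} (hr : 0 ≤ r) (hr1 : r ≤ 1) :
    pr {ω | ¬ ∀ p : ι × ι,
        |∑ i : Fin (n / 2), F p.1 (D (Tuple.sort (fun l => (D l ω).2) (oddPos i)) ω)
          * F p.2 (D (Tuple.sort (fun l => (D l ω).2) (evenPos i)) ω)|
        ≤ n * (deviationConst L q * r)}
      ≤ ENNReal.ofReal (Fintype.card (ι × ι) * (2 * Real.exp (-(q * (n * r ^ 2))))) := by
  refine measure_not_forall_le fun p => ?_
  have hκ := sqExpConst_pos hL
  have hk : sqExpConst L * (r / (2 * sqExpConst L)) = r / 2 := by field_simp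
  have h := measure_abs_sum_neighbours_ge_le hD hind hlaw (hF p.1) (hF p.2) hL.le (hFL p.1)
    (hFL p.2) (hF0 p.1) (t := r / (2 * sqExpConst L)) (by positivity) (by rw [hk]; linarith)
    (deviationConst L q * r)
  refine (measure_mono fun ω hω => (not_le.1 hω).le).trans
    (h.trans (ENNReal.ofReal_le_ofReal ?_))
  have e : r / (2 * sqExpConst L) * (deviationConst L q * r) = (q + 1) * r ^ 2 := by
    rw [deviationConst]; field_simp
  rw [hk, e]
  refine mul_le_mul_of_nonneg_left (Real.exp_le_exp.2 ?_) zero_le_two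
  linarith

end Tails

end SparseSIR

namespace SparseSIR

/-! ### A net of sparse vectors -/

section Net

variable {d : ℕ}

/-- A finite net in the set of the `k`-sparse vectors of norm at most one: its points are the
vectors `v` whose nonzero entries are among `v (J 1), …, v (J k)` and are of the form `a / N` with
integers `|a| ≤ N`. -/
noncomputable def sparseNet (d k N : ℕ) : Finset (Fin d → ℝ) :=
  (Finset.univ.image fun p : (Fin k → Fin d) × (Fin k → Fin (2 * N + 1)) =>
    Function.extend p.1 (fun l => ((p.2 l : ℝ) - N) / N) 0).filter fun v => v ⬝ᵥ v ≤ 1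

theorem card_sparseNet_le (d k N : ℕ) : (sparseNet d k N).card ≤ (d * (2 * N + 1)) ^ k := by
  refine (Finset.card_filter_le _ _).trans (Finset.card_image_le.trans (le_of_eq ?_))
  simp [mul_pow]

theorem exists_support_of_mem_sparseNet {k N : ℕ} {v : Fin d → ℝ} (hv : v ∈ sparseNet d k N) :
    v ⬝ᵥ v ≤ 1 ∧ ∃ I : Finset (Fin d), I.card ≤ k ∧ ∀ i ∉ I, v i = 0 := by
  obtain ⟨h1, h2⟩ := Finset.mem_filter.1 hv
  obtain ⟨p, -, rfl⟩ := Finset.mem_image.1 h1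
  refine ⟨h2, Finset.univ.image p.1, Finset.card_image_le.trans (by simp), fun i hi => ?_⟩
  exact Function.extend_apply' _ _ _ fun ⟨l, hl⟩ => hi (Finset.mem_image.2 ⟨l, by simp, hl⟩)

/-- Rounding the entries of a sparse vector towards zero gives a point of the net. -/
theorem exists_mem_sparseNet {k N : ℕ} (hN : 0 < N) {I : Finset (Fin d)} (hI : I.card ≤ k)
    (hI0 : I.Nonempty) {v : Fin d → ℝ} (hv : ∀ i ∉ I, v i = 0) (hv1 : v ⬝ᵥ v ≤ 1) :
    ∃ w ∈ sparseNet d k N, (∀ i ∉ I, w i = 0) ∧ ∀ i, |v i - w i| ≤ 1 / N := by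
  have hNr : (0 : ℝ) < N := by exact_mod_cast hN
  have hround : ∀ x : ℝ, |x| ≤ 1 → ∃ a : Fin (2 * N + 1),
      |x - ((a : ℝ) - N) / N| ≤ 1 / N ∧ |((a : ℝ) - N) / N| ≤ |x| := by
    intro x hx
    have hm0 : ⌊|x| * N⌋₊ ≤ N := by
      have : (⌊|x| * N⌋₊ : ℝ) ≤ |x| * N := Nat.floor_le (by positivity)
      have : (⌊|x| * N⌋₊ : ℝ) ≤ N := by nlinarith
      exact_mod_cast this
    have hm1 : (⌊|x| * N⌋₊ : ℝ) ≤ |x| * N := Nat.floor_le (by positivity)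
    have hm2 : |x| * N < ⌊|x| * N⌋₊ + 1 := Nat.lt_floor_add_one _
    obtain ⟨m, hm⟩ : ∃ m, m = ⌊|x| * N⌋₊ := ⟨_, rfl⟩
    rw [← hm] at hm0 hm1 hm2
    have b1 : (m : ℝ) / N ≤ |x| := by rw [div_le_iff₀ hNr]; exact hm1
    have b2 : |x| ≤ m / N + 1 / N := by
      rw [← add_div, le_div_iff₀ hNr]; exact hm2.le
    have b0 : (0 : ℝ) ≤ m / N := by positivity
    rcases le_total 0 x with h | h
    · refine ⟨⟨N + m, by omega⟩, ?_⟩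
      have e : (((N + m : ℕ) : ℝ) - N) / N = m / N := by push_cast; ring
      simp only [e]
      rw [abs_of_nonneg h] at b1 b2 ⊢
      rw [abs_of_nonneg b0, abs_of_nonneg (by linarith)]
      constructor <;> linarith
    · refine ⟨⟨N - m, by omega⟩, ?_⟩
      have e : (((N - m : ℕ) : ℝ) - N) / N = -(m / N) := by
        rw [Nat.cast_sub hm0]; ring
      simp only [e]
      rw [abs_of_nonpos h] at b1 b2 ⊢
      rw [abs_neg, abs_of_nonneg b0, abs_of_nonpos (by linarith)]
      constructor <;> linarith
  have hvi : ∀ i, |v i| ≤ 1 := by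
    intro i
    rw [← sq_le_one_iff_abs_le_one, sq]
    exact (Finset.single_le_sum (f := fun i => v i * v i) (fun j _ => mul_self_nonneg _)
      (Finset.mem_univ i)).trans hv1
  choose a ha1 ha2 using fun i => hround (v i) (hvi i)
  obtain ⟨f⟩ : Nonempty (I ↪ Fin k) := by
    rw [Function.Embedding.nonempty_iff_card_le]; simpa using hI
  have : Nonempty I := hI0.to_subtype
  obtain ⟨J, hJ⟩ : ∃ J : Fin k → Fin d, J = fun l => (Function.invFun f l).1 := ⟨_, rfl⟩
  have hJI : ∀ l, J l ∈ I := fun l => by rw [hJ]; exact (Function.invFun f l).2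
  have hJs : ∀ i ∈ I, ∃ l, J l = i := fun i hi => ⟨f ⟨i, hi⟩, by
    rw [hJ]; simp [Function.leftInverse_invFun f.injective _]⟩
  obtain ⟨w, hw⟩ : ∃ w : Fin d → ℝ, w = Function.extend J (fun l => ((a (J l) : ℝ) - N) / N) 0 :=
    ⟨_, rfl⟩
  have hwI : ∀ i ∈ I, w i = ((a i : ℝ) - N) / N := by
    intro i hi
    rw [hw, Function.extend_def, dif_pos (hJs i hi), (hJs i hi).choose_spec]
  have hw0 : ∀ i ∉ I, w i = 0 := by
    intro i hi
    rw [hw]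
    exact Function.extend_apply' _ _ _ fun ⟨l, hl⟩ => hi (hl ▸ hJI l)
  have hle : ∀ i, |w i| ≤ |v i| := by
    intro i
    by_cases hi : i ∈ I
    · rw [hwI i hi]; exact ha2 i
    · rw [hw0 i hi, abs_zero]; positivity
  refine ⟨w, Finset.mem_filter.2 ⟨Finset.mem_image.2 ⟨(J, fun l => a (J l)), by simp, hw.symm⟩, ?_⟩,
    hw0, fun i => ?_⟩
  · refine le_trans (Finset.sum_le_sum fun i _ => ?_) hv1
    rw [← sq, ← sq]
    exact sq_le_sq.2 (hle i)
  · by_cases hi : i ∈ I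
    · rw [hwI i hi]; exact ha1 i
    · rw [hw0 i hi, hv i hi]; simp

/-- A quadratic form that is at most `δ` on the net is at most `2 δ ‖v‖²` at all sparse `v`. By
polarization, replacing `v` by the nearest point of the net changes the form by at most half of its
supremum. -/
theorem abs_form_le_of_sparseNet {E : Matrix (Fin d) (Fin d) ℝ} (hE : Eᵀ = E) {k : ℕ} {δ : ℝ}
    (hnet : ∀ v ∈ sparseNet d k (4 * k), |v ⬝ᵥ (E *ᵥ v)| ≤ δ) {I : Finset (Fin d)}
    (hI : I.card ≤ k) {v : Fin d → ℝ} (hv : ∀ i ∉ I, v i = 0) :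
    |v ⬝ᵥ (E *ᵥ v)| ≤ 2 * δ * (v ⬝ᵥ v) := by
  rcases I.eq_empty_or_nonempty with rfl | hI0
  · have : v = 0 := by ext i; exact hv i (by simp)
    simp [this]
  have hk : 0 < k := lt_of_lt_of_le hI0.card_pos hI
  set T : Set ℝ := {x | ∃ v : Fin d → ℝ, (∀ i ∉ I, v i = 0) ∧ v ⬝ᵥ v ≤ 1 ∧ x = |v ⬝ᵥ (E *ᵥ v)|}
    with hT
  have hentry : ∀ v : Fin d → ℝ, v ⬝ᵥ v ≤ 1 → ∀ i, |v i| ≤ 1 := by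
    intro v hv1 i
    rw [← sq_le_one_iff_abs_le_one, sq]
    exact (Finset.single_le_sum (f := fun i => v i * v i) (fun j _ => mul_self_nonneg _)
      (Finset.mem_univ i)).trans hv1
  have hbdd : BddAbove T := by
    refine ⟨∑ i, ∑ j, |E i j|, ?_⟩
    rintro x ⟨v, -, hv1, rfl⟩
    have hb := hentry v hv1
    rw [dotProduct]
    refine (Finset.abs_sum_le_sum_abs _ _).trans (Finset.sum_le_sum fun i _ => ?_)
    rw [abs_mul, Matrix.mulVec, dotProduct]
    calc |v i| * |∑ j, E i j * v j| ≤ 1 * ∑ j, |E i j * v j| := by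
          gcongr
          · exact hb i
          · exact Finset.abs_sum_le_sum_abs _ _
      _ ≤ ∑ j, |E i j| := by
          rw [one_mul]
          refine Finset.sum_le_sum fun j _ => ?_
          rw [abs_mul]
          exact mul_le_of_le_one_right (abs_nonneg _) (hb j)
  set M := sSup T with hM
  have hMle : ∀ v : Fin d → ℝ, (∀ i ∉ I, v i = 0) → v ⬝ᵥ v ≤ 1 → |v ⬝ᵥ (E *ᵥ v)| ≤ M :=
    fun v h1 h2 => le_csSup hbdd ⟨v, h1, h2, rfl⟩
  have hM0 : 0 ≤ M := (abs_nonneg _).trans (hMle 0 (by simp) (by simp))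
  have hself : ∀ v : Fin d → ℝ, 0 ≤ v ⬝ᵥ v := fun v =>
    Finset.sum_nonneg fun i _ => mul_self_nonneg _
  have hscale : ∀ (v : Fin d → ℝ) (B : ℝ), (∀ u : Fin d → ℝ, (∀ i ∉ I, u i = 0) → u ⬝ᵥ u ≤ 1 →
      |u ⬝ᵥ (E *ᵥ u)| ≤ B) → (∀ i ∉ I, v i = 0) → |v ⬝ᵥ (E *ᵥ v)| ≤ B * (v ⬝ᵥ v) := by
    intro v B hB hvI
    rcases eq_or_lt_of_le (hself v) with h0 | hpos
    · have : v = 0 := dotProduct_self_eq_zero.1 h0.symm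
      simp [this]
    · have h := hB ((√(v ⬝ᵥ v))⁻¹ • v) (fun i hi => by simp [hvI i hi]) (by
        rw [smul_dotProduct, dotProduct_smul, smul_smul, ← mul_inv, Real.mul_self_sqrt hpos.le,
          smul_eq_mul, inv_mul_cancel₀ hpos.ne'])
      rw [Matrix.mulVec_smul, smul_dotProduct, dotProduct_smul, smul_smul, ← mul_inv,
        Real.mul_self_sqrt hpos.le, smul_eq_mul, abs_mul, abs_of_pos (inv_pos.2 hpos),
        ← div_eq_inv_mul, div_le_iff₀ hpos] at h
      exact h
  have hsymm : ∀ x y : Fin d → ℝ, x ⬝ᵥ (E *ᵥ y) = y ⬝ᵥ (E *ᵥ x) := by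
    intro x y
    rw [Matrix.dotProduct_mulVec, ← Matrix.mulVec_transpose, hE, dotProduct_comm]
  -- the bilinear form at vectors of norms at most `1/4` and `2`
  have hbil : ∀ x y : Fin d → ℝ, (∀ i ∉ I, x i = 0) → (∀ i ∉ I, y i = 0) →
      |x ⬝ᵥ (E *ᵥ y)| ≤ M * (4 * (x ⬝ᵥ x) + (y ⬝ᵥ y) / 16) := by
    intro x y hx hy
    have h1 := hscale ((2 : ℝ) • x + (1 / 4 : ℝ) • y) M hMle fun i hi => by simp [hx i hi, hy i hi]
    have h2 := hscale ((2 : ℝ) • x - (1 / 4 : ℝ) • y) M hMle fun i hi => by simp [hx i hi, hy i hi]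
    have e1 := hsymm x y
    have e2 := dotProduct_comm x y
    simp only [Matrix.mulVec_add, Matrix.mulVec_sub, Matrix.mulVec_smul, add_dotProduct,
      sub_dotProduct, dotProduct_add, dotProduct_sub, smul_dotProduct, dotProduct_smul,
      smul_eq_mul] at h1 h2
    rw [← e1, ← e2] at h1 h2
    rw [abs_le] at h1 h2 ⊢
    constructor <;> linarith [h1.1, h1.2, h2.1, h2.2]
  have hstep : ∀ u : Fin d → ℝ, (∀ i ∉ I, u i = 0) → u ⬝ᵥ u ≤ 1 →
      |u ⬝ᵥ (E *ᵥ u)| ≤ δ + M / 2 := by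
    intro u hu hu1
    obtain ⟨w, hw, hwI, hclose⟩ := exists_mem_sparseNet (N := 4 * k) (by omega) hI hI0 hu hu1
    have hw1 := (exists_support_of_mem_sparseNet hw).1
    have hkr : (1 : ℝ) ≤ k := by exact_mod_cast hk
    have hdiff : (u - w) ⬝ᵥ (u - w) ≤ 1 / 16 := by
      have : (u - w) ⬝ᵥ (u - w) ≤ ∑ i ∈ I, (1 / ((4 * k : ℕ) : ℝ)) ^ 2 := by
        rw [dotProduct, ← Finset.sum_subset (Finset.subset_univ I)
          fun i _ hi => by simp [hu i hi, hwI i hi]]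
        refine Finset.sum_le_sum fun i _ => ?_
        rw [← sq]
        exact sq_le_sq' (by have := (abs_le.1 (hclose i)).1; simpa using this)
          (abs_le.1 (hclose i)).2
      refine this.trans ?_
      rw [Finset.sum_const, nsmul_eq_mul]
      push_cast
      have hIr : (I.card : ℝ) ≤ k := by exact_mod_cast hI
      calc (I.card : ℝ) * (1 / (4 * (k : ℝ))) ^ 2 ≤ k * (1 / (4 * (k : ℝ))) ^ 2 := by gcongr
        _ = 1 / (16 * (k : ℝ)) := by field_simp; norm_num
        _ ≤ 1 / 16 := by
          apply one_div_le_one_div_of_le (by norm_num); linarith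
    have hsum : (u + w) ⬝ᵥ (u + w) ≤ 4 := by
      have h0 := hself (u - w)
      simp only [sub_dotProduct, dotProduct_sub, add_dotProduct, dotProduct_add] at h0 ⊢
      linarith
    have hb := hbil (u - w) (u + w) (fun i hi => by simp [hu i hi, hwI i hi])
      fun i hi => by simp [hu i hi, hwI i hi]
    have hb' : |(u - w) ⬝ᵥ (E *ᵥ (u + w))| ≤ M / 2 := by
      refine hb.trans ?_
      have : 4 * ((u - w) ⬝ᵥ (u - w)) + ((u + w) ⬝ᵥ (u + w)) / 16 ≤ 1 / 2 := by linarith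
      nlinarith
    have e : u ⬝ᵥ (E *ᵥ u) = w ⬝ᵥ (E *ᵥ w) + (u - w) ⬝ᵥ (E *ᵥ (u + w)) := by
      simp only [Matrix.mulVec_add, sub_dotProduct, dotProduct_add]
      rw [hsymm w u]; ring
    rw [e]
    exact (abs_add_le _ _).trans (add_le_add (hnet w hw) hb')
  have hMfin : M ≤ δ + M / 2 := by
    refine csSup_le ⟨_, 0, by simp, by simp, rfl⟩ ?_
    rintro x ⟨u, h1, h2, rfl⟩
    exact hstep u h1 h2
  refine hscale v _ (fun u h1 h2 => (hMle u h1 h2).trans ?_) hv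
  linarith

end Net

end SparseSIR

namespace SparseSIR

/-! ### Deviation of the sample covariance matrix -/

section SampleCovariance

variable {n d : ℕ}

/-- The centred linear function `vᵀ(x - E x)` of the covariates. -/
noncomputable def centredForm (P : Measure ((Fin d → ℝ) × ℝ)) (v : Fin d → ℝ)
    (z : (Fin d → ℝ) × ℝ) : ℝ := v ⬝ᵥ (z.1 - meanVec P)

theorem measurable_centredForm (P : Measure ((Fin d → ℝ) × ℝ)) (v : Fin d → ℝ) :
    Measurable (centredForm P v) := by
  unfold centredForm
  simp only [dotProduct, Pi.sub_apply]
  fun_prop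

theorem centredForm_eq (P : Measure ((Fin d → ℝ) × ℝ)) (v : Fin d → ℝ) (z : (Fin d → ℝ) × ℝ) :
    centredForm P v z = ∑ j, v j * z.1 j - ∑ j, v j * meanVec P j := by
  simp [centredForm, dotProduct, mul_sub, Finset.sum_sub_distrib]

theorem integral_sum_mul {P : Measure ((Fin d → ℝ) × ℝ)} [IsProbabilityMeasure P]
    (h : ∀ j : Fin d, MemLp (fun z : (Fin d → ℝ) × ℝ => z.1 j) 2 P) (v : Fin d → ℝ) :
    ∫ z, ∑ j, v j * z.1 j ∂P = ∑ j, v j * meanVec P j := by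
  rw [integral_finsetSum _ fun j _ => ((h j).integrable one_le_two).const_mul _]
  exact Finset.sum_congr rfl fun j _ => integral_const_mul _ _

theorem integral_centredForm {P : Measure ((Fin d → ℝ) × ℝ)} [IsProbabilityMeasure P]
    (h : ∀ j : Fin d, MemLp (fun z : (Fin d → ℝ) × ℝ => z.1 j) 2 P) (v : Fin d → ℝ) :
    ∫ z, centredForm P v z ∂P = 0 := by
  simp only [centredForm_eq]
  have hi : Integrable (fun z : (Fin d → ℝ) × ℝ => ∑ j, v j * z.1 j) P :=
    integrable_finsetSum _ fun j _ => ((h j).integrable one_le_two).const_mul _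
  rw [integral_sub hi (integrable_const _), integral_sum_mul h]
  simp

theorem integral_centredForm_mul {P : Measure ((Fin d → ℝ) × ℝ)} [IsProbabilityMeasure P]
    (h : ∀ j : Fin d, MemLp (fun z : (Fin d → ℝ) × ℝ => z.1 j) 2 P) (v w : Fin d → ℝ) :
    ∫ z, centredForm P v z * centredForm P w z ∂P = v ⬝ᵥ (covX P *ᵥ w) := by
  rw [covX, dotProduct_covariance_mulVec h, covariance, integral_sum_mul h, integral_sum_mul h]
  simp only [centredForm_eq]

theorem sampleCov_transpose (D : Fin n → (Fin d → ℝ) × ℝ) : (sampleCov D)ᵀ = sampleCov D := by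
  simp only [sampleCov, Matrix.transpose_smul, Matrix.transpose_sum, Matrix.transpose_vecMulVec]

/-- The quadratic form of the sample covariance matrix, with an arbitrary centring `m`. -/
theorem dotProduct_sampleCov_mulVec (hn : 0 < n) (D : Fin n → (Fin d → ℝ) × ℝ) (m v w : Fin d → ℝ) :
    v ⬝ᵥ (sampleCov D *ᵥ w)
      = (n : ℝ)⁻¹ * ∑ i, (v ⬝ᵥ ((D i).1 - m)) * (w ⬝ᵥ ((D i).1 - m))
        - ((n : ℝ)⁻¹ * ∑ i, v ⬝ᵥ ((D i).1 - m)) * ((n : ℝ)⁻¹ * ∑ i, w ⬝ᵥ ((D i).1 - m)) := by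
  have hn' : (n : ℝ) ≠ 0 := by positivity
  have hmean : ∀ u : Fin d → ℝ, (n : ℝ)⁻¹ * ∑ i, u ⬝ᵥ ((D i).1 - m) = u ⬝ᵥ (sampleMean D - m) := by
    intro u
    simp only [dotProduct_sub, Finset.sum_sub_distrib, sampleMean, dotProduct_smul,
      dotProduct_sum, smul_eq_mul]
    simp
    field_simp
  have hform : v ⬝ᵥ (sampleCov D *ᵥ w)
      = (n : ℝ)⁻¹ * ∑ i, (v ⬝ᵥ ((D i).1 - sampleMean D)) * (w ⬝ᵥ ((D i).1 - sampleMean D)) := by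
    simp only [sampleCov, Matrix.smul_mulVec, Matrix.sum_mulVec, Matrix.vecMulVec_mulVec,
      dotProduct_smul, dotProduct_sum, smul_eq_mul]
    congr 1
    refine Finset.sum_congr rfl fun i _ => ?_
    simp [dotProduct_comm w]
  have hs : ∀ u : Fin d → ℝ, ∑ i, u ⬝ᵥ ((D i).1 - m) = n * (u ⬝ᵥ (sampleMean D - m)) := by
    intro u; rw [← hmean]; field_simp
  have e : ∀ (u : Fin d → ℝ) i, u ⬝ᵥ ((D i).1 - sampleMean D)
      = u ⬝ᵥ ((D i).1 - m) - u ⬝ᵥ (sampleMean D - m) := by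
    intro u i; simp only [dotProduct_sub]; ring
  rw [hmean, hmean, hform]
  simp only [e]
  obtain ⟨p, hp⟩ : ∃ p, p = v ⬝ᵥ (sampleMean D - m) := ⟨_, rfl⟩
  obtain ⟨q, hq⟩ : ∃ q, q = w ⬝ᵥ (sampleMean D - m) := ⟨_, rfl⟩
  have hv := hs v
  have hw := hs w
  rw [← hp] at hv
  rw [← hq] at hw
  rw [← hp, ← hq]
  simp only [sub_mul, mul_sub, Finset.sum_sub_distrib, ← Finset.sum_mul, ← Finset.mul_sum]
  rw [hv, hw]
  simp
  field_simp

theorem sampleCov_posSemidef (D : Fin n → (Fin d → ℝ) × ℝ) : (sampleCov D).PosSemidef := by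
  refine posSemidef_of_transpose_eq (sampleCov_transpose D) fun v => ?_
  simp only [sampleCov, Matrix.smul_mulVec, Matrix.sum_mulVec, Matrix.vecMulVec_mulVec,
    dotProduct_smul, dotProduct_sum, smul_eq_mul]
  refine mul_nonneg (by positivity) (Finset.sum_nonneg fun i _ => ?_)
  simp [dotProduct_comm v, mul_self_nonneg]

variable {Ω : Type*} [MeasurableSpace Ω] {pr : Measure Ω} [IsProbabilityMeasure pr]
  {P : Measure ((Fin d → ℝ) × ℝ)} [IsProbabilityMeasure P] {D : Fin n → Ω → (Fin d → ℝ) × ℝ}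

/-- The bound on the deviation of the sample covariance matrix, per unit of `r`: its first term
comes from the second moments, and the square from the sample mean. -/
noncomputable def covDeviationConst (L q : ℝ) : ℝ :=
  deviationConst L q + deviationConst L q ^ 2

theorem covDeviationConst_pos {L q : ℝ} (hL : 0 < L) (hq : 0 ≤ q) : 0 < covDeviationConst L q := by
  have := deviationConst_pos hL hq
  unfold covDeviationConst; positivity

/-- The bilinear form of the sample covariance matrix is close to that of `Σ_x` at all pairs of
vectors of a finite family. -/
theorem measure_not_forall_sampleCov_le {ι : Type*} [Fintype ι] (hn : 0 < n)
    (hD : ∀ i, Measurable (D i)) (hind : iIndepFun D pr) (hlaw : ∀ i, pr.map (D i) = P)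
    (h : ∀ j : Fin d, MemLp (fun z : (Fin d → ℝ) × ℝ => z.1 j) 2 P) {v : ι → Fin d → ℝ} {L : ℝ}
    (hL : 1 ≤ L) (hv : ∀ a, SubGaussianNormLE (centredForm P (v a)) L P)
    {q r : ℝ} (hr : 0 ≤ r) (hr1 : r ≤ 1) :
    pr {ω | ¬ ∀ p : ι × ι, |v p.1 ⬝ᵥ ((sampleCov (fun i => D i ω) - covX P) *ᵥ v p.2)|
        ≤ covDeviationConst L q * r}
      ≤ ENNReal.ofReal ((Fintype.card ι + 1) ^ 2 * (2 * Real.exp (-(q * (n * r ^ 2))))) := by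
  -- the constant function is added to the family, to control the sample mean
  obtain ⟨F, hF⟩ : ∃ F : Option ι → (Fin d → ℝ) × ℝ → ℝ,
      F = fun a => a.elim (fun _ => 1) fun a => centredForm P (v a) := ⟨_, rfl⟩
  have hFm : ∀ a, Measurable (F a) := by
    rintro (_ | a)
    · rw [hF]; exact measurable_const
    · rw [hF]; exact measurable_centredForm P _
  have hFL : ∀ a, SubGaussianNormLE (F a) L P := by
    rintro (_ | a)
    · rw [hF]
      exact (subGaussianNormLE_const (a := 1)).mono (by simpa using hL)
    · rw [hF]; exact hv a
  have key := measure_not_forall_average_le hD hind hlaw hFm (by linarith) hFL (q := q) hr hr1 hn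
  have hcard : (Fintype.card (Option ι × Option ι) : ℝ) = (Fintype.card ι + 1) ^ 2 := by
    simp [sq]
  rw [hcard] at key
  refine (measure_mono fun ω hω => ?_).trans key
  refine fun hall => hω fun p => ?_
  have h1 := hall (some p.1, some p.2)
  have h2 := hall (some p.1, none)
  have h3 := hall (some p.2, none)
  rw [hF] at h1 h2 h3
  simp only [Option.elim_some, Option.elim_none, mul_one] at h1 h2 h3
  rw [integral_centredForm h, sub_zero] at h2 h3
  rw [integral_centredForm_mul h] at h1
  rw [Matrix.sub_mulVec, dotProduct_sub, dotProduct_sampleCov_mulVec hn _ (meanVec P)]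
  simp only [centredForm] at h1 h2 h3
  obtain ⟨x, hx⟩ : ∃ x, x = (n : ℝ)⁻¹ * ∑ i, v p.1 ⬝ᵥ ((D i ω).1 - meanVec P) := ⟨_, rfl⟩
  obtain ⟨y, hy⟩ : ∃ y, y = (n : ℝ)⁻¹ * ∑ i, v p.2 ⬝ᵥ ((D i ω).1 - meanVec P) := ⟨_, rfl⟩
  rw [← hx] at h2 ⊢
  rw [← hy] at h3 ⊢
  have hxy : |x * y| ≤ deviationConst L q ^ 2 * r := by
    rw [abs_mul]
    calc |x| * |y| ≤ (deviationConst L q * r) * (deviationConst L q * r) :=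
          mul_le_mul h2 h3 (abs_nonneg _) ((abs_nonneg _).trans h2)
      _ = deviationConst L q ^ 2 * (r * r) := by ring
      _ ≤ deviationConst L q ^ 2 * r := by
          refine mul_le_mul_of_nonneg_left ?_ (sq_nonneg _)
          exact mul_le_of_le_one_left hr hr1
  rw [sub_right_comm]
  refine (abs_sub _ _).trans ((add_le_add h1 hxy).trans (le_of_eq ?_))
  rw [covDeviationConst]; ring

/-- With high probability the sample covariance matrix is close to `Σ_x` as a quadratic form on all
`k`-sparse vectors. -/
theorem measure_not_sparse_sampleCov_le (hn : 0 < n)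
    (hD : ∀ i, Measurable (D i)) (hind : iIndepFun D pr) (hlaw : ∀ i, pr.map (D i) = P)
    (h : ∀ j : Fin d, MemLp (fun z : (Fin d → ℝ) × ℝ => z.1 j) 2 P) {k : ℕ} {L : ℝ}
    (hL : 1 ≤ L) (hv : ∀ I : Finset (Fin d), I.card ≤ k → ∀ v : Fin d → ℝ, (∀ i ∉ I, v i = 0) →
      v ⬝ᵥ v ≤ 1 → SubGaussianNormLE (centredForm P v) L P)
    {q r : ℝ} (hr : 0 ≤ r) (hr1 : r ≤ 1) :
    pr {ω | ¬ ∀ I : Finset (Fin d), I.card ≤ k → ∀ v : Fin d → ℝ, (∀ i ∉ I, v i = 0) →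
        |v ⬝ᵥ ((sampleCov (fun i => D i ω) - covX P) *ᵥ v)|
          ≤ 2 * (covDeviationConst L q * r) * (v ⬝ᵥ v)}
      ≤ ENNReal.ofReal ((((d : ℝ) * (8 * k + 1)) ^ k + 1) ^ 2
        * (2 * Real.exp (-(q * (n * r ^ 2))))) := by
  have key := measure_not_forall_sampleCov_le (ι := sparseNet d k (4 * k)) (v := fun a => a.1)
    hn hD hind hlaw h hL (fun a => by
      obtain ⟨h1, I, h2, h3⟩ := exists_support_of_mem_sparseNet a.2
      exact hv I h2 _ h3 h1) (q := q) hr hr1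
  refine (measure_mono fun ω hω => ?_).trans (key.trans (ENNReal.ofReal_le_ofReal ?_))
  · refine fun hall => hω fun I hI v hvI => ?_
    refine abs_form_le_of_sparseNet ?_ (fun w hw => hall (⟨w, hw⟩, ⟨w, hw⟩)) hI hvI
    rw [Matrix.transpose_sub, sampleCov_transpose, covX_transpose]
  · have h1 : ((Fintype.card (sparseNet d k (4 * k)) : ℕ) : ℝ) ≤ ((d : ℝ) * (8 * k + 1)) ^ k := by
      rw [Fintype.card_coe]
      have := card_sparseNet_le d k (4 * k)
      calc ((sparseNet d k (4 * k)).card : ℝ) ≤ (((d * (2 * (4 * k) + 1)) ^ k : ℕ) : ℝ) := by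
            exact_mod_cast this
        _ = _ := by push_cast; ring
    gcongr

end SampleCovariance

end SparseSIR

namespace SparseSIR

/-! ### The estimator of the mean conditional covariance -/

section ConditionalCovariance

variable {n d : ℕ} {P : Measure ((Fin d → ℝ) × ℝ)}
  {m : ℝ → Fin d → ℝ}

/-- The regression residual `x_j - m_j(y)` for a version `m` of the inverse regression curve. Unlike
`residual`, it is defined pointwise, so it can be evaluated at the observations. -/
def curveResidual (m : ℝ → Fin d → ℝ) (j : Fin d) (z : (Fin d → ℝ) × ℝ) : ℝ := z.1 j - m z.2 j

theorem measurable_curveResidual (hm : Measurable m) (j : Fin d) :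
    Measurable (curveResidual m j) := by
  unfold curveResidual; fun_prop

theorem curveResidual_ae_eq (hm : IsInverseRegressionCurve P m) (j : Fin d) :
    curveResidual m j =ᵐ[P] residual P j := by
  filter_upwards [hm.2 j] with z hz
  simp only [curveResidual, residual, hz]

theorem integral_curveResidual_mul [IsProbabilityMeasure P]
    (hm : IsInverseRegressionCurve P m)
    (h : ∀ j : Fin d, MemLp (fun z : (Fin d → ℝ) × ℝ => z.1 j) 2 P) (j k : Fin d) :
    ∫ z, curveResidual m j z * curveResidual m k z ∂P = covX P j k - covCondMean P j k := by
  rw [← integral_residual_mul h]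
  refine integral_congr_ae ?_
  filter_upwards [curveResidual_ae_eq hm j, curveResidual_ae_eq hm k] with z hj hk
  rw [hj, hk]

theorem setIntegral_curveResidual [IsProbabilityMeasure P]
    (hm : IsInverseRegressionCurve P m)
    (h : ∀ j : Fin d, MemLp (fun z : (Fin d → ℝ) × ℝ => z.1 j) 2 P) (j : Fin d) {C : Set ℝ}
    (hC : MeasurableSet C) : ∫ z in Prod.snd ⁻¹' C, curveResidual m j z ∂P = 0 := by
  have hi := (h j).integrable one_le_two
  have hC' : MeasurableSet[MeasurableSpace.comap (Prod.snd : (Fin d → ℝ) × ℝ → ℝ) inferInstance]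
      (Prod.snd ⁻¹' C) := ⟨C, hC, rfl⟩
  have h1 := setIntegral_condExp comap_snd_le hi hC'
  rw [integral_congr_ae (ae_restrict_of_ae (curveResidual_ae_eq hm j))]
  simp only [residual]
  rw [integral_sub hi.integrableOn
    ((memLp_condMeanX h j).integrable one_le_two).integrableOn, ← h1]
  exact sub_self _

/-- The conditional expectation is a contraction in every `L^p`, so taking residuals at most doubles
the sub-Gaussian norm. -/
theorem subGaussianNormLE_curveResidual [IsProbabilityMeasure P]
    (hm : IsInverseRegressionCurve P m)
    (h : ∀ j : Fin d, MemLp (fun z : (Fin d → ℝ) × ℝ => z.1 j) 2 P) {j : Fin d} {L : ℝ}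
    (hL : 0 ≤ L) (hj : SubGaussianNormLE (fun z => z.1 j - meanVec P j) L P) :
    SubGaussianNormLE (curveResidual m j) (2 * L) P := by
  intro p hp
  have hi := (h j).integrable one_le_two
  obtain ⟨g, hg⟩ : ∃ g : (Fin d → ℝ) × ℝ → ℝ, g = fun z => z.1 j - meanVec P j := ⟨_, rfl⟩
  have hgm : AEStronglyMeasurable g P := by
    rw [hg]; exact (by fun_prop : Measurable fun z : (Fin d → ℝ) × ℝ =>
      z.1 j - meanVec P j).aestronglyMeasurable
  have hce : condExp (MeasurableSpace.comap (Prod.snd : (Fin d → ℝ) × ℝ → ℝ) inferInstance) P g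
      =ᵐ[P] fun z => condMeanX P j z - meanVec P j := by
    rw [hg]
    refine (condExp_sub hi (integrable_const (meanVec P j)) _).trans ?_
    rw [condExp_const comap_snd_le]
    rfl
  have e : curveResidual m j =ᵐ[P] g - condExp
      (MeasurableSpace.comap (Prod.snd : (Fin d → ℝ) × ℝ → ℝ) inferInstance) P g := by
    filter_upwards [curveResidual_ae_eq hm j, hce] with z h1 h2
    rw [h1, Pi.sub_apply, h2, residual, hg]
    ring
  have hp1 : (1 : ENNReal) ≤ ENNReal.ofReal p := by simpa using hp
  have hgL := hj p hp
  rw [← hg] at hgL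
  rw [eLpNorm_congr_ae e]
  refine (eLpNorm_sub_le hgm (stronglyMeasurable_condExp.mono
    comap_snd_le).aestronglyMeasurable hp1).trans ?_
  refine (add_le_add hgL ((eLpNorm_condExp_le_eLpNorm _ hp1).trans hgL)).trans ?_
  rw [← ENNReal.ofReal_add (by positivity) (by positivity)]
  exact ENNReal.ofReal_le_ofReal (by linarith)

/-- The curve evaluated at neighbouring sorted responses varies by at most its variation over one
partition of `[-B, B]`. -/
theorem sum_norm_curve_sub_le (hn : 0 < n) {B : ℝ} {τ : ℕ → ℝ} (hτ : HasVariationRate B τ m)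
    {y : Fin n → ℝ} (hy : ∀ i, y i ∈ Set.Icc (-B) B) :
    ∑ i : Fin (n / 2), ‖m (y (Tuple.sort y (oddPos i))) - m (y (Tuple.sort y (evenPos i)))‖
      ≤ τ n * (n : ℝ) ^ (1 / 4 : ℝ) := by
  obtain ⟨t, ht⟩ : ∃ t : ℕ → ℝ, t = fun l => y (Tuple.sort y ⟨min l (n - 1), by omega⟩) := ⟨_, rfl⟩
  have hmono : Monotone t := by
    intro a b hab
    rw [ht]
    exact Tuple.monotone_sort y (Fin.mk_le_mk.2 (min_le_min_right _ hab))
  have h := hτ n t hmono fun i => by rw [ht]; exact hy _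
  refine le_trans ?_ h
  have e : ∀ i : Fin (n / 2), ‖m (y (Tuple.sort y (oddPos i))) - m (y (Tuple.sort y (evenPos i)))‖
      = ‖m (t (2 * (i : ℕ) + 1)) - m (t (2 * (i : ℕ)))‖ := by
    intro i
    have := i.isLt
    simp only [ht, oddPos, evenPos]
    have e1 : min (2 * (i : ℕ) + 1) (n - 1) = 2 * i + 1 := by omega
    have e2 : min (2 * (i : ℕ)) (n - 1) = 2 * i := by omega
    simp only [e1, e2]
  simp only [e]
  rw [← Finset.sum_image (s := Finset.univ) (g := fun i : Fin (n / 2) => 2 * (i : ℕ))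
    (f := fun l => ‖m (t (l + 1)) - m (t l)‖) (fun a _ b _ hab => Fin.ext (by simpa using hab))]
  refine Finset.sum_le_sum_of_subset_of_nonneg (fun l hl => ?_) fun _ _ _ => norm_nonneg _
  obtain ⟨i, -, rfl⟩ := Finset.mem_image.1 hl
  have := i.isLt
  exact Finset.mem_range.2 (by omega)

/-- Neighbouring pairs exhaust the sample up to at most one observation. -/
theorem abs_sum_pairs_sub_sum_le (σ : Equiv.Perm (Fin n)) {f : Fin n → ℝ} {b : ℝ} (hb0 : 0 ≤ b)
    (hb : ∀ i, |f i| ≤ b) :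
    |∑ i : Fin (n / 2), (f (σ (oddPos i)) + f (σ (evenPos i))) - ∑ i, f i| ≤ b := by
  obtain ⟨e, he⟩ : ∃ e : Fin (n / 2) ⊕ Fin (n / 2) → Fin n,
    e = σ ∘ Sum.elim oddPos evenPos := ⟨_, rfl⟩
  have hinj : Function.Injective e := by rw [he]; exact σ.injective.comp injective_sumElim_pos
  have h1 : ∑ i : Fin (n / 2), (f (σ (oddPos i)) + f (σ (evenPos i)))
      = ∑ l ∈ Finset.univ.image e, f l := by
    rw [Finset.sum_image fun _ _ _ _ h => hinj h, Fintype.sum_sum_type, Finset.sum_add_distrib, he]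
    rfl
  have hcard : (Finset.univ \ Finset.univ.image e).card ≤ 1 := by
    rw [Finset.card_sdiff_of_subset (Finset.subset_univ _),
      Finset.card_image_of_injective _ hinj]
    simp
    omega
  rw [h1, ← Finset.sum_sdiff (Finset.subset_univ (Finset.univ.image e)), sub_add_cancel_right,
    abs_neg]
  refine (Finset.abs_sum_le_sum_abs _ _).trans ((Finset.sum_le_card_nsmul _ _ b
    fun i _ => hb i).trans ?_)
  rw [nsmul_eq_mul]
  have : ((Finset.univ \ Finset.univ.image e).card : ℝ) ≤ 1 := by exact_mod_cast hcard
  nlinarith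

/-- The estimator `T̂` is the average of the products of the residuals, up to the products of
residuals of neighbouring observations, the variation `V` of the curve, and the observation that is
left over when `n` is odd. -/
theorem abs_condCovEstimator_sub_le (hn : 0 < n) {D : Fin n → (Fin d → ℝ) × ℝ} {X V a : ℝ}
    (hX0 : 0 ≤ X) (hX : ∀ i j, |curveResidual m j (D i)| ≤ X)
    (hV : ∑ i : Fin (n / 2), ‖m (D (Tuple.sort (fun l => (D l).2) (oddPos i))).2
      - m (D (Tuple.sort (fun l => (D l).2) (evenPos i))).2‖ ≤ V)
    (ha : ∀ j k, |∑ i : Fin (n / 2),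
      curveResidual m j (D (Tuple.sort (fun l => (D l).2) (oddPos i)))
        * curveResidual m k (D (Tuple.sort (fun l => (D l).2) (evenPos i)))| ≤ n * a)
    (j k : Fin d) :
    |condCovEstimator D j k - (n : ℝ)⁻¹ * ∑ i, curveResidual m j (D i) * curveResidual m k (D i)|
      ≤ (n : ℝ)⁻¹ * (X ^ 2 + 4 * X * V + V ^ 2) + 2 * a := by
  have hnr : (0 : ℝ) < n := by exact_mod_cast hn
  obtain ⟨σ, hσ⟩ : ∃ σ, σ = Tuple.sort (fun l => (D l).2) := ⟨_, rfl⟩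
  rw [← hσ] at hV
  simp only [← hσ] at ha
  obtain ⟨o, ho⟩ : ∃ o : Fin d → Fin (n / 2) → ℝ,
    o = fun j i => curveResidual m j (D (σ (oddPos i))) := ⟨_, rfl⟩
  obtain ⟨e, he⟩ : ∃ e : Fin d → Fin (n / 2) → ℝ,
    e = fun j i => curveResidual m j (D (σ (evenPos i))) := ⟨_, rfl⟩
  obtain ⟨δ, hδ⟩ : ∃ δ : Fin d → Fin (n / 2) → ℝ,
    δ = fun j i => m (D (σ (oddPos i))).2 j - m (D (σ (evenPos i))).2 j := ⟨_, rfl⟩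
  obtain ⟨N, hN⟩ : ∃ N : Fin (n / 2) → ℝ,
    N = fun i => ‖m (D (σ (oddPos i))).2 - m (D (σ (evenPos i))).2‖ := ⟨_, rfl⟩
  have hδN : ∀ j i, |δ j i| ≤ N i := by
    intro j i
    have := norm_le_pi_norm (m (D (σ (oddPos i))).2 - m (D (σ (evenPos i))).2) j
    rw [hδ, hN]
    exact this
  have hN0 : ∀ i, 0 ≤ N i := fun i => by rw [hN]; exact norm_nonneg _
  have hNV : ∑ i, N i ≤ V := by rw [hN]; exact hV
  have hV0 : 0 ≤ V := (Finset.sum_nonneg fun i _ => hN0 i).trans hNV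
  have hoX : ∀ j i, |o j i| ≤ X := fun j i => by rw [ho]; exact hX _ _
  have heX : ∀ j i, |e j i| ≤ X := fun j i => by rw [he]; exact hX _ _
  have hdiff : ∀ (i : Fin (n / 2)) j, concomitantDiff D i j = (o j i - e j i) + δ j i := by
    intro i j
    simp only [concomitantDiff, concomitant, Pi.sub_apply, ho, he, hδ, curveResidual, ← hσ]
    change (D (σ (oddPos i))).1 j - (D (σ (evenPos i))).1 j = _
    ring
  have hT : condCovEstimator D j k = (n : ℝ)⁻¹ * ∑ i : Fin (n / 2),
      ((o j i - e j i) + δ j i) * ((o k i - e k i) + δ k i) := by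
    simp only [condCovEstimator, Matrix.smul_apply, Matrix.sum_apply, Matrix.vecMulVec_apply,
      hdiff, smul_eq_mul]
  have hpairs := abs_sum_pairs_sub_sum_le σ
    (f := fun i => curveResidual m j (D i) * curveResidual m k (D i)) (b := X ^ 2) (sq_nonneg _)
    fun i => by
      rw [abs_mul, sq]
      exact mul_le_mul (hX i j) (hX i k) (abs_nonneg _) hX0
  have hc1 : |∑ i, o j i * e k i| ≤ n * a := by rw [ho, he]; exact ha j k
  have hc2 : |∑ i, o k i * e j i| ≤ n * a := by rw [ho, he]; exact ha k j
  have hlin : ∀ j k, |∑ i, (o j i - e j i) * δ k i| ≤ 2 * X * V := by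
    intro j k
    refine (Finset.abs_sum_le_sum_abs _ _).trans ?_
    calc ∑ i, |(o j i - e j i) * δ k i| ≤ ∑ i, 2 * X * N i := by
          refine Finset.sum_le_sum fun i _ => ?_
          rw [abs_mul]
          refine mul_le_mul ((abs_sub _ _).trans ?_) (hδN k i) (abs_nonneg _) (by positivity)
          linarith [hoX j i, heX j i]
      _ = 2 * X * ∑ i, N i := by rw [Finset.mul_sum]
      _ ≤ 2 * X * V := by gcongr
  have hquad : |∑ i, δ j i * δ k i| ≤ V ^ 2 := by
    refine (Finset.abs_sum_le_sum_abs _ _).trans ?_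
    calc ∑ i, |δ j i * δ k i| ≤ ∑ i, V * N i := by
          refine Finset.sum_le_sum fun i _ => ?_
          rw [abs_mul]
          refine mul_le_mul ((hδN j i).trans ?_) (hδN k i) (abs_nonneg _) hV0
          exact (Finset.single_le_sum (fun i _ => hN0 i) (Finset.mem_univ i)).trans hNV
      _ = V * ∑ i, N i := by rw [Finset.mul_sum]
      _ ≤ V ^ 2 := by rw [sq]; gcongr
  have hsplit : ∑ i : Fin (n / 2), ((o j i - e j i) + δ j i) * ((o k i - e k i) + δ k i)
      = ∑ i : Fin (n / 2), (o j i * o k i + e j i * e k i) - ∑ i, o j i * e k i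
        - ∑ i, o k i * e j i + ∑ i, (o j i - e j i) * δ k i + ∑ i, (o k i - e k i) * δ j i
        + ∑ i, δ j i * δ k i := by
    simp only [← Finset.sum_sub_distrib, ← Finset.sum_add_distrib]
    exact Finset.sum_congr rfl fun i _ => by ring
  have hpairs' : |∑ i : Fin (n / 2), (o j i * o k i + e j i * e k i)
      - ∑ i, curveResidual m j (D i) * curveResidual m k (D i)| ≤ X ^ 2 := by
    rw [ho, he]; exact hpairs
  rw [hT, ← mul_sub, abs_mul, abs_of_pos (inv_pos.2 hnr), hsplit]
  have h3 := hlin j k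
  have h4 := hlin k j
  have hfin : ∀ p s c₁ c₂ l₁ l₂ q : ℝ, |p - s| ≤ X ^ 2 → |c₁| ≤ n * a → |c₂| ≤ n * a →
      |l₁| ≤ 2 * X * V → |l₂| ≤ 2 * X * V → |q| ≤ V ^ 2 →
      |p - c₁ - c₂ + l₁ + l₂ + q - s| ≤ (X ^ 2 + 4 * X * V + V ^ 2) + n * (2 * a) := by
    intro p s c₁ c₂ l₁ l₂ q h1 h2 h3 h4 h5 h6
    rw [abs_le] at *
    constructor <;>
      linarith [h1.1, h1.2, h2.1, h2.2, h3.1, h3.2, h4.1, h4.2, h5.1, h5.2, h6.1, h6.2]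
  calc _ ≤ (n : ℝ)⁻¹ * ((X ^ 2 + 4 * X * V + V ^ 2) + n * (2 * a)) :=
        mul_le_mul_of_nonneg_left (hfin _ _ _ _ _ _ _ hpairs' hc1 hc2 h3 h4 hquad)
          (inv_pos.2 hnr).le
    _ = _ := by field_simp

end ConditionalCovariance

end SparseSIR

namespace SparseSIR

/-! ### Entrywise deviation of the estimator -/

section EntrywiseDeviation

variable {n d K : ℕ}

/-- The effect of replacing `T` by `S` in `T U diag(μ) Uᵀ T`: two linear terms, and a
quadratic one that is the sum of `K` products of deviations. -/
theorem abs_conj_sub_conj_le {S T : Matrix (Fin d) (Fin d) ℝ} (hS : Sᵀ = S) (hT : Tᵀ = T)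
    {U : Matrix (Fin d) (Fin K) ℝ} {μ : Fin K → ℝ} (hμ0 : ∀ k, 0 ≤ μ k) (hμ1 : ∀ k, μ k ≤ 1)
    {η : ℝ} (h1 : ∀ i j, |((S - T) * (U * Matrix.diagonal μ * Uᵀ * T)) i j| ≤ η)
    (h2 : ∀ i k, |((S - T) * U) i k| ≤ η) (i j : Fin d) :
    |(S * U * Matrix.diagonal μ * Uᵀ * S - T * U * Matrix.diagonal μ * Uᵀ * T) i j|
      ≤ 2 * η + K * η ^ 2 := by
  obtain ⟨E, hE⟩ : ∃ E, E = S - T := ⟨_, rfl⟩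
  rw [← hE] at h1 h2
  have hEt : Eᵀ = E := by rw [hE, Matrix.transpose_sub, hS, hT]
  have hSE : S = T + E := by rw [hE]; abel
  obtain ⟨G, hG⟩ : ∃ G, G = U * Matrix.diagonal μ * Uᵀ := ⟨_, rfl⟩
  have hGt : Gᵀ = G := by
    rw [hG]; simp [Matrix.transpose_mul, Matrix.mul_assoc]
  have hEU : (E * U)ᵀ = Uᵀ * E := by rw [Matrix.transpose_mul, hEt]
  have e : S * U * Matrix.diagonal μ * Uᵀ * S - T * U * Matrix.diagonal μ * Uᵀ * T
      = E * (G * T) + (E * (G * T))ᵀ + (E * U) * Matrix.diagonal μ * (E * U)ᵀ := by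
    have a1 : S * U * Matrix.diagonal μ * Uᵀ * S = S * G * S := by
      rw [hG]; simp only [Matrix.mul_assoc]
    have a2 : T * U * Matrix.diagonal μ * Uᵀ * T = T * G * T := by
      rw [hG]; simp only [Matrix.mul_assoc]
    have a3 : (E * U) * Matrix.diagonal μ * (E * U)ᵀ = E * G * E := by
      rw [hEU, hG]; simp only [Matrix.mul_assoc]
    have a4 : (E * (G * T))ᵀ = T * G * E := by
      rw [Matrix.transpose_mul, Matrix.transpose_mul, hEt, hGt, hT]
    rw [a1, a2, a3, a4, hSE]
    noncomm_ring
  rw [e, Matrix.add_apply, Matrix.add_apply, Matrix.transpose_apply]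
  rw [← hG] at h1
  have h3 : |((E * U) * Matrix.diagonal μ * (E * U)ᵀ) i j| ≤ K * η ^ 2 := by
    rw [Matrix.mul_apply]
    refine (Finset.abs_sum_le_sum_abs _ _).trans ?_
    calc ∑ k, |((E * U) * Matrix.diagonal μ) i k * (E * U)ᵀ k j| ≤ ∑ _k : Fin K, η ^ 2 := by
          refine Finset.sum_le_sum fun k _ => ?_
          rw [Matrix.mul_diagonal, Matrix.transpose_apply, abs_mul, abs_mul,
            abs_of_nonneg (hμ0 k)]
          have hη := (abs_nonneg _).trans (h2 i k)
          calc |(E * U) i k| * μ k * |(E * U) j k| ≤ η * 1 * η := by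
                have := hμ0 k
                gcongr
                · exact h2 i k
                · exact hμ1 k
                · exact h2 j k
            _ = η ^ 2 := by ring
      _ = K * η ^ 2 := by simp
  refine (abs_add_le _ _).trans ?_
  have := abs_add_le ((E * (G * T)) i j) ((E * (G * T)) j i)
  linarith [h1 i j, h1 j i]

theorem single_dotProduct_mulVec_col {m : ℕ} (E : Matrix (Fin d) (Fin d) ℝ)
    (M : Matrix (Fin d) (Fin m) ℝ) (i : Fin d) (j : Fin m) :
    (Pi.single i 1 : Fin d → ℝ) ⬝ᵥ (E *ᵥ fun l => M l j) = (E * M) i j := by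
  rw [single_dotProduct, one_mul, Matrix.mulVec, Matrix.mul_apply, dotProduct]

/-- The columns of `U diag(μ) Uᵀ Σ` have a `Σ`-norm that is bounded by the variances of the
coordinates, by Bessel's inequality. -/
theorem form_col_le {S : Matrix (Fin d) (Fin d) ℝ} (hS : S.PosSemidef)
    {U : Matrix (Fin d) (Fin K) ℝ} (hU : Uᵀ * S * U = 1) {μ : Fin K → ℝ} (hμ0 : ∀ k, 0 ≤ μ k)
    (hμ1 : ∀ k, μ k ≤ 1) (j : Fin d) :
    (fun l => (U * Matrix.diagonal μ * Uᵀ * S) l j) ⬝ᵥ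
      (S *ᵥ fun l => (U * Matrix.diagonal μ * Uᵀ * S) l j) ≤ S j j := by
  obtain ⟨v, hv⟩ : ∃ v : Fin d → ℝ, v = Pi.single j 1 := ⟨_, rfl⟩
  obtain ⟨y, hy⟩ : ∃ y, y = Uᵀ *ᵥ (S *ᵥ v) := ⟨_, rfl⟩
  have hw : (fun l => (U * Matrix.diagonal μ * Uᵀ * S) l j) = U *ᵥ (Matrix.diagonal μ *ᵥ y) := by
    rw [hy, hv, Matrix.mulVec_mulVec, Matrix.mulVec_mulVec, Matrix.mulVec_mulVec,
      Matrix.mulVec_single_one]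
    simp only [Matrix.mul_assoc]
    rfl
  have hb := sum_sq_transpose_mulVec_le hS hU v
  have hvj : v ⬝ᵥ (S *ᵥ v) = S j j := by rw [hv]; simp
  rw [hvj, ← hy] at hb
  rw [hw]
  have e : (U *ᵥ (Matrix.diagonal μ *ᵥ y)) ⬝ᵥ (S *ᵥ (U *ᵥ (Matrix.diagonal μ *ᵥ y)))
      = (Matrix.diagonal μ *ᵥ y) ⬝ᵥ (Matrix.diagonal μ *ᵥ y) := by
    have := dotProduct_conj_mulVec S Uᵀ (Matrix.diagonal μ *ᵥ y)
    rw [Matrix.transpose_transpose] at this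
    rw [← this, hU, Matrix.one_mulVec]
  rw [e]
  refine le_trans (Finset.sum_le_sum fun k _ => ?_) hb
  rw [Matrix.mulVec_diagonal]
  have h0 := hμ0 k
  have h1 := hμ1 k
  have : μ k * μ k ≤ 1 := by nlinarith
  nlinarith [sq_nonneg (y k)]

/-- The constant in the bound on the entrywise deviation. -/
noncomputable def entryDeviationConst (L q : ℝ) : ℝ :=
  3 * covDeviationConst L q + covDeviationConst L q ^ 2 + 3 * deviationConst L q
    + 3 * (2 * sqExpConst L * (2 + q) + 1)

theorem entryDeviationConst_pos {L q : ℝ} (hL : 0 < L) (hq : 0 ≤ q) :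
    0 < entryDeviationConst L q := by
  have h1 := covDeviationConst_pos hL hq
  have h2 := deviationConst_pos hL hq
  have h3 := sqExpConst_pos hL
  unfold entryDeviationConst; positivity

variable {Ω : Type*} [MeasurableSpace Ω] {pr : Measure Ω} [IsProbabilityMeasure pr]
  {P : Measure ((Fin d → ℝ) × ℝ)} [IsProbabilityMeasure P] {D : Fin n → Ω → (Fin d → ℝ) × ℝ}

/-- With high probability the estimator of `Σ_{E(x ∣ y)}` is entrywise close to the matrix
`Σ̂_x U diag(μ) Uᵀ Σ̂_x`, which replaces `Σ_x` by `Σ̂_x` in the factorization of `Σ_{E(x ∣ y)}`. -/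
theorem measure_not_forall_entry_le (hn : 0 < n)
    (hD : ∀ i, Measurable (D i)) (hind : iIndepFun D pr) (hlaw : ∀ i, pr.map (D i) = P)
    (h : ∀ j : Fin d, MemLp (fun z : (Fin d → ℝ) × ℝ => z.1 j) 2 P) {B : ℝ}
    (hB : ∀ᵐ z ∂P, z.2 ∈ Set.Icc (-B) B) {m : ℝ → Fin d → ℝ} (hm : IsInverseRegressionCurve P m)
    {τ : ℕ → ℝ} (hτ : HasVariationRate B τ m) (hτn : τ n ≤ 1)
    {U : Matrix (Fin d) (Fin K) ℝ} {μ : Fin K → ℝ} (hU : Uᵀ * covX P * U = 1)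
    (hA : covCondMean P = covX P * U * Matrix.diagonal μ * Uᵀ * covX P)
    (hμ0 : ∀ k, 0 ≤ μ k) (hμ1 : ∀ k, μ k ≤ 1) {c L : ℝ} (hc : 1 ≤ c)
    (hdiag : ∀ j, covX P j j ≤ c) (hL : 1 ≤ L)
    (hsub : ∀ v : Fin d → ℝ, v ⬝ᵥ (covX P *ᵥ v) ≤ c → SubGaussianNormLE (centredForm P v) (L / 2) P)
    (hd : 1 ≤ Real.log d) (hdn : Real.log d ≤ n) (hKd : K ≤ d)
    (hKr : K * √(Real.log d / n) ≤ 1) {q : ℝ} (hq : 0 ≤ q) :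
    pr {ω | ¬ ∀ i j, |(covCondMeanEstimator (fun i => D i ω)
        - sampleCov (fun i => D i ω) * U * Matrix.diagonal μ * Uᵀ * sampleCov (fun i => D i ω)) i j|
          ≤ entryDeviationConst L q * √(Real.log d / n)}
      ≤ ENNReal.ofReal (38 * d ^ 2 * Real.exp (-(q * Real.log d))) := by
  have hnr : (0 : ℝ) < n := by exact_mod_cast hn
  have hL0 : 0 < L := by linarith
  have hκ := sqExpConst_pos hL0
  obtain ⟨r, hr⟩ : ∃ r, r = √(Real.log d / n) := ⟨_, rfl⟩
  rw [← hr] at hKr ⊢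
  have hr0 : 0 ≤ r := by rw [hr]; exact Real.sqrt_nonneg _
  have hr1 : r ≤ 1 := by
    rw [hr]; exact Real.sqrt_le_one.2 ((div_le_one hnr).2 hdn)
  have hr2 : r ^ 2 = Real.log d / n := by rw [hr, Real.sq_sqrt (by positivity)]
  have hnr2 : n * r ^ 2 = Real.log d := by rw [hr2]; field_simp
  have hsn : 1 / √(n : ℝ) ≤ r := by
    rw [hr, ← Real.sqrt_one, ← Real.sqrt_div zero_le_one]
    exact Real.sqrt_le_sqrt (by gcongr)
  have hd1 : (1 : ℝ) ≤ d := by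
    rcases Nat.eq_zero_or_pos d with h0 | h0
    · rw [h0] at hd; norm_num at hd
    · exact_mod_cast h0
  -- the three sub-Gaussian families
  obtain ⟨v, hv⟩ : ∃ v : Fin d ⊕ (Fin d ⊕ Fin K) → Fin d → ℝ,
      v = Sum.elim (fun i => Pi.single i 1) (Sum.elim
        (fun j l => (U * Matrix.diagonal μ * Uᵀ * covX P) l j) fun k l => U l k) := ⟨_, rfl⟩
  have hvc : ∀ a, v a ⬝ᵥ (covX P *ᵥ v a) ≤ c := by
    rintro (i | j | k)
    · rw [hv]; simpa using hdiag i
    · rw [hv]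
      exact (form_col_le (covX_posSemidef h) hU hμ0 hμ1 j).trans (hdiag j)
    · rw [hv]
      refine le_trans (le_of_eq ?_) hc
      have := congrFun (congrFun hU k) k
      rw [Matrix.one_apply_eq, Matrix.mul_assoc, Matrix.mul_apply] at this
      rw [← this]
      rfl
  have hvL : ∀ a, SubGaussianNormLE (centredForm P (v a)) L P := fun a =>
    (hsub _ (hvc a)).mono (by linarith)
  have hεm : ∀ j, Measurable (curveResidual m j) := measurable_curveResidual hm.1
  have hεL : ∀ j, SubGaussianNormLE (curveResidual m j) L P := by
    intro j
    have h1 := hsub (Pi.single j 1) (by simpa using hdiag j)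
    have h2 : centredForm P (Pi.single j 1) = fun z => z.1 j - meanVec P j := by
      ext z; exact meanVec_single_dotProduct P j z
    rw [h2] at h1
    have := subGaussianNormLE_curveResidual hm h (by linarith) h1
    rwa [mul_div_cancel₀ _ two_ne_zero] at this
  have b1 := measure_not_forall_sampleCov_le hn hD hind hlaw h hL hvL (q := q) hr0 hr1
  have b2 := measure_not_forall_average_le hD hind hlaw hεm hL0 hεL (q := q) hr0 hr1 hn
  have b3 := measure_not_forall_neighbours_le hD hind hlaw hεm hL0 hεL
    (fun j C hC => setIntegral_curveResidual hm h j hC) (q := q) hr0 hr1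
  obtain ⟨u, hu⟩ : ∃ u, u = Real.log n + q * Real.log d := ⟨_, rfl⟩
  have b4 := measure_not_forall_sq_le hD hlaw hεm hL0 hεL u
  have b5 : pr {ω | ¬ ∀ i, (D i ω).2 ∈ Set.Icc (-B) B} = 0 := by
    have : ∀ᵐ ω ∂pr, ∀ i, (D i ω).2 ∈ Set.Icc (-B) B := by
      rw [ae_all_iff]
      intro i
      rw [← hlaw i] at hB
      exact ae_of_ae_map (hD i).aemeasurable hB
    exact this
  rw [hnr2] at b1 b2 b3
  refine (measure_mono (t := _ ∪ (_ ∪ (_ ∪ (_ ∪ _)))) ?_).trans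
    ((measure_union_le _ _).trans ((add_le_add b1 ((measure_union_le _ _).trans (add_le_add b2
      ((measure_union_le _ _).trans (add_le_add b3 ((measure_union_le _ _).trans
        (add_le_add b4 b5.le))))))).trans ?_))
  · intro ω hω
    by_contra hgood
    simp only [Set.mem_union, not_or, Set.mem_ofPred_eq, not_not] at hgood
    obtain ⟨g1, g2, g3, g4, g5⟩ := hgood
    refine hω fun i j => ?_
    obtain ⟨S, hS⟩ : ∃ S, S = sampleCov (fun i => D i ω) := ⟨_, rfl⟩
    have hSt : Sᵀ = S := by rw [hS]; exact sampleCov_transpose _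
    rw [← hS] at g1 ⊢
    have hM2 := covDeviationConst_pos hL0 hq
    obtain ⟨M2, hM2'⟩ : ∃ x, x = covDeviationConst L q := ⟨_, rfl⟩
    obtain ⟨M1, hM1'⟩ : ∃ x, x = deviationConst L q := ⟨_, rfl⟩
    rw [← hM2'] at g1 hM2
    rw [← hM1'] at g2 g3
    -- the terms that involve the sample covariance matrix only
    have t1 : |(S - covX P) i j| ≤ M2 * r := by
      have := g1 (Sum.inl i, Sum.inl j)
      rw [hv] at this
      simpa using this
    have t2 := abs_conj_sub_conj_le hSt (covX_transpose P) hμ0 hμ1 (η := M2 * r)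
      (fun i j => by
        have := g1 (Sum.inl i, Sum.inr (Sum.inl j))
        rw [hv] at this
        simp only [Sum.elim_inl, Sum.elim_inr] at this
        rwa [single_dotProduct_mulVec_col] at this)
      (fun i k => by
        have := g1 (Sum.inl i, Sum.inr (Sum.inr k))
        rw [hv] at this
        simp only [Sum.elim_inl, Sum.elim_inr] at this
        rwa [single_dotProduct_mulVec_col] at this) i j
    rw [← hA] at t2
    have t2' : K * (M2 * r) ^ 2 ≤ M2 ^ 2 * r := by
      calc K * (M2 * r) ^ 2 = (K * r) * (M2 ^ 2 * r) := by ring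
        _ ≤ 1 * (M2 ^ 2 * r) := by gcongr
        _ = _ := one_mul _
    -- the residual terms
    obtain ⟨X, hX⟩ : ∃ X, X = √(2 * sqExpConst L * u) := ⟨_, rfl⟩
    have hn1 : (1 : ℝ) ≤ n := by exact_mod_cast hn
    have hu0 : 0 ≤ u := by
      rw [hu]
      have := Real.log_nonneg hn1
      positivity
    have hX2 : X ^ 2 = 2 * sqExpConst L * u := by rw [hX, Real.sq_sqrt (by positivity)]
    have hX0 : 0 ≤ X := by rw [hX]; exact Real.sqrt_nonneg _
    obtain ⟨V, hV⟩ : ∃ V, V = (n : ℝ) ^ (1 / 4 : ℝ) := ⟨_, rfl⟩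
    have hV0 : 0 ≤ V := by rw [hV]; positivity
    have hV2 : V ^ 2 = √n := by
      rw [hV, ← Real.rpow_natCast, ← Real.rpow_mul hnr.le, Real.sqrt_eq_rpow]; norm_num
    have t3 := abs_condCovEstimator_sub_le hn (D := fun i => D i ω) (m := m) (V := V)
      (a := M1 * r) hX0 (fun i j => Real.abs_le_sqrt (g4 (i, j)) |>.trans_eq hX.symm)
      ((sum_norm_curve_sub_le hn hτ g5).trans (by
        rw [← hV]; exact mul_le_of_le_one_left hV0 hτn)) (fun j k => g3 (j, k)) i j
    have t4 := g2 (i, j)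
    simp only at t4
    rw [integral_curveResidual_mul hm h] at t4
    have hXn : (n : ℝ)⁻¹ * X ^ 2 ≤ 2 * sqExpConst L * (2 + q) * r := by
      have hlog : Real.log n ≤ 2 * √n := by
        have := Real.log_le_sub_one_of_pos (Real.sqrt_pos.2 hnr)
        rw [Real.log_sqrt hnr.le] at this
        linarith
      have h1 : (n : ℝ)⁻¹ * Real.log n ≤ 2 * r := by
        calc (n : ℝ)⁻¹ * Real.log n ≤ (n : ℝ)⁻¹ * (2 * √n) := by gcongr
          _ = 2 * (1 / √n) := by
              have := Real.mul_self_sqrt hnr.le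
              have h0 : √(n : ℝ) ≠ 0 := by positivity
              field_simp
              linarith
          _ ≤ 2 * r := by gcongr
      have h2 : (n : ℝ)⁻¹ * Real.log d ≤ r := by
        rw [← div_eq_inv_mul, ← hr2, sq]
        exact mul_le_of_le_one_left hr0 hr1
      rw [hX2, hu]
      calc (n : ℝ)⁻¹ * (2 * sqExpConst L * (Real.log n + q * Real.log d))
          = 2 * sqExpConst L * ((n : ℝ)⁻¹ * Real.log n + q * ((n : ℝ)⁻¹ * Real.log d)) := by ring
        _ ≤ 2 * sqExpConst L * (2 * r + q * r) := by gcongr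
        _ = _ := by ring
    have hVn : (n : ℝ)⁻¹ * V ^ 2 ≤ r := by
      rw [hV2]
      refine le_trans (le_of_eq ?_) hsn
      have := Real.mul_self_sqrt hnr.le
      have h0 : √(n : ℝ) ≠ 0 := by positivity
      field_simp
      linarith
    have t3' : (n : ℝ)⁻¹ * (X ^ 2 + 4 * X * V + V ^ 2)
        ≤ 3 * (2 * sqExpConst L * (2 + q) + 1) * r := by
      have : 4 * X * V ≤ 2 * X ^ 2 + 2 * V ^ 2 := by nlinarith [sq_nonneg (X - V)]
      calc (n : ℝ)⁻¹ * (X ^ 2 + 4 * X * V + V ^ 2)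
          ≤ (n : ℝ)⁻¹ * (X ^ 2 + (2 * X ^ 2 + 2 * V ^ 2) + V ^ 2) := by gcongr
        _ = 3 * ((n : ℝ)⁻¹ * X ^ 2 + (n : ℝ)⁻¹ * V ^ 2) := by ring
        _ ≤ 3 * (2 * sqExpConst L * (2 + q) * r + r) := by gcongr
        _ = _ := by ring
    have e : (covCondMeanEstimator (fun i => D i ω) - S * U * Matrix.diagonal μ * Uᵀ * S) i j
        = (S - covX P) i j
          - (condCovEstimator (fun i => D i ω) i j
              - (n : ℝ)⁻¹ * ∑ l, curveResidual m i (D l ω) * curveResidual m j (D l ω))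
          - ((n : ℝ)⁻¹ * ∑ l, curveResidual m i (D l ω) * curveResidual m j (D l ω)
              - (covX P i j - covCondMean P i j))
          - (S * U * Matrix.diagonal μ * Uᵀ * S - covCondMean P) i j := by
      rw [covCondMeanEstimator, ← hS]
      simp only [Matrix.sub_apply]
      ring
    rw [e, entryDeviationConst, ← hM1', ← hM2']
    have hfin : ∀ a b c e : ℝ, |a - b - c - e| ≤ |a| + |b| + |c| + |e| := fun a b c e =>
      (abs_sub _ _).trans (by linarith [abs_sub (a - b) c, abs_sub a b])
    refine (hfin _ _ _ _).trans ?_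
    linarith
  · have hcard1 : (Fintype.card (Fin d ⊕ (Fin d ⊕ Fin K)) : ℝ) ≤ 3 * d := by
      have : (K : ℝ) ≤ d := by exact_mod_cast hKd
      simp only [Fintype.card_sum, Fintype.card_fin]
      push_cast
      linarith
    have hcard2 : (Fintype.card (Fin d × Fin d) : ℝ) = (d : ℝ) ^ 2 := by simp [sq]
    have hcard3 : (Fintype.card (Fin n × Fin d) : ℝ) = n * d := by simp
    have hexp : Real.exp (-u) = (n : ℝ)⁻¹ * Real.exp (-(q * Real.log d)) := by
      rw [hu, neg_add, Real.exp_add, Real.exp_neg (Real.log n), Real.exp_log hnr]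
    rw [hcard2, hcard3, hexp, add_zero, ← ENNReal.ofReal_add (by positivity) (by positivity),
      ← ENNReal.ofReal_add (by positivity) (by positivity),
      ← ENNReal.ofReal_add (by positivity) (by positivity)]
    refine ENNReal.ofReal_le_ofReal ?_
    have hw := Real.exp_pos (-(q * Real.log d))
    obtain ⟨w, hw'⟩ : ∃ w, w = Real.exp (-(q * Real.log d)) := ⟨_, rfl⟩
    rw [← hw'] at hw ⊢
    have h1 : ((Fintype.card (Fin d ⊕ (Fin d ⊕ Fin K)) : ℝ) + 1) ^ 2 ≤ 16 * (d : ℝ) ^ 2 := by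
      calc ((Fintype.card (Fin d ⊕ (Fin d ⊕ Fin K)) : ℝ) + 1) ^ 2 ≤ (4 * (d : ℝ)) ^ 2 := by
            gcongr; linarith
        _ = _ := by ring
    have h2 : (n : ℝ) * d * (2 * ((n : ℝ)⁻¹ * w)) = 2 * d * w := by field_simp
    have h3 : (d : ℝ) * w ≤ (d : ℝ) ^ 2 * w := by
      gcongr; nlinarith
    rw [h2]
    have h4 := mul_le_mul_of_nonneg_right h1 (by positivity : 0 ≤ 2 * w)
    linarith

end EntrywiseDeviation

end SparseSIR

namespace SparseSIR

/-! ### Transfer of the sparse eigenvalue bounds and choice of the constants -/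

section Transfer

variable {d K : ℕ}

theorem SparseEigenvaluesIn.sparseFormBounds {S : Matrix (Fin d) (Fin d) ℝ} {k : ℕ} {c : ℝ}
    (h : SparseEigenvaluesIn S k c) : SparseFormBounds S k c⁻¹ c := by
  intro I hI v hv
  by_cases h0 : v = 0
  · simp [h0]
  have hnnz : nnzCount v ≤ k := by
    refine le_trans ?_ hI
    rw [nnzCount, ← Set.ncard_coe_finset I]
    exact Set.ncard_le_ncard (fun j hj => by by_contra hjI; exact hj (hv j hjI)) I.finite_toSet
  have hpos := dotProduct_self_pos h0
  obtain ⟨h1, h2⟩ := h v h0 hnnz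
  exact ⟨(le_div_iff₀ hpos).1 h1, (div_le_iff₀ hpos).1 h2⟩

theorem SparseFormBounds.diag_mem {S : Matrix (Fin d) (Fin d) ℝ} {k : ℕ} {φ₁ φ₂ : ℝ}
    (h : SparseFormBounds S k φ₁ φ₂) (hk : 0 < k) (j : Fin d) : φ₁ ≤ S j j ∧ S j j ≤ φ₂ := by
  have := h {j} (by rw [Finset.card_singleton]; exact hk) (Pi.single j 1) fun i hi =>
    Pi.single_eq_of_ne (by simpa using hi) _
  simpa using this

/-- The sparse eigenvalue bounds pass from `T` to `S` with the constant doubled. -/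
theorem SparseFormBounds.of_deviation {S T : Matrix (Fin d) (Fin d) ℝ} {k : ℕ} {c x : ℝ}
    (h : SparseFormBounds T k c⁻¹ c) (hc : 1 ≤ c) (hx : x ≤ 1 / (2 * c))
    (hdev : ∀ I : Finset (Fin d), I.card ≤ k → ∀ v : Fin d → ℝ, (∀ i ∉ I, v i = 0) →
      |v ⬝ᵥ ((S - T) *ᵥ v)| ≤ x * (v ⬝ᵥ v)) :
    SparseFormBounds S k (1 / (2 * c)) (2 * c) := by
  intro I hI v hv
  obtain ⟨h1, h2⟩ := h I hI v hv
  have h3 := hdev I hI v hv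
  rw [Matrix.sub_mulVec, dotProduct_sub] at h3
  have h0 : 0 ≤ v ⬝ᵥ v := Finset.sum_nonneg fun i _ => mul_self_nonneg _
  have h4 : x * (v ⬝ᵥ v) ≤ 1 / (2 * c) * (v ⬝ᵥ v) := by gcongr
  have hc' : c⁻¹ = 1 / (2 * c) + 1 / (2 * c) := by field_simp; norm_num
  have h5 : 1 / (2 * c) ≤ c := by
    rw [div_le_iff₀ (by linarith)]; nlinarith
  have h6 : 1 / (2 * c) * (v ⬝ᵥ v) ≤ c * (v ⬝ᵥ v) := by gcongr
  rw [hc', add_mul] at h1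
  rw [abs_le] at h3
  constructor <;> linarith [h3.1, h3.2]

/-- The columns of a sparse matrix that are orthonormal for `T` stay nearly orthonormal for `S`. -/
theorem half_le_form_of_deviation {S T : Matrix (Fin d) (Fin d) ℝ} {k : ℕ} {c x : ℝ}
    (h : SparseFormBounds T k c⁻¹ c) (hc : 1 ≤ c) (hx : x ≤ 1 / (2 * c))
    (hdev : ∀ I : Finset (Fin d), I.card ≤ k → ∀ v : Fin d → ℝ, (∀ i ∉ I, v i = 0) →
      |v ⬝ᵥ ((S - T) *ᵥ v)| ≤ x * (v ⬝ᵥ v))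
    {U : Matrix (Fin d) (Fin K) ℝ} (hU : Uᵀ * T * U = 1) {J : Finset (Fin d)} (hJ : J.card ≤ k)
    (hUJ : ∀ i ∉ J, ∀ l, U i l = 0) (y : Fin K → ℝ) :
    1 / 2 * (y ⬝ᵥ y) ≤ y ⬝ᵥ ((Uᵀ * S * U) *ᵥ y) := by
  have e : ∀ M : Matrix (Fin d) (Fin d) ℝ,
      y ⬝ᵥ ((Uᵀ * M * U) *ᵥ y) = (U *ᵥ y) ⬝ᵥ (M *ᵥ (U *ᵥ y)) := by
    intro M
    have := dotProduct_conj_mulVec M Uᵀ y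
    rwa [Matrix.transpose_transpose] at this
  have hT := e T
  rw [hU, Matrix.one_mulVec] at hT
  rw [e S]
  obtain ⟨v, hv⟩ : ∃ v, v = U *ᵥ y := ⟨_, rfl⟩
  rw [← hv] at hT ⊢
  have hvJ : ∀ i ∉ J, v i = 0 := fun i hi => by
    rw [hv]; simp [Matrix.mulVec, dotProduct, hUJ i hi]
  have h1 := (h J hJ v hvJ).1
  have h3 := hdev J hJ v hvJ
  rw [Matrix.sub_mulVec, dotProduct_sub] at h3
  have h0 : 0 ≤ v ⬝ᵥ v := Finset.sum_nonneg fun i _ => mul_self_nonneg _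
  have h4 : x * (v ⬝ᵥ v) ≤ 1 / 2 * (v ⬝ᵥ (T *ᵥ v)) := by
    calc x * (v ⬝ᵥ v) ≤ 1 / (2 * c) * (v ⬝ᵥ v) := by gcongr
      _ = 1 / 2 * (c⁻¹ * (v ⬝ᵥ v)) := by field_simp
      _ ≤ _ := by gcongr
  rw [hT]
  rw [abs_le] at h3
  linarith [h3.1]

/-- The union bound over the net is beaten by a sample of size of order `s² log d`. -/
theorem net_bound_le {κ s n : ℕ} {η : ℝ} (hκ : 0 < κ) (hs : 0 < s) (hsd : s ≤ d)
    (hd : 1 ≤ Real.log d)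
    (hn : (2 * κ * (Real.log (9 * κ) + 3) + 5) * s ^ 2 * Real.log d ≤ n * η ^ 2) :
    (((d : ℝ) * (8 * (κ * s ^ 2 : ℕ) + 1)) ^ (κ * s ^ 2) + 1) ^ 2
        * (2 * Real.exp (-(1 * (n * η ^ 2)))) ≤ 8 * Real.exp (-(5 * Real.log d)) := by
  obtain ⟨k, hk⟩ : ∃ k, k = κ * s ^ 2 := ⟨_, rfl⟩
  rw [← hk]
  have hkr : (k : ℝ) = κ * (s : ℝ) ^ 2 := by rw [hk]; push_cast; ring
  have hκ1 : (1 : ℝ) ≤ κ := by exact_mod_cast hκ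
  have hs1 : (1 : ℝ) ≤ s := by exact_mod_cast hs
  have hsd' : (s : ℝ) ≤ d := by exact_mod_cast hsd
  have hd0 : (0 : ℝ) < d := by linarith
  have hk1 : (1 : ℝ) ≤ k := by
    rw [hkr]; nlinarith [one_le_pow₀ hs1 (n := 2)]
  obtain ⟨l, hl⟩ : ∃ l, l = Real.log (9 * κ) + 3 := ⟨_, rfl⟩
  rw [← hl] at hn
  have hlog0 : 0 ≤ Real.log (9 * κ) := Real.log_nonneg (by linarith)
  have hbase : (d : ℝ) * (8 * k + 1) ≤ Real.exp (l * Real.log d) := by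
    calc (d : ℝ) * (8 * k + 1) ≤ d * (9 * (κ * (d : ℝ) ^ 2)) := by
          have : (k : ℝ) ≤ κ * (d : ℝ) ^ 2 := by rw [hkr]; gcongr
          gcongr
          linarith
      _ = Real.exp (Real.log (9 * κ) + 3 * Real.log d) := by
          rw [Real.exp_add, Real.exp_log (by linarith), mul_comm (3 : ℝ), Real.exp_mul,
            Real.exp_log hd0, show (3 : ℝ) = ((3 : ℕ) : ℝ) by norm_num, Real.rpow_natCast]
          ring
      _ ≤ Real.exp (l * Real.log d) := by
          refine Real.exp_le_exp.2 ?_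
          rw [hl]
          nlinarith
  have hpow : ((d : ℝ) * (8 * k + 1)) ^ k ≤ Real.exp (k * (l * Real.log d)) := by
    rw [Real.exp_nat_mul]
    gcongr
  have hone : 1 ≤ Real.exp (k * (l * Real.log d)) := by
    refine Real.one_le_exp ?_
    have : 0 ≤ l := by rw [hl]; linarith
    positivity
  calc (((d : ℝ) * (8 * k + 1)) ^ k + 1) ^ 2 * (2 * Real.exp (-(1 * (n * η ^ 2))))
      ≤ (2 * Real.exp (k * (l * Real.log d))) ^ 2 * (2 * Real.exp (-(1 * (n * η ^ 2)))) := by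
        gcongr; linarith
    _ = 8 * Real.exp (2 * (k * (l * Real.log d)) - n * η ^ 2) := by
        rw [mul_pow, ← Real.exp_nat_mul, sub_eq_add_neg, Real.exp_add]
        push_cast
        ring_nf
    _ ≤ 8 * Real.exp (-(5 * Real.log d)) := by
        gcongr
        have h5 : 5 * Real.log d ≤ 5 * (s : ℝ) ^ 2 * Real.log d := by
          have : (1 : ℝ) ≤ (s : ℝ) ^ 2 := one_le_pow₀ hs1
          nlinarith
        have e : (2 * κ * l + 5) * (s : ℝ) ^ 2 * Real.log d
            = 2 * (k * (l * Real.log d)) + 5 * (s : ℝ) ^ 2 * Real.log d := by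
          rw [hkr]; ring
        linarith

/-- The probabilities of the exceptional events add up to at most `1 / d`, because `46 < e⁴`. -/
theorem tail_sum_le (hd : 1 ≤ Real.log d) (hd0 : (0 : ℝ) < d) :
    8 * Real.exp (-(5 * Real.log d)) + 38 * (d : ℝ) ^ 2 * Real.exp (-(9 * Real.log d))
      ≤ Real.exp (-1 * Real.log d) := by
  have h1 : (d : ℝ) ^ 2 = Real.exp (2 * Real.log d) := by
    rw [mul_comm, Real.exp_mul, Real.exp_log hd0]; norm_num
  have h2 : 38 * (d : ℝ) ^ 2 * Real.exp (-(9 * Real.log d))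
      ≤ 38 * Real.exp (-(5 * Real.log d)) := by
    rw [h1, mul_assoc, ← Real.exp_add]
    gcongr
    linarith
  have h3 : Real.exp (-1 * Real.log d)
      = Real.exp (4 * Real.log d) * Real.exp (-(5 * Real.log d)) := by
    rw [← Real.exp_add]; congr 1; ring
  have h4 : (46 : ℝ) ≤ Real.exp (4 * Real.log d) := by
    have h5 : Real.exp 4 ≤ Real.exp (4 * Real.log d) := Real.exp_le_exp.2 (by linarith)
    have h6 : Real.exp 4 = Real.exp 1 ^ 4 := by rw [← Real.exp_nat_mul]; norm_num
    have h7 : (2.7 : ℝ) ^ 4 ≤ Real.exp 1 ^ 4 := by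
      gcongr
      linarith [Real.exp_one_gt_d9]
    norm_num at h7
    linarith
  rw [h3]
  have := mul_le_mul_of_nonneg_right h4 (Real.exp_pos (-(5 * Real.log d))).le
  linarith

end Transfer

end SparseSIR

theorem theorem1 (c : ℝ) (hc : 0 < c) :
    ∃ κ : ℕ, 0 < κ ∧ ∀ L : ℝ, 0 < L →
    ∃ C C₁ C₂ C₃ C₄ : ℝ, 0 < C ∧ 0 < C₁ ∧ 0 < C₂ ∧ 0 < C₃ ∧ 0 < C₄ ∧
    ∀ τ : ℕ → ℝ, Tendsto τ atTop (𝓝 0) →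
    ∃ n₀ : ℕ, ∀ (n d K s : ℕ),
    n₀ ≤ n → 0 < K → K < s → (K : ℝ) < Real.log d →
    ∀ (P : Measure ((Fin d → ℝ) × ℝ)) [IsProbabilityMeasure P]
      (β : Matrix (Fin d) (Fin K) ℝ) (B lamK ρ A : ℝ),
    -- the response is bounded, and the inverse regression curve is of the assumed smoothness
    0 < B → (∀ᵐ z ∂P, z.2 ∈ Set.Icc (-B) B) →
    (∃ m : ℝ → Fin d → ℝ, SparseSIR.IsInverseRegressionCurve P m ∧
      SparseSIR.HasVariationRate B τ m) →
    -- the covariates are sub-Gaussian and the sparse eigenvalues are bounded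
    SparseSIR.IsSubGaussianX P L →
    SparseSIR.SparseEigenvaluesIn (SparseSIR.covX P) (κ * s ^ 2) c →
    -- the sufficient dimension reduction model with its linearity condition
    SparseSIR.IsDimensionReduction P β →
    SparseSIR.LinearityCondition P β →
    SparseSIR.sparsityLevel (SparseSIR.colSpan β) = s →
    SparseSIR.IsKthGenEigenvalue (SparseSIR.covCondMean P) (SparseSIR.covX P) K lamK →
    0 < lamK →
    -- sample size, dimension and tuning parameter
    C * (s : ℝ) ^ 2 * Real.log d / lamK ^ 2 < n →
    lamK * (K : ℝ) ^ 2 < s * Real.log d →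
    C₁ * Real.sqrt (Real.log d / n) ≤ ρ →
    ρ ≤ A * Real.sqrt (Real.log d / n) →
    -- independent observations with law `P`
    ∀ {Ω : Type*} [MeasurableSpace Ω] (pr : Measure Ω) [IsProbabilityMeasure pr]
      (D : Fin n → Ω → (Fin d → ℝ) × ℝ),
    (∀ i, Measurable (D i)) → iIndepFun D pr → (∀ i, pr.map (D i) = P) →
    -- the bound fails, for some solution, with at most the stated probability
    pr {ω | ¬ ∀ (Q : Matrix (Fin d) (Fin d) ℝ) (W : Submodule ℝ (EuclideanSpace ℝ (Fin d))),
        SparseSIR.IsSIRSolution (fun i => D i ω) K ρ Q →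
        SparseSIR.IsLeadingEigenspace Q K W →
        SparseSIR.subspaceDist (SparseSIR.colSpan β) W ≤
          C₂ * A * s * Real.sqrt (Real.log d / n) / lamK}
      ≤ ENNReal.ofReal (Real.exp (-C₃ * s) + Real.exp (-C₄ * Real.log d)) := by
  -- `24 c²` is `6 φ₂ / φ₁` for the bounds `φ₁ = 1 / (2 c)`, `φ₂ = 2 c` on the sparse eigenvalues of
  -- the sample covariance matrix
  obtain ⟨k₀, hk₀⟩ : ∃ k₀ : ℕ, k₀ = ⌈(24 * c ^ 2) ^ 2⌉₊ + 36 := ⟨_, rfl⟩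
  have hk₀r : (24 * c ^ 2) ^ 2 + 36 ≤ (k₀ : ℝ) := by
    rw [hk₀]; push_cast; gcongr; exact Nat.le_ceil _
  have hk24 : 24 * c ^ 2 ≤ √(k₀ : ℝ) := Real.le_sqrt_of_sq_le (by linarith)
  have hk6 : 6 ≤ √(k₀ : ℝ) := Real.le_sqrt_of_sq_le (by nlinarith [sq_nonneg (24 * c ^ 2)])
  have hratio : 6 * (2 * c) ≤ 1 / (2 * c) * √(k₀ : ℝ) := by
    rw [div_mul_eq_mul_div, le_div_iff₀ (by positivity)]
    linarith
  refine ⟨k₀ + 1, by omega, fun L hL => ?_⟩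
  -- a common sub-Gaussian norm of the constant `1`, the linear forms of variance at most `c`, and the
  -- residuals, which account for the factor `2`
  obtain ⟨L₀, hL₀⟩ : ∃ L₀, L₀ = max 1 (2 * (L * √c)) := ⟨_, rfl⟩
  have hL₀1 : 1 ≤ L₀ := by rw [hL₀]; exact le_max_left _ _
  have hL₀2 : L * √c ≤ L₀ / 2 := by
    have : 2 * (L * √c) ≤ L₀ := by rw [hL₀]; exact le_max_right _ _
    linarith
  have hL₀0 : 0 < L₀ := by linarith
  have hcov := SparseSIR.covDeviationConst_pos hL₀0 zero_le_one
  have hent := SparseSIR.entryDeviationConst_pos (q := 9) hL₀0 (by norm_num)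
  obtain ⟨M, hM⟩ : ∃ M, M = SparseSIR.covDeviationConst L₀ 1 := ⟨_, rfl⟩
  rw [← hM] at hcov
  -- the deviation on the net that keeps the sparse eigenvalues within a factor `2`
  obtain ⟨η, hη⟩ : ∃ η, η = 1 / (4 * c * M + 1) := ⟨_, rfl⟩
  have hη0 : 0 < η := by rw [hη]; positivity
  have hη1 : η ≤ 1 := by
    rw [hη, div_le_one (by positivity)]
    have : 0 < 4 * c * M := by positivity
    linarith
  have hηc : 2 * (M * η) ≤ 1 / (2 * c) := by
    rw [hη, mul_one_div, ← mul_div_assoc, div_le_div_iff₀ (by positivity) (by positivity)]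
    linarith
  obtain ⟨κ, hκ⟩ : ∃ κ : ℕ, κ = k₀ + 1 := ⟨_, rfl⟩
  have hκ0 : 0 < κ := by omega
  have hκ1 : (1 : ℝ) ≤ κ := by exact_mod_cast hκ0
  obtain ⟨C₀, hC₀⟩ : ∃ C₀, C₀ = 2 * κ * (Real.log (9 * κ) + 3) + 5 := ⟨_, rfl⟩
  have hC₀5 : 5 ≤ C₀ := by
    have : 0 ≤ Real.log (9 * κ) := Real.log_nonneg (by linarith)
    have : 0 ≤ 2 * κ * (Real.log (9 * κ) + 3) := by positivity
    linarith
  refine ⟨C₀ / η ^ 2, 2 * SparseSIR.entryDeviationConst L₀ 9,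
    192 * (2 * c) / (1 / (2 * c)) ^ 2, 1, 1, by positivity, by positivity, by positivity,
    one_pos, one_pos, fun τ hτ => ?_⟩
  obtain ⟨n₀, hn₀⟩ := eventually_atTop.1 (hτ.eventually_le_const zero_lt_one)
  refine ⟨n₀, ?_⟩
  intro n d K s hn hK hKs hKd P _ β B lamK ρ A hB hBy hm hsubG hsparse hdr hlin hs hgen hlam hsize
    _ hρ1 hρ2 Ω _ pr _ D hD hind hlaw
  obtain ⟨m, hm, hvar⟩ := hm
  rw [← hκ] at hsparse
  -- elementary consequences of the assumptions on the sizes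
  have hlogd : 1 ≤ Real.log d := by
    have : (1 : ℝ) ≤ K := by exact_mod_cast hK
    linarith
  have hsd : s ≤ d := by
    rw [← hs, SparseSIR.sparsityLevel]
    exact (Set.ncard_le_ncard (Set.subset_univ _)).trans (by simp [Set.ncard_univ])
  have hs0 : 0 < s := by omega
  have hs1 : (1 : ℝ) ≤ s := by exact_mod_cast hs0
  have hd0 : 0 < d := by omega
  have hform := hsparse.sparseFormBounds
  have hks : 0 < κ * s ^ 2 := by positivity
  have hdiag := hform.diag_mem hks
  have hc1 : 1 ≤ c := by
    have h := (hdiag ⟨0, hd0⟩).1.trans (hdiag ⟨0, hd0⟩).2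
    by_contra! hlt
    exact absurd ((one_lt_inv₀ hc).2 hlt) (not_lt.2 (h.trans hlt.le))
  have hc12 : 1 / (2 * c) ≤ 2 * c := by
    have : 1 / (2 * c) ≤ 1 := (div_le_one (by positivity)).2 (by linarith)
    linarith
  have hmem := hsubG.memLp
  obtain ⟨U, μ, hU, hA, hμlam, hμ1, hlam1, hspan⟩ :=
    SparseSIR.exists_population_factorization hmem hK hdr hlin hgen hlam
  have hsize' : C₀ / η ^ 2 * (s : ℝ) ^ 2 * Real.log d ≤ n := by
    refine le_trans ?_ hsize.le
    rw [le_div_iff₀ (by positivity)]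
    refine mul_le_of_le_one_right (by positivity) ?_
    exact pow_le_one₀ hlam.le hlam1
  have hnet : C₀ * (s : ℝ) ^ 2 * Real.log d ≤ n * η ^ 2 := by
    have h := mul_le_mul_of_nonneg_right hsize' (sq_nonneg η)
    refine le_trans (le_of_eq ?_) h
    field_simp
  have hns : (s : ℝ) ^ 2 * Real.log d ≤ n := by
    have h1 : n * η ^ 2 ≤ n := mul_le_of_le_one_right (Nat.cast_nonneg _) (pow_le_one₀ hη0.le hη1)
    have h2 : 0 ≤ (s : ℝ) ^ 2 * Real.log d := by positivity
    have h3 : 1 * ((s : ℝ) ^ 2 * Real.log d) ≤ C₀ * ((s : ℝ) ^ 2 * Real.log d) :=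
      mul_le_mul_of_nonneg_right (by linarith) h2
    linarith
  have hdn : Real.log d ≤ n := by
    exact (le_mul_of_one_le_left (by linarith) (one_le_pow₀ hs1)).trans hns
  have hnr : (0 : ℝ) < n := by linarith
  have hn0 : 0 < n := by exact_mod_cast hnr
  obtain ⟨r, hr⟩ : ∃ r, r = √(Real.log d / n) := ⟨_, rfl⟩
  have hr0 : 0 < r := by rw [hr]; exact Real.sqrt_pos.2 (by positivity)
  have hKr : K * √(Real.log d / n) ≤ 1 := by
    have hKs' : (K : ℝ) ≤ s := by exact_mod_cast hKs.le
    rw [← abs_of_nonneg (by positivity : 0 ≤ K * √(Real.log d / n)), ← sq_le_one_iff_abs_le_one,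
      mul_pow, Real.sq_sqrt (by positivity), ← mul_div_assoc, div_le_one hnr]
    refine le_trans ?_ hns
    gcongr
  have hρ0 : 0 < ρ := by
    refine lt_of_lt_of_le ?_ hρ1
    rw [← hr]; positivity
  have hcentred : ∀ v : Fin d → ℝ, v ⬝ᵥ (SparseSIR.covX P *ᵥ v) ≤ c →
      SparseSIR.SubGaussianNormLE (SparseSIR.centredForm P v) (L₀ / 2) P := by
    intro v hv
    refine SparseSIR.SubGaussianNormLE.mono (hsubG v) (le_trans ?_ hL₀2)
    gcongr
  -- the two events on which the deterministic bound applies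
  have b1 := SparseSIR.measure_not_sparse_sampleCov_le (k := κ * s ^ 2) hn0 hD hind hlaw hmem hL₀1
    (fun I hI v hvI hv1 => (hcentred v (by
      exact (hform I hI v hvI).2.trans (mul_le_of_le_one_right hc.le hv1))).mono (by linarith))
    (q := 1) hη0.le hη1
  have b2 := SparseSIR.measure_not_forall_entry_le hn0 hD hind hlaw hmem hBy hm hvar (hn₀ n hn) hU
    hA (fun k => hlam.le.trans (hμlam k)) hμ1 hc1 (fun j => (hdiag j).2) hL₀1 hcentred hlogd hdn
    (hKs.le.trans hsd) hKr (q := 9) (by norm_num)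
  have hcount := SparseSIR.net_bound_le (η := η) hκ0 hs0 hsd hlogd (by rw [← hC₀]; exact hnet)
  refine (measure_mono (t := _ ∪ _) ?_).trans ((measure_union_le _ _).trans
    ((add_le_add (b1.trans (ENNReal.ofReal_le_ofReal hcount)) b2).trans ?_))
  · intro ω hω
    by_contra hgood
    simp only [Set.mem_union, not_or, Set.mem_ofPred_eq, not_not] at hgood
    obtain ⟨g1, g2⟩ := hgood
    refine hω fun Q W hQ hW => ?_
    rw [← hM] at g1
    -- the rows of `U` vanish outside the support of the projection
    obtain ⟨J, hJ⟩ : ∃ J : Finset (Fin d), J = (Set.toFinite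
      {j | SparseSIR.projMatrix (SparseSIR.colSpan β) j j ≠ 0}).toFinset := ⟨_, rfl⟩
    have hJs : J.card = s := by
      rw [hJ, ← Set.ncard_eq_toFinset_card, ← hs]; rfl
    have hUJ : ∀ i ∉ J, ∀ k, U i k = 0 := by
      intro i hi k
      refine SparseSIR.eq_zero_of_projMatrix_diag_eq_zero ?_ k
      rw [hspan]
      by_contra h0
      exact hi (by rw [hJ]; simpa using h0)
    have hJk : J.card ≤ κ * s ^ 2 := by
      rw [hJs, sq, ← mul_assoc]
      exact Nat.le_mul_of_pos_left s (by positivity)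
    have hbound := SparseSIR.subspaceDist_le_of_deviation (SparseSIR.sampleCov_posSemidef _)
      hK hlam hρ0 hμlam hs0 (k₀ := k₀) (by omega) (φ₁ := 1 / (2 * c)) (φ₂ := 2 * c) (by positivity)
      hc12
      (by rw [← hκ]; exact hform.of_deviation hc1 hηc g1)
      hratio hk6 hJs.le hUJ
      (SparseSIR.half_le_form_of_deviation hform hc1 hηc g1 hU hJk hUJ)
      (fun i j => (g2 i j).trans (by linarith)) hQ.1 hQ.2 hW
    rw [hspan] at hbound
    refine hbound.trans ?_
    calc 192 * (2 * c) / (1 / (2 * c)) ^ 2 * (ρ * s / lamK)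
        ≤ 192 * (2 * c) / (1 / (2 * c)) ^ 2 * (A * √(Real.log d / n) * s / lamK) := by gcongr
      _ = 192 * (2 * c) / (1 / (2 * c)) ^ 2 * A * s * √(Real.log d / n) / lamK := by ring
  · rw [← ENNReal.ofReal_add (by positivity) (by positivity)]
    refine ENNReal.ofReal_le_ofReal ?_
    have h := SparseSIR.tail_sum_le hlogd (by exact_mod_cast hd0)
    have := Real.exp_pos (-1 * (s : ℝ))
    linarith
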